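/- **Setting.** Manifolds are finite-dimensional, smooth, Hausdorff and second countable. Let $(S,\omega)$ be a symplectic manifold and $H:S\to\mathbb R$ a smooth function; $X_f$ is defined by $i_{X_f}\omega=df$ and $\{f,g\}_S=\omega(X_f,X_g)$. Let $\mathbb R^\times$ be either $\mathbb R^+$ or $\mathbb R\setminus\{0\}$, let $\phi$ be a principal action of $\mathbb R^\times$ on $S$ with $\phi_s^*\omega=s\,\omega$ and $H\circ\phi_s=sH$ (a scaling symmetry), and let $\Phi$ be a principal action of a Lie group $G$ on $S$ with $\Phi_g^*\omega=\omega$ and $H\circ\Phi_g=H$, such that $\Phi_g\circ\phi_s=\phi_s\circ\Phi_g$ for all $g,s$. Here an action is principal if it is smooth and free and its orbit space is a manifold over which the quotient map is a locally trivial principal bundle. Assume that the induced actions of $\mathbb R^\times$ on $P=S/G$ and of $G$ on $C=S/\mathbb R^\times$ are principal as well. A Kirillov structure on a real line bundle $V\to B$ is a Lie bracket $[\cdot,\cdot]$ on $\Gamma(V^*)$ such that for every $h_2\in\Gamma(V^*)$ there is a smooth vector field $X_{h_2}$ on $B$ (the symbol, or Hamiltonian vector field, of $h_2$) with $[fh_1,h_2]=f[h_1,h_2]+X_{h_2}(f)\,h_1$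 for all $f\in C^\infty(B)$, $h_1\in\Gamma(V^*)$. *First $G$, then $\mathbb R^\times$.* $P=S/G$ has the Poisson bracket with $\{f_1,f_2\}_P\circ\wp_S=\{f_1\circ\wp_S,f_2\circ\wp_S\}_S$, and the function $H^G$ with $H^G\circ\wp_S=H$, where $\wp_S:S\to P$ is the projection. Let $L=(P\times\mathbb R)/\mathbb R^\times\to P/\mathbb R^\times$ be the quotient by $s\cdot(y,t)=(sy,t/s)$. A section $h$ of $L^*$ corresponds to the homogeneous function $H_h(y)=h([y])([y,1])$ on $P$. The bracket on $\Gamma(L^*)$ is given by $H_{[h_1,h_2]_{L^*}}=-\{H_{h_1},H_{h_2}\}_P$, and the section $h_{H^G}$ by $H_{h_{H^G}}=H^G$. *First $\mathbb R^\times$, then $G$.* Let $p_S:S\to C=S/\mathbb R^\times$ be the projection, $\Delta$ the infinitesimal generator of $\phi$, $\lambda=-i_\Delta\omega$, $\mathcal D=Tp_S(\ker\lambda)$, and $\mathcal D^\circ\subset T^*C$ the annihilator of $\mathcal D$, a line bundle over $C$. For $x\in S$ let $\alpha_x\in\mathcal D^\circ_{p_S(x)}$ be the covector with $\alpha_x\circ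 T_xp_S=\lambda_x$. A section $h$ of $(\mathcal D^\circ)^*$ corresponds to the homogeneous function $H_h(x)=h(p_S(x))(\alpha_x)$ on $S$. The bracket on $\Gamma((\mathcal D^\circ)^*)$ is given by $H_{[h_1,h_2]}=-\{H_{h_1},H_{h_2}\}_S$, and the section $h_H$ by $H_{h_H}=H$. The group $G$ acts on $\mathcal D^\circ$ by cotangent lift, with quotient line bundle $\mathcal D^\circ/G\to C/G$; every section of $(\mathcal D^\circ/G)^*$ is induced by a ($G$-invariant) section $h$ of $(\mathcal D^\circ)^*$, and is then denoted by $h^G$. The bracket on $\Gamma((\mathcal D^\circ/G)^*)$ is given by $[h_1^G,h_2^G]=([h_1,h_2])^G$, and $h_H^G$ is the section induced by $h_H$. **Theorem.** These brackets and sections exist, the brackets are Kirillov structures on $L$, $\mathcal D^\circ$ and $\mathcal D^\circ/G$, and: 1. There is an isomorphism of real line bundles $(\Psi,\psi)$ from $L\to (S/G)/\mathbb R^\times$ to $\mathcal D^\circ/G\to (S/\mathbb R^\times)/G$, with $\psi$ a diffeomorphism, given by $\psi([[x]])=[[x]]$ and $\Psi([[x],t])=[t\,\alpha_x]$ for $x\in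 S$, $t\in\mathbb R$. 2. $h_{H^G}=\Psi^*\circ h_H^G\circ\psi$. 3. $[\Psi^*\circ k_1\circ\psi,\ \Psi^*\circ k_2\circ\psi]_{L^*}=\Psi^*\circ[k_1,k_2]\circ\psi$ for all sections $k_1,k_2$ of $(\mathcal D^\circ/G)^*$, with the bracket of $\Gamma((\mathcal D^\circ/G)^*)$ on the right. 4. The Hamiltonian vector fields $X_{h_{H^G}}$ on $(S/G)/\mathbb R^\times$ and $X_{h_H^G}$ on $(S/\mathbb R^\times)/G$ are $\psi$-related: $T\psi\circ X_{h_{H^G}}=X_{h_H^G}\circ\psi$. So both orders of reduction give equivalent Kirillov Hamiltonian systems. -/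

import Mathlib

open scoped Manifold ContDiff
open Bundle

/-! ### The multiplicative group -/

section ScalingGroup

variable (Γ : Subgroup ℝˣ) [Fact (Γ = ⊤ ∨ Γ = Units.posSubgroup ℝ)]

/-- The coordinate `s ↦ (s : ℝ)` on `Γ`, where `Γ` is `ℝ ∖ {0}` or `(0, ∞)`. -/
def scalingCoord {Γ : Subgroup ℝˣ} (s : Γ) : ℝ := ((s : ℝˣ) : ℝ)

theorem isOpenEmbedding_scalingCoord :
    Topology.IsOpenEmbedding (scalingCoord : Γ → ℝ) := by
  have hopen : IsOpen (Γ : Set ℝˣ) := by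
    rcases (Fact.out : Γ = ⊤ ∨ Γ = Units.posSubgroup ℝ) with h | h
    · rw [h]; exact isOpen_univ
    · have : (Γ : Set ℝˣ) = (fun u : ℝˣ => (u : ℝ)) ⁻¹' Set.Ioi 0 := by
        ext u; rw [h]; simp [Units.mem_posSubgroup]
      rw [this]
      exact isOpen_Ioi.preimage Units.continuous_val
  exact Units.isOpenEmbedding_val.comp hopen.isOpenEmbedding_subtypeVal

/-- `Γ` is an open submanifold of `ℝ`. -/
noncomputable instance : ChartedSpace ℝ Γ :=
  (isOpenEmbedding_scalingCoord Γ).singletonChartedSpace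

instance : IsManifold 𝓘(ℝ, ℝ) ∞ Γ :=
  (isOpenEmbedding_scalingCoord Γ).isManifold_singleton

theorem contMDiff_scalingCoord :
    ContMDiff 𝓘(ℝ, ℝ) 𝓘(ℝ, ℝ) ∞ (scalingCoord : Γ → ℝ) :=
  contMDiff_isOpenEmbedding (isOpenEmbedding_scalingCoord Γ)

instance : LieGroup 𝓘(ℝ, ℝ) ∞ Γ where
  contMDiff_mul := by
    apply ContMDiff.of_comp_isOpenEmbedding (isOpenEmbedding_scalingCoord Γ)
    have : (scalingCoord : Γ → ℝ) ∘ (fun x : Γ × Γ => x.1 * x.2) =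
      fun x : Γ × Γ => scalingCoord x.1 * scalingCoord x.2 := by ext; simp [scalingCoord]
    rw [this]
    exact ((contMDiff_scalingCoord Γ).comp contMDiff_fst).mul
      ((contMDiff_scalingCoord Γ).comp contMDiff_snd)
  contMDiff_inv := by
    apply ContMDiff.of_comp_isOpenEmbedding (isOpenEmbedding_scalingCoord Γ)
    have : (scalingCoord : Γ → ℝ) ∘ (fun x : Γ => x⁻¹) =
      fun x : Γ => (scalingCoord x)⁻¹ := by ext; simp [scalingCoord]
    rw [this]
    intro x
    have h : ContMDiffAt 𝓘(ℝ, ℝ) 𝓘(ℝ, ℝ) ∞ (fun r : ℝ => r⁻¹) (scalingCoord x) := by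
      rw [contMDiffAt_iff_contDiffAt]
      exact contDiffAt_inv ℝ (by simp [scalingCoord])
    exact h.comp x (contMDiff_scalingCoord Γ x)

end ScalingGroup

section orb
/-- The orbit space `M/G`, with the quotient topology. -/
abbrev Orb (G M : Type*) [Group G] [MulAction G M] : Type _ := MulAction.orbitRel.Quotient G M

/-- The projection `M → M/G`. -/
abbrev orb (G : Type*) {M : Type*} [Group G] [MulAction G M] (x : M) : Orb G M :=
  Quotient.mk _ x

variable {G H M : Type*} [Group G] [Group H] [MulAction G M] [MulAction H M]

theorem orb_eq_orb {x y : M} : orb G x = orb G y ↔ ∃ g : G, g • y = x := by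
  rw [Quotient.eq]; exact Iff.rfl

/-- The action of `H` induced on `M/G` when the actions of `G` and `H` commute. -/
instance [SMulCommClass G H M] : MulAction H (Orb G M) where
  smul h := Quotient.map (fun x => h • x) (by
    rintro _ y ⟨g, rfl⟩
    exact ⟨g, smul_comm g h y⟩)
  one_smul := by
    rintro ⟨x⟩
    exact congrArg (orb G) (one_smul H x)
  mul_smul := by
    rintro h h' ⟨x⟩
    exact congrArg (orb G) (mul_smul h h' x)

theorem smul_orb [SMulCommClass G H M] (h : H) (x : M) : h • orb G x = orb G (h • x) := rfl

theorem exists_smul_orb_eq_out [SMulCommClass H G M] (x : M) (b : Orb G (Orb H M))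
    (hx : orb G (orb H x) = b) : ∃ g : G, orb H (g • x) = b.out :=
  orb_eq_orb.mp ((Quotient.out_eq b).trans hx.symm)
end orb


section sympl
variable {E : Type*} [NormedAddCommGroup E] [NormedSpace ℝ E] {M : Type*} [TopologicalSpace M] [ChartedSpace E M]

/-- The differential of a function, as a covector. -/
noncomputable def differential (f : M → ℝ) (x : M) : TangentSpace 𝓘(ℝ, E) x →L[ℝ] ℝ :=
  mfderiv 𝓘(ℝ, E) 𝓘(ℝ, ℝ) f x

/-- Smoothness of a vector field. -/
def IsSmoothField [IsManifold 𝓘(ℝ, E) ∞ M] (X : ∀ x : M, TangentSpace 𝓘(ℝ, E) x) : Prop :=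
  ContMDiff 𝓘(ℝ, E) 𝓘(ℝ, E).tangent ∞ (fun x => (⟨x, X x⟩ : TangentBundle 𝓘(ℝ, E) M))

/-- The 2-form is closed: its exterior derivative, expressed by the values on smooth vector
fields, vanishes. -/
def IsClosedForm [IsManifold 𝓘(ℝ, E) ∞ M]
    (form : ∀ x : M, TangentSpace 𝓘(ℝ, E) x →L[ℝ] TangentSpace 𝓘(ℝ, E) x →L[ℝ] ℝ) :
    Prop :=
  ∀ X Y Z : (∀ x : M, TangentSpace 𝓘(ℝ, E) x),
    IsSmoothField X → IsSmoothField Y → IsSmoothField Z → ∀ x,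
    differential (fun y => form y (Y y) (Z y)) x (X x)
      - differential (fun y => form y (X y) (Z y)) x (Y x)
      + differential (fun y => form y (X y) (Y y)) x (Z x)
      - form x (VectorField.mlieBracket 𝓘(ℝ, E) X Y x) (Z x)
      + form x (VectorField.mlieBracket 𝓘(ℝ, E) X Z x) (Y x)
      - form x (VectorField.mlieBracket 𝓘(ℝ, E) Y Z x) (X x) = 0

variable (E M) in
/-- A symplectic form: a smooth non-degenerate closed 2-form. -/
structure SymplecticForm [IsManifold 𝓘(ℝ, E) ∞ M] where
  form : ∀ x : M, TangentSpace 𝓘(ℝ, E) x →L[ℝ] TangentSpace 𝓘(ℝ, E) x →L[ℝ] ℝ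
  contMDiff_form : ContMDiff 𝓘(ℝ, E) (𝓘(ℝ, E).prod 𝓘(ℝ, E →L[ℝ] E →L[ℝ] ℝ)) ∞
    (fun x => TotalSpace.mk' (E →L[ℝ] E →L[ℝ] ℝ)
      (E := fun x : M => TangentSpace 𝓘(ℝ, E) x →L[ℝ] TangentSpace 𝓘(ℝ, E) x →L[ℝ] ℝ) x (form x))
  skew : ∀ x v w, form x v w = - form x w v
  nondegenerate : ∀ x v, (∀ w, form x v w = 0) → v = 0
  closed : IsClosedForm form
end sympl

section principal

variable {EG E EB G M : Type*}
  [NormedAddCommGroup EG] [NormedSpace ℝ EG] [NormedAddCommGroup E] [NormedSpace ℝ E]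
  [NormedAddCommGroup EB] [NormedSpace ℝ EB]
  [Group G] [TopologicalSpace G] [ChartedSpace EG G]
  [TopologicalSpace M] [ChartedSpace E M] [MulAction G M] [ChartedSpace EB (Orb G M)]

variable (EG E EB G M) in
/-- The action of `G` on `M` is principal, and the given manifold structure on the orbit space is
that of the quotient: the action is smooth and free, the projection `M → M/G` is smooth, and it is
a locally trivial principal bundle. A local trivialization over `U` is given by a section `σ`,
smooth on `U`, and by the smooth map `τ` with `x = τ x • σ [x]`; the trivialization is
`x ↦ ([x], τ x)`, with inverse `(c, g) ↦ g • σ c`. The values of `σ` and `τ` off `U` and its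
preimage play no role. -/
structure IsPrincipalAction : Prop where
  contMDiff_smul : ContMDiff (𝓘(ℝ, EG).prod 𝓘(ℝ, E)) 𝓘(ℝ, E) ∞ (fun p : G × M => p.1 • p.2)
  contMDiff_orb : ContMDiff 𝓘(ℝ, E) 𝓘(ℝ, EB) ∞ (orb G : M → Orb G M)
  free : ∀ (g : G) (x : M), g • x = x → g = 1
  locally_trivial : ∀ b : Orb G M, ∃ U : Set (Orb G M), IsOpen U ∧ b ∈ U ∧
    ∃ σ : Orb G M → M, (∀ c, orb G (σ c) = c) ∧ ContMDiffOn 𝓘(ℝ, EB) 𝓘(ℝ, E) ∞ σ U ∧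
    ∃ τ : M → G, ContMDiffOn 𝓘(ℝ, E) 𝓘(ℝ, EG) ∞ τ (orb G ⁻¹' U) ∧
      ∀ x, orb G x ∈ U → τ x • σ (orb G x) = x

namespace IsPrincipalAction

theorem smul_left_injective (h : IsPrincipalAction EG E EB G M)
    {g g' : G} {x : M} (e : g • x = g' • x) : g = g' := by
  have : (g'⁻¹ * g) • x = x := by rw [mul_smul, e, inv_smul_smul]
  have := h.free _ _ this
  exact (inv_mul_eq_one.mp this).symm

theorem contMDiff_const_smul (h : IsPrincipalAction EG E EB G M)
    [IsManifold 𝓘(ℝ, E) ∞ M] (g : G) : ContMDiff 𝓘(ℝ, E) 𝓘(ℝ, E) ∞ (fun x : M => g • x) :=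
  h.contMDiff_smul.comp (contMDiff_const.prodMk contMDiff_id)

/-- The group element relating two smooth maps with the same projection is smooth. -/
theorem exists_div (h : IsPrincipalAction EG E EB G M)
    [LieGroup 𝓘(ℝ, EG) ∞ G] {EN N : Type*} [NormedAddCommGroup EN] [NormedSpace ℝ EN] [TopologicalSpace N]
    [ChartedSpace EN N] {U : Set N} (hU : IsOpen U) {a b : N → M}
    (ha : ContMDiffOn 𝓘(ℝ, EN) 𝓘(ℝ, E) ∞ a U) (hb : ContMDiffOn 𝓘(ℝ, EN) 𝓘(ℝ, E) ∞ b U)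
    (hab : ∀ n ∈ U, orb G (a n) = orb G (b n)) :
    ∃ g : N → G, ContMDiffOn 𝓘(ℝ, EN) 𝓘(ℝ, EG) ∞ g U ∧ ∀ n ∈ U, b n = g n • a n := by
  classical
  have key : ∀ n : N, ∃ g : G, n ∈ U → b n = g • a n := by
    intro n
    by_cases hn : n ∈ U
    · obtain ⟨g, hg⟩ := orb_eq_orb.mp (hab n hn).symm
      exact ⟨g, fun _ => hg.symm⟩
    · exact ⟨1, fun h => absurd h hn⟩
  choose g hg using key
  refine ⟨g, ?_, hg⟩
  intro n hn
  obtain ⟨V, hV, hnV, σ, hσ, -, τ, hτ, hτσ⟩ := h.locally_trivial (orb G (a n))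
  have haC : ContMDiffAt 𝓘(ℝ, EN) 𝓘(ℝ, E) ∞ a n := ha.contMDiffAt (hU.mem_nhds hn)
  have hbC : ContMDiffAt 𝓘(ℝ, EN) 𝓘(ℝ, E) ∞ b n := hb.contMDiffAt (hU.mem_nhds hn)
  have hopen : IsOpen (orb G ⁻¹' V : Set M) := hV.preimage h.contMDiff_orb.continuous
  have h1 : ContMDiffAt 𝓘(ℝ, EN) 𝓘(ℝ, EG) ∞ (fun m => τ (a m)) n :=
    (hτ.contMDiffAt (hopen.mem_nhds hnV)).comp n haC
  have h2 : ContMDiffAt 𝓘(ℝ, EN) 𝓘(ℝ, EG) ∞ (fun m => τ (b m)) n :=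
    (hτ.contMDiffAt (hopen.mem_nhds (by simpa [← hab n hn] using hnV))).comp n hbC
  have h3 : ContMDiffAt 𝓘(ℝ, EN) 𝓘(ℝ, EG) ∞ (fun m => τ (b m) * (τ (a m))⁻¹) n := h2.mul h1.inv
  refine (h3.congr_of_eventuallyEq ?_).contMDiffWithinAt
  filter_upwards [hU.mem_nhds hn, haC.continuousAt.preimage_mem_nhds (hopen.mem_nhds hnV)]
    with m hm hmV
  have hmV' : orb G (a m) ∈ V := hmV
  apply h.smul_left_injective (x := a m)
  rw [← hg m hm, mul_smul]
  have e1 := hτσ (a m) hmV'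
  have e2 := hτσ (b m) (by rw [← hab m hm]; exact hmV')
  have : (τ (a m))⁻¹ • a m = σ (orb G (a m)) := by rw [inv_smul_eq_iff, e1]
  rw [this, hab m hm, e2]

end IsPrincipalAction
end principal

section frames

variable {EB B : Type*} [NormedAddCommGroup EB] [NormedSpace ℝ EB] [TopologicalSpace B]
  [ChartedSpace EB B]

variable (EB) in
/-- Local frames of a family of one-dimensional spaces, through their coordinates: `coord i b` is
the coordinate of `V b` with respect to the `i`-th frame, defined over the open set `dom i`, and
the changes of frame are smooth. -/
structure LineFrames (V : B → Type*) [∀ b, AddCommGroup (V b)] [∀ b, Module ℝ (V b)]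
    [∀ b, TopologicalSpace (V b)] where
  dom : B → Set B
  isOpen_dom : ∀ i, IsOpen (dom i)
  mem_dom : ∀ i, i ∈ dom i
  coord : ∀ i b : B, V b ≃L[ℝ] ℝ
  contMDiffOn_coord : ∀ i j, ContMDiffOn 𝓘(ℝ, EB) 𝓘(ℝ, ℝ) ∞
    (fun b => coord j b ((coord i b).symm 1)) (dom i ∩ dom j)

namespace LineFrames

variable {V : B → Type*} [∀ b, AddCommGroup (V b)] [∀ b, Module ℝ (V b)]
    [∀ b, TopologicalSpace (V b)] (Φ : LineFrames EB V)

/-- The local trivialization of a frame. -/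
noncomputable def pretriv (i : B) : Pretrivialization ℝ (π ℝ V) where
  toFun v := (v.1, Φ.coord i v.1 v.2)
  invFun p := ⟨p.1, (Φ.coord i p.1).symm p.2⟩
  source := π ℝ V ⁻¹' Φ.dom i
  target := Φ.dom i ×ˢ Set.univ
  map_source' v hv := ⟨hv, trivial⟩
  map_target' p hp := hp.1
  left_inv' v _ := by simp
  right_inv' p _ := by simp
  open_target := (Φ.isOpen_dom i).prod isOpen_univ
  baseSet := Φ.dom i
  open_baseSet := Φ.isOpen_dom i
  source_eq := rfl
  target_eq := rfl
  proj_toFun _ _ := rfl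

theorem pretriv_symm (i b : B) (hb : b ∈ Φ.dom i) (r : ℝ) :
    (Φ.pretriv i).symm b r = (Φ.coord i b).symm r := by
  have := (Φ.pretriv i).symm_apply hb r
  rw [this]
  rfl

theorem coord_eq (i j b : B) (r : ℝ) :
    Φ.coord j b ((Φ.coord i b).symm r) = Φ.coord j b ((Φ.coord i b).symm 1) * r := by
  have : (Φ.coord i b).symm r = r • (Φ.coord i b).symm 1 := by
    rw [← map_smul, smul_eq_mul, mul_one]
  rw [this, map_smul, smul_eq_mul, mul_comm]

/-- The vector bundle with prescribed smooth local frames. -/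
noncomputable def prebundle : VectorPrebundle ℝ ℝ V where
  pretrivializationAtlas := Set.range Φ.pretriv
  pretrivialization_linear' := by
    rintro _ ⟨i, rfl⟩
    exact ⟨fun b _ => (Φ.coord i b).toLinearMap.isLinear⟩
  pretrivializationAt := Φ.pretriv
  mem_base_pretrivializationAt := Φ.mem_dom
  pretrivialization_mem_atlas _ := ⟨_, rfl⟩
  exists_coordChange := by
    rintro _ ⟨i, rfl⟩ _ ⟨j, rfl⟩
    refine ⟨fun b => ContinuousLinearMap.mul ℝ ℝ (Φ.coord j b ((Φ.coord i b).symm 1)), ?_, ?_⟩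
    · exact (ContinuousLinearMap.mul ℝ ℝ).continuous.comp_continuousOn
        (Φ.contMDiffOn_coord i j).continuousOn
    · intro b hb r
      rw [Φ.pretriv_symm i b hb.1]
      exact (Φ.coord_eq i j b r).symm
  totalSpaceMk_isInducing b := by
    have h1 : Topology.IsInducing (fun r : ℝ => (b, r)) := Topology.isInducing_const_prod.2 .id
    exact h1.comp (Φ.coord b b).toHomeomorph.isInducing

theorem prebundle_isContMDiff : Φ.prebundle.IsContMDiff 𝓘(ℝ, EB) ∞ where
  exists_contMDiffCoordChange := by
    rintro _ ⟨i, rfl⟩ _ ⟨j, rfl⟩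
    refine ⟨fun b => ContinuousLinearMap.mul ℝ ℝ (Φ.coord j b ((Φ.coord i b).symm 1)), ?_, ?_⟩
    · exact (ContinuousLinearMap.mul ℝ ℝ).contMDiff.comp_contMDiffOn (Φ.contMDiffOn_coord i j)
    · intro b hb r
      rw [Φ.pretriv_symm i b hb.1]
      exact (Φ.coord_eq i j b r).symm

end LineFrames
end frames
section curves

theorem IsPrincipalAction.exists_section {EG E EB G M : Type*}
    [NormedAddCommGroup EG] [NormedSpace ℝ EG] [NormedAddCommGroup E] [NormedSpace ℝ E]
    [NormedAddCommGroup EB] [NormedSpace ℝ EB]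
    [Group G] [TopologicalSpace G] [ChartedSpace EG G] [LieGroup 𝓘(ℝ, EG) ∞ G]
    [TopologicalSpace M] [ChartedSpace E M] [IsManifold 𝓘(ℝ, E) ∞ M]
    [MulAction G M] [ChartedSpace EB (Orb G M)]
    (h : IsPrincipalAction EG E EB G M) (x : M) :
    ∃ σ : Orb G M → M, (∀ c, orb G (σ c) = c) ∧ σ (orb G x) = x ∧
      ContMDiffAt 𝓘(ℝ, EB) 𝓘(ℝ, E) ∞ σ (orb G x) ∧
      ∃ ρ : M → G, ρ x = 1 ∧ ContMDiffAt 𝓘(ℝ, E) 𝓘(ℝ, EG) ∞ ρ x ∧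
        ∀ᶠ y in nhds x, ρ y • σ (orb G y) = y := by
  obtain ⟨U, hU, hxU, σ, hσ, hσs, τ, hτ, hτσ⟩ := h.locally_trivial (orb G x)
  have hopen : IsOpen (orb G ⁻¹' U : Set M) := hU.preimage h.contMDiff_orb.continuous
  refine ⟨fun c => τ x • σ c, ?_, hτσ x hxU, ?_, fun y => τ y * (τ x)⁻¹, mul_inv_cancel _, ?_, ?_⟩
  · intro c
    rw [← hσ c, orb_eq_orb, hσ c]
    exact ⟨τ x, rfl⟩
  · exact (h.contMDiff_const_smul (τ x)).contMDiffAt.comp _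
      (hσs.contMDiffAt (hU.mem_nhds hxU))
  · exact (hτ.contMDiffAt (hopen.mem_nhds hxU)).mul contMDiffAt_const
  · filter_upwards [hopen.mem_nhds hxU] with y hy
    rw [mul_smul, inv_smul_smul, hτσ y hy]

/-- The tangent map read in the model spaces. -/
noncomputable def tmap (E E' : Type*) {M M' : Type*} [NormedAddCommGroup E] [NormedSpace ℝ E]
    [NormedAddCommGroup E'] [NormedSpace ℝ E'] [TopologicalSpace M] [ChartedSpace E M]
    [TopologicalSpace M'] [ChartedSpace E' M'] (f : M → M') (x : M) : E →L[ℝ] E' :=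
  mfderiv 𝓘(ℝ, E) 𝓘(ℝ, E') f x

section tmap
variable {E E' E'' M M' M'' : Type*} [NormedAddCommGroup E] [NormedSpace ℝ E]
  [NormedAddCommGroup E'] [NormedSpace ℝ E'] [NormedAddCommGroup E''] [NormedSpace ℝ E'']
  [TopologicalSpace M] [ChartedSpace E M] [TopologicalSpace M'] [ChartedSpace E' M']
  [TopologicalSpace M''] [ChartedSpace E'' M'']

theorem tmap_comp {f : M → M'} {g : M' → M''} {x : M} {y : M'}
    (hg : MDifferentiableAt 𝓘(ℝ, E') 𝓘(ℝ, E'') g y)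
    (hf : MDifferentiableAt 𝓘(ℝ, E) 𝓘(ℝ, E') f x) (hy : f x = y) :
    tmap E E'' (fun z => g (f z)) x = (tmap E' E'' g y).comp (tmap E E' f x) :=  by
  subst hy
  exact mfderiv_comp x hg hf

theorem tmap_id (x : M) : tmap E E (fun y : M => y) x = ContinuousLinearMap.id ℝ E := mfderiv_id

theorem tmap_congr {f g : M → M'} {x : M} (h : f =ᶠ[nhds x] g) : tmap E E' f x = tmap E E' g x :=
  Filter.EventuallyEq.mfderiv_eq h

theorem tmap_comp₂ {a : M' → M'' → M''} {f : M → M'} {g : M → M''} {x : M} {y : M'} {z : M''}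
    (ha : MDifferentiableAt (𝓘(ℝ, E').prod 𝓘(ℝ, E'')) 𝓘(ℝ, E'') (fun p : M' × M'' => a p.1 p.2) (y, z))
    (hf : MDifferentiableAt 𝓘(ℝ, E) 𝓘(ℝ, E') f x)
    (hg : MDifferentiableAt 𝓘(ℝ, E) 𝓘(ℝ, E'') g x) (hy : f x = y) (hz : g x = z) (u : E) :
    tmap E E'' (fun w => a (f w) (g w)) x u =
      tmap E' E'' (fun w => a w z) y (tmap E E' f x u) +
        tmap E'' E'' (fun w => a y w) z (tmap E E'' g x u) := by
  subst hy hz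
  have h1 := mfderiv_comp x ha (hf.prodMk hg)
  rw [hf.mfderiv_prod hg, mfderiv_prod_eq_add_comp ha] at h1
  exact congrArg (fun L : E →L[ℝ] E'' => L u) h1

end tmap

variable {E EB M : Type*} [NormedAddCommGroup E] [NormedSpace ℝ E]
  [NormedAddCommGroup EB] [NormedSpace ℝ EB]
  (Γ : Subgroup ℝˣ) [Fact (Γ = ⊤ ∨ Γ = Units.posSubgroup ℝ)]
  [TopologicalSpace M] [ChartedSpace E M] [MulAction Γ M] [ChartedSpace EB (Orb Γ M)]

/-- The infinitesimal generator `Δ` of the action of `Γ`: the velocity of `s ↦ s • x` at `s = 1`. -/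
noncomputable def eulerField (x : M) : TangentSpace 𝓘(ℝ, E) x :=
  mfderiv 𝓘(ℝ, ℝ) 𝓘(ℝ, E) (fun s : Γ => s • x) 1 (1 : ℝ)


variable {Γ}

variable (E Γ) in
/-- The infinitesimal generator read in the model space. -/
noncomputable def eulerVec (x : M) : E := tmap ℝ E (fun s : Γ => s • x) 1 1

theorem eulerField_eq (x : M) : eulerField Γ x = eulerVec E Γ x := rfl

theorem tmap_smul_left_apply (x : M) (r : ℝ) :
    tmap ℝ E (fun s : Γ => s • x) 1 r = r • eulerVec E Γ x := by
  have h := (tmap ℝ E (fun s : Γ => s • x) 1).map_smul r 1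
  rw [smul_eq_mul, mul_one] at h
  exact h

theorem eulerField_of_equivariant {E' M' : Type*} [NormedAddCommGroup E'] [NormedSpace ℝ E']
    [TopologicalSpace M'] [ChartedSpace E' M'] [MulAction Γ M']
    (hM : ContMDiff (𝓘(ℝ, ℝ).prod 𝓘(ℝ, E)) 𝓘(ℝ, E) ∞ (fun p : Γ × M => p.1 • p.2))
    {f : M → M'} {x : M} (hf : MDifferentiableAt 𝓘(ℝ, E) 𝓘(ℝ, E') f x)
    (hfe : ∀ (s : Γ) (y : M), f (s • y) = s • f y) :
    tmap E E' f x (eulerVec E Γ x) = eulerVec E' Γ (f x) := by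
  have h1 : MDifferentiableAt 𝓘(ℝ, ℝ) 𝓘(ℝ, E) (fun s : Γ => s • x) 1 :=
    ((hM.comp (contMDiff_id.prodMk contMDiff_const)).mdifferentiable (by simp)) 1
  have h2 := tmap_comp hf h1 (one_smul _ _)
  simp only [hfe] at h2
  unfold eulerVec
  rw [h2]
  rfl

theorem IsPrincipalAction.ker_tmap_orb [IsManifold 𝓘(ℝ, E) ∞ M]
    (h : IsPrincipalAction ℝ E EB Γ M) (x : M) (u : E)
    (hu : tmap E EB (orb Γ) x u = 0) :
    ∃ r : ℝ, u = r • eulerVec E Γ x := by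
  obtain ⟨σ, hσ, hσx, hσs, ρ, hρx, hρs, hρσ⟩ := h.exists_section x
  have hp : MDifferentiableAt 𝓘(ℝ, E) 𝓘(ℝ, EB) (orb Γ : M → Orb Γ M) x :=
    h.contMDiff_orb.mdifferentiable (by simp) x
  have hσd := hσs.mdifferentiableAt (by simp)
  have hρd := hρs.mdifferentiableAt (by simp)
  have hσp : MDifferentiableAt 𝓘(ℝ, E) 𝓘(ℝ, E) (fun y : M => σ (orb Γ y)) x := hσd.comp x hp
  have ha : MDifferentiableAt (𝓘(ℝ, ℝ).prod 𝓘(ℝ, E)) 𝓘(ℝ, E)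
      (fun p : Γ × M => p.1 • p.2) (1, x) := h.contMDiff_smul.mdifferentiable (by simp) _
  have h1 := tmap_comp₂ (a := fun (s : Γ) (y : M) => s • y) ha hρd hσp hρx hσx u
  rw [tmap_congr hρσ, tmap_id, tmap_comp hσd hp rfl, ContinuousLinearMap.comp_apply, hu, map_zero,
    map_zero, add_zero, tmap_smul_left_apply] at h1
  exact ⟨_, h1⟩

theorem IsPrincipalAction.eulerField_ne_zero [IsManifold 𝓘(ℝ, E) ∞ M]
    (h : IsPrincipalAction ℝ E EB Γ M) (x : M) : eulerVec E Γ x ≠ 0 := by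
  intro h0
  obtain ⟨σ, hσ, hσx, hσs, ρ, hρx, hρs, hρσ⟩ := h.exists_section x
  have hρd := hρs.mdifferentiableAt (by simp)
  have h1 : MDifferentiableAt 𝓘(ℝ, ℝ) 𝓘(ℝ, E) (fun s : Γ => s • x) 1 :=
    ((h.contMDiff_smul.comp (contMDiff_id.prodMk contMDiff_const)).mdifferentiable (by simp)) 1
  have hev : (fun s : Γ => ρ (s • x)) =ᶠ[nhds 1] fun s => s := by
    have : Filter.Tendsto (fun s : Γ => s • x) (nhds 1) (nhds x) := by
      have := h1.continuousAt.tendsto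
      rwa [one_smul] at this
    filter_upwards [this.eventually hρσ] with s hs
    have e : orb Γ (s • x) = orb Γ x := orb_eq_orb.mpr ⟨s, rfl⟩
    rw [e, hσx] at hs
    exact h.smul_left_injective hs
  have h2 := tmap_comp hρd h1 (one_smul _ _)
  rw [tmap_congr hev, tmap_id] at h2
  have h3 := congrArg (fun L : ℝ →L[ℝ] ℝ => L 1) h2
  have h4 : (1 : ℝ) = tmap E ℝ ρ x (eulerVec E Γ x) := h3
  rw [h0, map_zero] at h4
  exact one_ne_zero h4

end curves
section assoc

theorem scalingCoord_ne_zero {Γ : Subgroup ℝˣ} (s : Γ) : scalingCoord s ≠ 0 := Units.ne_zero _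

theorem scalingCoord_mul {Γ : Subgroup ℝˣ} (s t : Γ) :
    scalingCoord (s * t) = scalingCoord s * scalingCoord t := by
  simp [scalingCoord]

theorem scalingCoord_one {Γ : Subgroup ℝˣ} : scalingCoord (1 : Γ) = 1 := rfl

variable {Γ : Subgroup ℝˣ} [Fact (Γ = ⊤ ∨ Γ = Units.posSubgroup ℝ)]
  {E EB M : Type*} [NormedAddCommGroup E] [NormedSpace ℝ E]
  [NormedAddCommGroup EB] [NormedSpace ℝ EB]
  [TopologicalSpace M] [ChartedSpace E M] [MulAction Γ M] [ChartedSpace EB (Orb Γ M)]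

variable (Γ M) in
/-- The orbit relation of the action `s • (x, t) = (s • x, t / s)` of `Γ` on `M × ℝ`. -/
def assocSetoid : Setoid (M × ℝ) where
  r p q := ∃ s : Γ, q = (s • p.1, p.2 / scalingCoord s)
  iseqv :=
    { refl := fun p => ⟨1, by simp [scalingCoord_one]⟩
      symm := by
        rintro p _ ⟨s, rfl⟩
        refine ⟨s⁻¹, ?_⟩
        have h := scalingCoord_ne_zero s
        have h2 : scalingCoord s⁻¹ = (scalingCoord s)⁻¹ := by simp [scalingCoord]
        ext
        · simp
        · simp [h2, h]
      trans := by
        rintro p _ _ ⟨s, rfl⟩ ⟨t, rfl⟩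
        exact ⟨t * s, Prod.ext (mul_smul t s p.1).symm (by
          simp [scalingCoord_mul, div_div, mul_comm])⟩ }

variable (Γ M) in
/-- The total space `(M × ℝ)/Γ` as a set. -/
abbrev AssocLine : Type _ := Quotient (assocSetoid Γ M)

/-- The projection `(M × ℝ)/Γ → M/Γ`, `[(x, t)] ↦ [x]`. -/
def AssocLine.proj : AssocLine Γ M → Orb Γ M :=
  Quotient.lift (fun p => orb Γ p.1) (by
    rintro p _ ⟨s, rfl⟩
    exact orb_eq_orb.mpr ⟨s⁻¹, by simp⟩)

/-- The fibre of `(M × ℝ)/Γ → M/Γ` over `k`. -/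
def AssocFiber (_ : IsPrincipalAction ℝ E EB Γ M) (k : Orb Γ M) : Type _ :=
  {q : AssocLine Γ M // q.proj = k}

variable (h : IsPrincipalAction ℝ E EB Γ M)

/-- The element `[(x, t)]` in the fibre over `[x]`. -/
def AssocFiber.mk (x : M) (t : ℝ) : AssocFiber h (orb Γ x) :=
  ⟨Quotient.mk _ (x, t), rfl⟩

namespace AssocFiber

/-- `[(x, t)]` in the fibre over `k = [x]`. -/
def mkAt (x : M) (k : Orb Γ M) (hx : orb Γ x = k) (t : ℝ) : AssocFiber h k :=
  ⟨Quotient.mk _ (x, t), hx⟩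

theorem mkAt_bijective (x : M) (k : Orb Γ M) (hx : orb Γ x = k) :
    Function.Bijective (mkAt h x k hx) := by
  constructor
  · intro t t' e
    obtain ⟨s, hs⟩ := Quotient.exact (congrArg Subtype.val e)
    have h1 : s = 1 := h.free s x (congrArg Prod.fst hs).symm
    have h2 := congrArg Prod.snd hs
    simpa [h1, scalingCoord_one] using h2.symm
  · rintro ⟨q, hq⟩
    induction q using Quotient.inductionOn with
    | h p =>
      obtain ⟨y, t⟩ := p
      obtain ⟨s, hs⟩ := orb_eq_orb.mp (hq.trans hx.symm)
      refine ⟨t * scalingCoord s, Subtype.ext (Quotient.sound ⟨s, ?_⟩)⟩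
      simp [hs, scalingCoord_ne_zero]

/-- The bijection `[(x, t)] ↦ t` of the fibre over `k = [x]` with `ℝ`, for one choice of `x`. -/
noncomputable def outEquiv (k : Orb Γ M) : AssocFiber h k ≃ ℝ :=
  (Equiv.ofBijective _ (mkAt_bijective h k.out k (Quotient.out_eq k))).symm

/-- The vector space structure with `a [(x, t)] + b [(x, u)] = [(x, a t + b u)]`. -/
noncomputable instance (k : Orb Γ M) : AddCommGroup (AssocFiber h k) := (outEquiv h k).addCommGroup

noncomputable instance (k : Orb Γ M) : Module ℝ (AssocFiber h k) := (outEquiv h k).module ℝ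

noncomputable instance (k : Orb Γ M) : TopologicalSpace (AssocFiber h k) :=
  TopologicalSpace.induced (outEquiv h k) inferInstance

/-- The bijection `[(x, t)] ↦ t` as an isomorphism of topological vector spaces. -/
noncomputable def outLin (k : Orb Γ M) : AssocFiber h k ≃L[ℝ] ℝ :=
  { (outEquiv h k).linearEquiv ℝ with
    continuous_toFun := continuous_induced_dom
    continuous_invFun := by
      refine continuous_induced_rng.mpr ?_
      have : (outEquiv h k) ∘ (outEquiv h k).symm = id := by ext; simp
      exact this ▸ continuous_id }

theorem outLin_symm (k : Orb Γ M) (t : ℝ) :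
    (outLin h k).symm t = mkAt h k.out k (Quotient.out_eq k) t := rfl

theorem mkAt_eq (x y : M) (k : Orb Γ M) (hx : orb Γ x = k) (hy : orb Γ y = k) (s : Γ)
    (hs : y = s • x) (t : ℝ) : mkAt h y k hy t = mkAt h x k hx (t * scalingCoord s) := by
  subst hs
  refine Subtype.ext (Quotient.sound ((assocSetoid Γ M).symm ⟨s, ?_⟩))
  simp [scalingCoord_ne_zero]

/-- The coordinate with respect to the basis vector `[(x, 1)]` of a fibre. -/
noncomputable def coord (x : M) (k : Orb Γ M) (hx : orb Γ x = k) : AssocFiber h k ≃L[ℝ] ℝ := by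
  refine ContinuousLinearEquiv.trans (outLin h k) ?_
  have hs : ∃ s : Γ, x = s • k.out :=
    (orb_eq_orb.mp (hx.trans (Quotient.out_eq k).symm)).imp fun _ h => h.symm
  exact ContinuousLinearEquiv.smulLeft (Units.mk0 _ (scalingCoord_ne_zero hs.choose))⁻¹

theorem coord_symm (x : M) (k : Orb Γ M) (hx : orb Γ x = k) (t : ℝ) :
    (coord h x k hx).symm t = mkAt h x k hx t := by
  have hs : ∃ s : Γ, x = s • k.out :=
    (orb_eq_orb.mp (hx.trans (Quotient.out_eq k).symm)).imp fun _ h => h.symm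
  rw [mkAt_eq h k.out x k (Quotient.out_eq k) hx hs.choose hs.choose_spec, ← outLin_symm]
  have e : t * scalingCoord hs.choose =
      ((Units.mk0 _ (scalingCoord_ne_zero hs.choose))⁻¹)⁻¹ • t := by
    rw [inv_inv, mul_comm]
    rfl
  rw [e]
  rfl

theorem coord_mkAt (x : M) (k : Orb Γ M) (hx : orb Γ x = k) (t : ℝ) :
    coord h x k hx (mkAt h x k hx t) = t := by
  rw [← coord_symm, ContinuousLinearEquiv.apply_symm_apply]

/-- The smooth frames `k ↦ [(σ k, 1)]` of `(M × ℝ)/Γ`, for smooth local sections `σ` of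
`M → M/Γ`. -/
noncomputable def frames [IsManifold 𝓘(ℝ, EB) ∞ (Orb Γ M)] : LineFrames EB (AssocFiber h) where
  dom i := (h.locally_trivial i).choose
  isOpen_dom i := (h.locally_trivial i).choose_spec.1
  mem_dom i := (h.locally_trivial i).choose_spec.2.1
  coord i k := coord h ((h.locally_trivial i).choose_spec.2.2.choose k) k
    ((h.locally_trivial i).choose_spec.2.2.choose_spec.1 k)
  contMDiffOn_coord i j := by
    set a := (h.locally_trivial i).choose_spec.2.2.choose with ha
    set b := (h.locally_trivial j).choose_spec.2.2.choose with hb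
    have hai := (h.locally_trivial i).choose_spec.2.2.choose_spec
    have hbi := (h.locally_trivial j).choose_spec.2.2.choose_spec
    rw [← ha] at hai
    rw [← hb] at hbi
    set U := (h.locally_trivial i).choose ∩ (h.locally_trivial j).choose with hUdef
    have hU : IsOpen U :=
      (h.locally_trivial i).choose_spec.1.inter (h.locally_trivial j).choose_spec.1
    obtain ⟨g, hg, hgab⟩ := h.exists_div hU (hbi.2.1.mono Set.inter_subset_right)
      (hai.2.1.mono Set.inter_subset_left) (fun n _ => (hbi.1 n).trans (hai.1 n).symm)
    refine ((contMDiff_scalingCoord Γ).comp_contMDiffOn hg).congr ?_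
    intro k hk
    rw [coord_symm, mkAt_eq h (b k) (a k) k (hbi.1 k) (hai.1 k) (g k) (hgab k hk), coord_mkAt,
      one_mul]
    rfl

variable [IsManifold 𝓘(ℝ, EB) ∞ (Orb Γ M)]

noncomputable instance : TopologicalSpace (TotalSpace ℝ (AssocFiber h)) :=
  (frames h).prebundle.totalSpaceTopology

noncomputable instance : FiberBundle ℝ (AssocFiber h) := (frames h).prebundle.toFiberBundle

instance : VectorBundle ℝ ℝ (AssocFiber h) := (frames h).prebundle.toVectorBundle

instance : ContMDiffVectorBundle ∞ ℝ (AssocFiber h) 𝓘(ℝ, EB) :=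
  letI := (frames h).prebundle_isContMDiff
  (frames h).prebundle.contMDiffVectorBundle 𝓘(ℝ, EB)

end AssocFiber
end assoc
section sympl2
variable {E : Type*} [NormedAddCommGroup E] [NormedSpace ℝ E] {M : Type*} [TopologicalSpace M] [ChartedSpace E M] [IsManifold 𝓘(ℝ, E) ∞ M]

namespace SymplecticForm
variable (Ω : SymplecticForm E M)

/-- The Hamiltonian vector field `X_f`, defined by `i_{X_f} ω = df`. -/
noncomputable def hamiltonianField (f : M → ℝ) (x : M) : TangentSpace 𝓘(ℝ, E) x :=
  Function.invFun (fun v => Ω.form x v) (differential f x)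

/-- The Poisson bracket `{f, g} = ω(X_f, X_g)`. -/
noncomputable def poisson (f g : M → ℝ) (x : M) : ℝ :=
  Ω.form x (Ω.hamiltonianField f x) (Ω.hamiltonianField g x)

end SymplecticForm
end sympl2

section system
variable (E E₁ E₂ E₃ E₄ EG S G : Type*) (Γ : Subgroup ℝˣ) [Fact (Γ = ⊤ ∨ Γ = Units.posSubgroup ℝ)]
  [NormedAddCommGroup E] [NormedSpace ℝ E] [NormedAddCommGroup E₁] [NormedSpace ℝ E₁]
  [NormedAddCommGroup E₂] [NormedSpace ℝ E₂] [NormedAddCommGroup E₃] [NormedSpace ℝ E₃]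
  [NormedAddCommGroup E₄] [NormedSpace ℝ E₄] [NormedAddCommGroup EG] [NormedSpace ℝ EG]
  [TopologicalSpace S] [ChartedSpace E S] [IsManifold 𝓘(ℝ, E) ∞ S]
  [Group G] [TopologicalSpace G] [ChartedSpace EG G]
  [MulAction G S] [MulAction Γ S] [SMulCommClass G Γ S] [SMulCommClass Γ G S]
  [ChartedSpace E₁ (Orb G S)] [ChartedSpace E₂ (Orb Γ S)]
  [ChartedSpace E₃ (Orb Γ (Orb G S))] [ChartedSpace E₄ (Orb G (Orb Γ S))]

/-- A symplectic Hamiltonian system `(S, ω, H)`, `ω = sympl`, `H = ham`, with a scaling symmetry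
(a principal action of `Γ` with `φ_s^* ω = s ω` and `H ∘ φ_s = s H`) and a symplectic symmetry (a
principal action of `G` preserving `ω` and `H`). The two actions commute, which is a class
assumption, and the actions they induce on the orbit spaces `S/G` and `S/Γ` are principal too. -/
structure CompatibleSystem where
  sympl : SymplecticForm E S
  ham : S → ℝ
  contMDiff_ham : ContMDiff 𝓘(ℝ, E) 𝓘(ℝ, ℝ) ∞ ham
  principal_scaling : IsPrincipalAction ℝ E E₂ Γ S
  form_scaling : ∀ (s : Γ) (x : S) (v w : TangentSpace 𝓘(ℝ, E) x),
    sympl.form (s • x) (mfderiv 𝓘(ℝ, E) 𝓘(ℝ, E) (fun y : S => s • y) x v)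
      (mfderiv 𝓘(ℝ, E) 𝓘(ℝ, E) (fun y : S => s • y) x w) = scalingCoord s * sympl.form x v w
  ham_scaling : ∀ (s : Γ) (x : S), ham (s • x) = scalingCoord s * ham x
  principal_symmetry : IsPrincipalAction EG E E₁ G S
  form_symmetry : ∀ (g : G) (x : S) (v w : TangentSpace 𝓘(ℝ, E) x),
    sympl.form (g • x) (mfderiv 𝓘(ℝ, E) 𝓘(ℝ, E) (fun y : S => g • y) x v)
      (mfderiv 𝓘(ℝ, E) 𝓘(ℝ, E) (fun y : S => g • y) x w) = sympl.form x v w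
  ham_symmetry : ∀ (g : G) (x : S), ham (g • x) = ham x
  principal_scaling_quotient : IsPrincipalAction ℝ E₁ E₃ Γ (Orb G S)
  principal_symmetry_quotient : IsPrincipalAction EG E₂ E₄ G (Orb Γ S)
end system

namespace CompatibleSystem
variable {E E₁ E₂ E₃ E₄ EG S G : Type*} {Γ : Subgroup ℝˣ} [Fact (Γ = ⊤ ∨ Γ = Units.posSubgroup ℝ)]
  [NormedAddCommGroup E] [NormedSpace ℝ E] [NormedAddCommGroup E₁] [NormedSpace ℝ E₁]
  [NormedAddCommGroup E₂] [NormedSpace ℝ E₂] [NormedAddCommGroup E₃] [NormedSpace ℝ E₃]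
  [NormedAddCommGroup E₄] [NormedSpace ℝ E₄] [NormedAddCommGroup EG] [NormedSpace ℝ EG]
  [TopologicalSpace S] [ChartedSpace E S] [IsManifold 𝓘(ℝ, E) ∞ S]
  [Group G] [TopologicalSpace G] [ChartedSpace EG G]
  [MulAction G S] [MulAction Γ S] [SMulCommClass G Γ S] [SMulCommClass Γ G S]
  [ChartedSpace E₁ (Orb G S)] [ChartedSpace E₂ (Orb Γ S)]
  [ChartedSpace E₃ (Orb Γ (Orb G S))] [ChartedSpace E₄ (Orb G (Orb Γ S))]
  (sys : CompatibleSystem E E₁ E₂ E₃ E₄ EG S G Γ)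

/-- The 1-form `λ = -i_Δ ω`. -/
noncomputable def liouville (x : S) : TangentSpace 𝓘(ℝ, E) x →L[ℝ] ℝ :=
  -(sys.sympl.form x (eulerField Γ x))

/-- The contact distribution `𝒟 = Tp(ker λ)` on `C = S/Γ`, where `p : S → C` is the projection. -/
noncomputable def contactDistribution : Set (TangentBundle 𝓘(ℝ, E₂) (Orb Γ S)) :=
  tangentMap 𝓘(ℝ, E) 𝓘(ℝ, E₂) (orb Γ) '' {u | sys.liouville u.1 u.2 = 0}

/-- The annihilator of `𝒟` in the cotangent space at `c`. -/
def annihilator (c : Orb Γ S) : Submodule ℝ (TangentSpace 𝓘(ℝ, E₂) c →L[ℝ] ℝ) where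
  carrier := {α | ∀ v : TangentSpace 𝓘(ℝ, E₂) c,
    (⟨c, v⟩ : TangentBundle 𝓘(ℝ, E₂) (Orb Γ S)) ∈ sys.contactDistribution → α v = 0}
  add_mem' ha hb v hv := by simp [ha v hv, hb v hv]
  zero_mem' v _ := rfl
  smul_mem' r a ha v hv := by simp [ha v hv]

theorem mem_contactDistribution (c : Orb Γ S) (v : E₂) :
    (⟨c, v⟩ : TangentBundle 𝓘(ℝ, E₂) (Orb Γ S)) ∈ sys.contactDistribution ↔
      ∃ (y : S) (u : E), orb Γ y = c ∧ sys.liouville y u = 0 ∧ tmap E E₂ (orb Γ) y u = v := by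
  constructor
  · rintro ⟨⟨y, u⟩, hu, e⟩
    cases e
    exact ⟨y, u, rfl, hu, rfl⟩
  · rintro ⟨y, u, rfl, hu, rfl⟩
    exact ⟨⟨y, u⟩, hu, rfl⟩

theorem tmap_orb_surjective (sys : CompatibleSystem E E₁ E₂ E₃ E₄ EG S G Γ)
    (x : S) :
    Function.Surjective (tmap E E₂ (orb Γ) x) := by
  obtain ⟨σ, hσ, hσx, hσs, -⟩ := sys.principal_scaling.exists_section x
  have hp : MDifferentiableAt 𝓘(ℝ, E) 𝓘(ℝ, E₂) (orb Γ : S → Orb Γ S) x :=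
    sys.principal_scaling.contMDiff_orb.mdifferentiable (by simp) x
  have h := tmap_comp hp (hσs.mdifferentiableAt (by simp)) hσx
  simp only [hσ] at h
  rw [tmap_id] at h
  intro v
  exact ⟨_, (congrArg (fun L : E₂ →L[ℝ] E₂ => L v) h).symm⟩

theorem liouville_smul (s : Γ) (x : S) (u : E) :
    sys.liouville (s • x) (tmap E E (fun y : S => s • y) x u) =
      scalingCoord s * sys.liouville x u := by
  have hs : MDifferentiableAt 𝓘(ℝ, E) 𝓘(ℝ, E) (fun y : S => s • y) x :=
    (sys.principal_scaling.contMDiff_const_smul s).mdifferentiable (by simp) x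
  have h := eulerField_of_equivariant sys.principal_scaling.contMDiff_smul hs
    (fun t y => by rw [smul_smul, smul_smul, mul_comm])
  have h2 := sys.form_scaling s x (eulerVec E Γ x) u
  have h3 : sys.sympl.form (s • x) (eulerVec E Γ (s • x)) (tmap E E (fun y : S => s • y) x u) =
      scalingCoord s * sys.sympl.form x (eulerVec E Γ x) u := by
    rw [← h]; exact h2
  show -(sys.sympl.form (s • x) (eulerVec E Γ (s • x)) (tmap E E (fun y : S => s • y) x u)) =
    scalingCoord s * -(sys.sympl.form x (eulerVec E Γ x) u)
  rw [h3]; ring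

theorem liouville_symmetry (g : G) (x : S) (u : E) :
    sys.liouville (g • x) (tmap E E (fun y : S => g • y) x u) = sys.liouville x u := by
  have hs : MDifferentiableAt 𝓘(ℝ, E) 𝓘(ℝ, E) (fun y : S => g • y) x :=
    (sys.principal_symmetry.contMDiff_const_smul g).mdifferentiable (by simp) x
  have h := eulerField_of_equivariant sys.principal_scaling.contMDiff_smul hs
    (fun t y => smul_comm g t y)
  have h2 := sys.form_symmetry g x (eulerVec E Γ x) u
  have h3 : sys.sympl.form (g • x) (eulerVec E Γ (g • x)) (tmap E E (fun y : S => g • y) x u) =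
      sys.sympl.form x (eulerVec E Γ x) u := by
    rw [← h]; exact h2
  exact congrArg Neg.neg h3

theorem tmap_orb_smul (sys : CompatibleSystem E E₁ E₂ E₃ E₄ EG S G Γ)
    (s : Γ) (x : S) (u : E) :
    tmap E E₂ (orb Γ) (s • x) (tmap E E (fun y : S => s • y) x u) = tmap E E₂ (orb Γ) x u := by
  have hs : MDifferentiableAt 𝓘(ℝ, E) 𝓘(ℝ, E) (fun y : S => s • y) x :=
    (sys.principal_scaling.contMDiff_const_smul s).mdifferentiable (by simp) x
  have hp : MDifferentiableAt 𝓘(ℝ, E) 𝓘(ℝ, E₂) (orb Γ : S → Orb Γ S) (s • x) :=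
    sys.principal_scaling.contMDiff_orb.mdifferentiable (by simp) _
  have h := tmap_comp hp hs rfl
  have e : (fun y : S => orb Γ (s • y)) = orb Γ := by
    ext y; exact orb_eq_orb.mpr ⟨s, rfl⟩
  rw [e] at h
  exact (congrArg (fun L : E →L[ℝ] E₂ => L u) h).symm

theorem tmap_orb_symmetry (sys : CompatibleSystem E E₁ E₂ E₃ E₄ EG S G Γ)
    [IsManifold 𝓘(ℝ, E₂) ∞ (Orb Γ S)] (g : G) (x : S) (u : E) :
    tmap E E₂ (orb Γ) (g • x) (tmap E E (fun y : S => g • y) x u) =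
      tmap E₂ E₂ (fun c : Orb Γ S => g • c) (orb Γ x) (tmap E E₂ (orb Γ) x u) := by
  have hs : MDifferentiableAt 𝓘(ℝ, E) 𝓘(ℝ, E) (fun y : S => g • y) x :=
    (sys.principal_symmetry.contMDiff_const_smul g).mdifferentiable (by simp) x
  have hp : ∀ y, MDifferentiableAt 𝓘(ℝ, E) 𝓘(ℝ, E₂) (orb Γ : S → Orb Γ S) y :=
    sys.principal_scaling.contMDiff_orb.mdifferentiable (by simp)
  have hg : MDifferentiableAt 𝓘(ℝ, E₂) 𝓘(ℝ, E₂) (fun c : Orb Γ S => g • c) (orb Γ x) :=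
    (sys.principal_symmetry_quotient.contMDiff_const_smul g).mdifferentiable (by simp) _
  have h1 := tmap_comp (hp (g • x)) hs rfl
  have h2 := tmap_comp hg (hp x) rfl
  have h3 := h1.symm.trans h2
  exact congrArg (fun L : E →L[ℝ] E₂ => L u) h3

theorem liouville_eulerVec (x : S) (r : ℝ) : sys.liouville x (r • eulerVec E Γ x) = 0 := by
  have h : sys.sympl.form x (eulerVec E Γ x) (eulerVec E Γ x) = 0 := by
    have := sys.sympl.skew x (eulerVec E Γ x) (eulerVec E Γ x)
    linarith
  have h2 := (sys.liouville x).map_smul r (eulerVec E Γ x)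
  have h3 : sys.liouville x (eulerVec E Γ x) = 0 := by
    show -(sys.sympl.form x (eulerVec E Γ x) (eulerVec E Γ x)) = 0
    rw [h, neg_zero]
  rw [h3, smul_zero] at h2
  exact h2

theorem exists_liouville_ne_zero (x : S) : ∃ u : E, sys.liouville x u ≠ 0 := by
  by_contra hc
  push Not at hc
  refine sys.principal_scaling.eulerField_ne_zero x (sys.sympl.nondegenerate x _ fun w => ?_)
  have h : -(sys.sympl.form x (eulerVec E Γ x) w) = 0 := hc w
  linarith

theorem mem_contactDistribution_orb (x : S) (v : E₂) :
    (⟨orb Γ x, v⟩ : TangentBundle 𝓘(ℝ, E₂) (Orb Γ S)) ∈ sys.contactDistribution ↔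
      ∃ u : E, sys.liouville x u = 0 ∧ tmap E E₂ (orb Γ) x u = v := by
  rw [mem_contactDistribution]
  constructor
  · rintro ⟨y, u, hy, hu, rfl⟩
    obtain ⟨s, rfl⟩ := orb_eq_orb.mp hy.symm
    refine ⟨tmap E E (fun z : S => s • z) y u, ?_, sys.tmap_orb_smul s y u⟩
    rw [sys.liouville_smul, hu, mul_zero]
  · rintro ⟨u, hu, rfl⟩
    exact ⟨x, u, rfl, hu, rfl⟩

/-- The values of an annihilator on lifts determine it. -/
theorem annihilator_ext {c : Orb Γ S} {α β : sys.annihilator c} (x : S)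
    (h : ∀ u : E, α.1 (tmap E E₂ (orb Γ) x u) = β.1 (tmap E E₂ (orb Γ) x u)) : α = β := by
  refine Subtype.ext (ContinuousLinearMap.ext fun v => ?_)
  obtain ⟨u, rfl⟩ := sys.tmap_orb_surjective x v
  exact h u

theorem exists_covector (x : S) (c : Orb Γ S) (hx : orb Γ x = c) :
    ∃ α : sys.annihilator c, ∀ u : E, α.1 (tmap E E₂ (orb Γ) x u) = sys.liouville x u := by
  subst hx
  obtain ⟨σ, hσ, hσx, hσs, ρ, hρx, hρs, hρσ⟩ := sys.principal_scaling.exists_section x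
  have hp : MDifferentiableAt 𝓘(ℝ, E) 𝓘(ℝ, E₂) (orb Γ : S → Orb Γ S) x :=
    sys.principal_scaling.contMDiff_orb.mdifferentiable (by simp) x
  have hσd := hσs.mdifferentiableAt (by simp)
  have hρd := hρs.mdifferentiableAt (by simp)
  have hσp : MDifferentiableAt 𝓘(ℝ, E) 𝓘(ℝ, E) (fun y : S => σ (orb Γ y)) x := hσd.comp x hp
  have ha : MDifferentiableAt (𝓘(ℝ, ℝ).prod 𝓘(ℝ, E)) 𝓘(ℝ, E)
      (fun p : Γ × S => p.1 • p.2) (1, x) :=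
    sys.principal_scaling.contMDiff_smul.mdifferentiable (by simp) _
  let lam : E →L[ℝ] ℝ := sys.liouville x
  have key : ∀ u : E, lam (tmap E₂ E σ (orb Γ x) (tmap E E₂ (orb Γ) x u)) = lam u := by
    intro u
    have h1 := tmap_comp₂ (a := fun (s : Γ) (y : S) => s • y) ha hρd hσp hρx hσx u
    rw [tmap_congr hρσ, tmap_id, tmap_comp hσd hp rfl, tmap_smul_left_apply] at h1
    simp only [one_smul, tmap_id, ContinuousLinearMap.comp_apply, ContinuousLinearMap.id_apply]
      at h1
    have h2 := congrArg lam h1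
    rw [map_add, show lam (_ • _) = 0 from sys.liouville_eulerVec x _, zero_add] at h2
    exact h2.symm
  refine ⟨⟨lam.comp (tmap E₂ E σ (orb Γ x)), ?_⟩, key⟩
  intro v hv
  obtain ⟨u, hu, rfl⟩ := (sys.mem_contactDistribution_orb x v).mp hv
  exact (key u).trans hu

/-- The covector `α` of `𝒟°` at `c = [x]` such that `α (T_x p u) = λ_x u` for every `u`. -/
noncomputable def covectorAt (x : S) (c : Orb Γ S) (hx : orb Γ x = c) : sys.annihilator c :=
  (sys.exists_covector x c hx).choose

theorem covectorAt_apply (x : S) (c : Orb Γ S) (hx : orb Γ x = c) (u : E) :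
    (sys.covectorAt x c hx).1 (tmap E E₂ (orb Γ) x u) = sys.liouville x u :=
  (sys.exists_covector x c hx).choose_spec u

end CompatibleSystem
namespace CompatibleSystem
variable {E E₁ E₂ E₃ E₄ EG S G : Type*} {Γ : Subgroup ℝˣ} [Fact (Γ = ⊤ ∨ Γ = Units.posSubgroup ℝ)]
  [NormedAddCommGroup E] [NormedSpace ℝ E] [NormedAddCommGroup E₁] [NormedSpace ℝ E₁]
  [NormedAddCommGroup E₂] [NormedSpace ℝ E₂] [NormedAddCommGroup E₃] [NormedSpace ℝ E₃]
  [NormedAddCommGroup E₄] [NormedSpace ℝ E₄] [NormedAddCommGroup EG] [NormedSpace ℝ EG]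
  [TopologicalSpace S] [ChartedSpace E S] [IsManifold 𝓘(ℝ, E) ∞ S]
  [Group G] [TopologicalSpace G] [ChartedSpace EG G]
  [MulAction G S] [MulAction Γ S] [SMulCommClass G Γ S] [SMulCommClass Γ G S]
  [ChartedSpace E₁ (Orb G S)] [ChartedSpace E₂ (Orb Γ S)]
  [ChartedSpace E₃ (Orb Γ (Orb G S))] [ChartedSpace E₄ (Orb G (Orb Γ S))]
  (sys : CompatibleSystem E E₁ E₂ E₃ E₄ EG S G Γ)

theorem covectorAt_smul (sys : CompatibleSystem E E₁ E₂ E₃ E₄ EG S G Γ) (x y : S) (c : Orb Γ S)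
    (hx : orb Γ x = c) (hy : orb Γ y = c) (s : Γ) (hs : y = s • x) :
    sys.covectorAt y c hy = scalingCoord s • sys.covectorAt x c hx := by
  subst hs
  refine sys.annihilator_ext x fun u => ?_
  have h1 := sys.covectorAt_apply (s • x) c hy (tmap E E (fun y : S => s • y) x u)
  rw [sys.tmap_orb_smul, sys.liouville_smul] at h1
  rw [h1, ← sys.covectorAt_apply x c hx u]
  rfl

theorem covectorAt_ne_zero (x : S) (c : Orb Γ S) (hx : orb Γ x = c) :
    sys.covectorAt x c hx ≠ 0 := by
  intro h0
  obtain ⟨u, hu⟩ := sys.exists_liouville_ne_zero x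
  apply hu
  rw [← sys.covectorAt_apply x c hx u, h0]
  rfl

theorem exists_eq_smul_covectorAt (x : S) (c : Orb Γ S) (hx : orb Γ x = c)
    (α : sys.annihilator c) : ∃ t : ℝ, α = t • sys.covectorAt x c hx := by
  subst hx
  obtain ⟨w, hw⟩ := sys.exists_liouville_ne_zero x
  let lam : E →L[ℝ] ℝ := sys.liouville x
  let a : E →L[ℝ] ℝ := (show E₂ →L[ℝ] ℝ from α.1).comp (tmap E E₂ (orb Γ) x)
  have ha : ∀ u : E, lam u = 0 → a u = 0 := fun u hu =>
    α.2 _ ((sys.mem_contactDistribution_orb x _).mpr ⟨u, hu, rfl⟩)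
  refine ⟨a w / lam w, sys.annihilator_ext x fun u => ?_⟩
  have h1 : lam (u - (lam u / lam w) • w) = 0 := by
    rw [map_sub, map_smul, smul_eq_mul, div_mul_cancel₀ (lam u) (show lam w ≠ 0 from hw), sub_self]
  have h2 := ha _ h1
  rw [map_sub, map_smul, smul_eq_mul, sub_eq_zero] at h2
  have h3 : a u = a w / lam w * lam u := by rw [h2]; ring
  have h4 : lam u = (sys.covectorAt x _ rfl).1 (tmap E E₂ (orb Γ) x u) :=
    (sys.covectorAt_apply x _ rfl u).symm
  rw [h4] at h3
  exact h3

/-- The fibre of `𝒟°` over `c`. -/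
def AnnFiber (c : Orb Γ S) : Type _ := sys.annihilator c

namespace AnnFiber

noncomputable instance (c : Orb Γ S) : AddCommGroup (sys.AnnFiber c) :=
  inferInstanceAs (AddCommGroup (sys.annihilator c))

noncomputable instance (c : Orb Γ S) : Module ℝ (sys.AnnFiber c) :=
  inferInstanceAs (Module ℝ (sys.annihilator c))

instance (c : Orb Γ S) : TopologicalSpace (sys.AnnFiber c) :=
  inferInstanceAs (TopologicalSpace (sys.annihilator c))

instance (c : Orb Γ S) : T2Space (sys.AnnFiber c) :=
  inferInstanceAs (T2Space (sys.annihilator c : Submodule ℝ (E₂ →L[ℝ] ℝ)))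

instance (c : Orb Γ S) : IsTopologicalAddGroup (sys.AnnFiber c) :=
  inferInstanceAs (IsTopologicalAddGroup (sys.annihilator c : Submodule ℝ (E₂ →L[ℝ] ℝ)))

instance (c : Orb Γ S) : ContinuousSMul ℝ (sys.AnnFiber c) :=
  inferInstanceAs (ContinuousSMul ℝ (sys.annihilator c : Submodule ℝ (E₂ →L[ℝ] ℝ)))

end AnnFiber

/-- The element `α_x` of `𝒟°` determined by `α_x ∘ T_x p = λ_x`. -/
noncomputable def covector (x : S) : sys.AnnFiber (orb Γ x) := sys.covectorAt x (orb Γ x) rfl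

/-- The coordinate on a fibre of `𝒟°` with respect to the covector defined by `x`. -/
noncomputable def coordAt (x : S) (c : Orb Γ S) (hx : orb Γ x = c) : sys.AnnFiber c ≃L[ℝ] ℝ :=
  ((LinearEquiv.ofBijective (LinearMap.toSpanSingleton ℝ (sys.AnnFiber c) (sys.covectorAt x c hx))
    ⟨smul_left_injective ℝ (sys.covectorAt_ne_zero x c hx), fun α =>
      (sys.exists_eq_smul_covectorAt x c hx α).imp fun _ h => h.symm⟩).toContinuousLinearEquiv).symm

theorem coordAt_symm (x : S) (c : Orb Γ S) (hx : orb Γ x = c) (t : ℝ) :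
    (sys.coordAt x c hx).symm t = t • (sys.covectorAt x c hx : sys.AnnFiber c) := rfl

theorem coordAt_coordAt_symm (x y : S) (c : Orb Γ S) (hx : orb Γ x = c) (hy : orb Γ y = c) (s : Γ)
    (hs : y = s • x) (t : ℝ) :
    sys.coordAt x c hx ((sys.coordAt y c hy).symm t) = scalingCoord s * t := by
  rw [← ContinuousLinearEquiv.eq_symm_apply, coordAt_symm, coordAt_symm,
    sys.covectorAt_smul x y c hx hy s hs, mul_comm]
  exact smul_smul t (scalingCoord s) (sys.covectorAt x c hx)

/-- The smooth frames `σ^* λ` of the line bundle `𝒟° → C`, for smooth local sections `σ` of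
`S → C`: the covector of `σ c` is the value at `c` of the pull-back of `λ` by `σ`. -/
noncomputable def annFrames : LineFrames E₂ sys.AnnFiber where
  dom i := (sys.principal_scaling.locally_trivial i).choose
  isOpen_dom i := (sys.principal_scaling.locally_trivial i).choose_spec.1
  mem_dom i := (sys.principal_scaling.locally_trivial i).choose_spec.2.1
  coord i k := sys.coordAt ((sys.principal_scaling.locally_trivial i).choose_spec.2.2.choose k) k
    ((sys.principal_scaling.locally_trivial i).choose_spec.2.2.choose_spec.1 k)
  contMDiffOn_coord i j := by
    set a := (sys.principal_scaling.locally_trivial i).choose_spec.2.2.choose with ha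
    set b := (sys.principal_scaling.locally_trivial j).choose_spec.2.2.choose with hb
    have hai := (sys.principal_scaling.locally_trivial i).choose_spec.2.2.choose_spec
    have hbi := (sys.principal_scaling.locally_trivial j).choose_spec.2.2.choose_spec
    rw [← ha] at hai
    rw [← hb] at hbi
    set U := (sys.principal_scaling.locally_trivial i).choose ∩
      (sys.principal_scaling.locally_trivial j).choose with hUdef
    have hU : IsOpen U := (sys.principal_scaling.locally_trivial i).choose_spec.1.inter
      (sys.principal_scaling.locally_trivial j).choose_spec.1
    obtain ⟨g, hg, hgab⟩ := sys.principal_scaling.exists_div hU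
      (hbi.2.1.mono Set.inter_subset_right) (hai.2.1.mono Set.inter_subset_left)
      (fun n _ => (hbi.1 n).trans (hai.1 n).symm)
    refine ((contMDiff_scalingCoord Γ).comp_contMDiffOn hg).congr ?_
    intro k hk
    rw [sys.coordAt_coordAt_symm (b k) (a k) k (hbi.1 k) (hai.1 k) (g k) (hgab k hk), mul_one]
    rfl

noncomputable instance : TopologicalSpace (TotalSpace ℝ sys.AnnFiber) :=
  sys.annFrames.prebundle.totalSpaceTopology

noncomputable instance : FiberBundle ℝ sys.AnnFiber := sys.annFrames.prebundle.toFiberBundle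

instance : VectorBundle ℝ ℝ sys.AnnFiber := sys.annFrames.prebundle.toVectorBundle

instance [IsManifold 𝓘(ℝ, E₂) ∞ (Orb Γ S)] : ContMDiffVectorBundle ∞ ℝ sys.AnnFiber 𝓘(ℝ, E₂) :=
  letI := sys.annFrames.prebundle_isContMDiff
  sys.annFrames.prebundle.contMDiffVectorBundle 𝓘(ℝ, E₂)

theorem annFiber_mk_eq (sys : CompatibleSystem E E₁ E₂ E₃ E₄ EG S G Γ)
    {c d : Orb Γ S} (hc : c = d) {α : sys.AnnFiber c} {β : sys.AnnFiber d}
    (h : ∀ v : E₂, α.1 v = β.1 v) :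
    (⟨c, α⟩ : TotalSpace ℝ sys.AnnFiber) = ⟨d, β⟩ := by
  subst hc
  exact congrArg _ (Subtype.ext (ContinuousLinearMap.ext h))

theorem exists_local_lift (sys : CompatibleSystem E E₁ E₂ E₃ E₄ EG S G Γ) (b : Orb G (Orb Γ S)) :
    ∃ U : Set (Orb G (Orb Γ S)), IsOpen U ∧ b ∈ U ∧ ∃ ξ : Orb G (Orb Γ S) → S,
      (∀ c, orb G (orb Γ (ξ c)) = c) ∧ ContMDiffOn 𝓘(ℝ, E₄) 𝓘(ℝ, E) ∞ ξ U := by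
  obtain ⟨V, hV, hbV, τ, hτ, hτs, -⟩ := sys.principal_symmetry_quotient.locally_trivial b
  obtain ⟨U, hU, hbU, σ, hσ, hσs, -⟩ := sys.principal_scaling.locally_trivial (τ b)
  refine ⟨V ∩ τ ⁻¹' U, hτs.continuousOn.isOpen_inter_preimage hV hU, ⟨hbV, hbU⟩,
    fun c => σ (τ c), fun c => by rw [hσ, hτ], ?_⟩
  exact hσs.comp (hτs.mono Set.inter_subset_left) fun c hc => hc.2

section action
variable [IsManifold 𝓘(ℝ, E₂) ∞ (Orb Γ S)]

theorem mem_contactDistribution_symmetry (sys : CompatibleSystem E E₁ E₂ E₃ E₄ EG S G Γ)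
    (g : G) (c : Orb Γ S) (v : E₂)
    (hv : (⟨c, v⟩ : TangentBundle 𝓘(ℝ, E₂) (Orb Γ S)) ∈ sys.contactDistribution) :
    tangentMap 𝓘(ℝ, E₂) 𝓘(ℝ, E₂) (fun c : Orb Γ S => g • c) ⟨c, v⟩ ∈ sys.contactDistribution := by
  obtain ⟨y, u, rfl, hu, rfl⟩ := (sys.mem_contactDistribution c v).mp hv
  refine (sys.mem_contactDistribution _ _).mpr ⟨g • y, tmap E E (fun y : S => g • y) y u, rfl, ?_,
    sys.tmap_orb_symmetry g y u⟩
  rw [sys.liouville_symmetry, hu]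

theorem tmap_inv_smul (sys : CompatibleSystem E E₁ E₂ E₃ E₄ EG S G Γ) (g : G) (c : Orb Γ S) (v : E₂) :
    tmap E₂ E₂ (fun c : Orb Γ S => g⁻¹ • c) (g • c) (tmap E₂ E₂ (fun c : Orb Γ S => g • c) c v) =
      v := by
  have hg : ∀ (g : G) c, MDifferentiableAt 𝓘(ℝ, E₂) 𝓘(ℝ, E₂) (fun c : Orb Γ S => g • c) c :=
    fun g => (sys.principal_symmetry_quotient.contMDiff_const_smul g).mdifferentiable (by simp)
  have h := tmap_comp (hg g⁻¹ (g • c)) (hg g c) rfl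
  simp only [inv_smul_smul] at h
  rw [tmap_id] at h
  exact (congrArg (fun L : E₂ →L[ℝ] E₂ => L v) h).symm

/-- The cotangent lift `α ↦ α ∘ T(g⁻¹)` of the action of `G`. -/
noncomputable def cotangentLift (g : G) (c : Orb Γ S) (α : sys.AnnFiber c) : sys.AnnFiber (g • c) :=
  ⟨(show E₂ →L[ℝ] ℝ from α.1).comp (tmap E₂ E₂ (fun d : Orb Γ S => g⁻¹ • d) (g • c)), by
    intro v hv
    have h := sys.mem_contactDistribution_symmetry g⁻¹ (g • c) v hv
    obtain ⟨y, u, hy, hu, e⟩ := (sys.mem_contactDistribution _ _).mp h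
    have hy : orb Γ y = c := Eq.trans hy (inv_smul_smul g c)
    exact α.2 _ ((sys.mem_contactDistribution _ _).mpr ⟨y, u, hy, hu, e⟩)⟩

/-- The action of `G` on `𝒟°` by cotangent lift. -/
noncomputable instance : MulAction G (TotalSpace ℝ sys.AnnFiber) where
  smul g p := ⟨g • p.1, sys.cotangentLift g p.1 p.2⟩
  one_smul := by
    rintro ⟨c, α⟩
    refine sys.annFiber_mk_eq (one_smul G c) fun v => ?_
    have h : tmap E₂ E₂ (fun d : Orb Γ S => (1 : G)⁻¹ • d) ((1 : G) • c) v = v := by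
      simp only [inv_one, one_smul, tmap_id]
      rfl
    exact congrArg (show E₂ →L[ℝ] ℝ from α.1) h
  mul_smul := by
    rintro g k ⟨c, α⟩
    refine sys.annFiber_mk_eq (mul_smul g k c) fun v => ?_
    have hg : ∀ (g : G) c, MDifferentiableAt 𝓘(ℝ, E₂) 𝓘(ℝ, E₂) (fun c : Orb Γ S => g • c) c :=
      fun g => (sys.principal_symmetry_quotient.contMDiff_const_smul g).mdifferentiable (by simp)
    have h := tmap_comp (x := (g * k) • c) (hg k⁻¹ (k • c)) (hg g⁻¹ ((g * k) • c))
      (by rw [mul_smul, inv_smul_smul])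
    have h2 : tmap E₂ E₂ (fun d : Orb Γ S => (g * k)⁻¹ • d) ((g * k) • c) v =
        tmap E₂ E₂ (fun d : Orb Γ S => k⁻¹ • d) (k • c)
          (tmap E₂ E₂ (fun d : Orb Γ S => g⁻¹ • d) (g • k • c) v) := by
      rw [← mul_smul g k c]
      simp only [mul_inv_rev, mul_smul k⁻¹ g⁻¹]
      exact congrArg (fun L : E₂ →L[ℝ] E₂ => L v) h
    exact congrArg (show E₂ →L[ℝ] ℝ from α.1) h2

theorem smul_annFiber (g : G) (c : Orb Γ S) (α : sys.AnnFiber c) :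
    g • (⟨c, α⟩ : TotalSpace ℝ sys.AnnFiber) = ⟨g • c, sys.cotangentLift g c α⟩ := rfl

theorem cotangentLift_covector (g : G) (x : S) (t : ℝ) :
    sys.cotangentLift g (orb Γ x) (t • sys.covector x) = t • sys.covector (g • x) := by
  refine sys.annihilator_ext (g • x) fun u' => ?_
  obtain ⟨u, rfl⟩ : ∃ u, u' = tmap E E (fun y : S => g • y) x u := by
    have hg : ∀ (g : G) c, MDifferentiableAt 𝓘(ℝ, E) 𝓘(ℝ, E) (fun c : S => g • c) c :=
      fun g => (sys.principal_symmetry.contMDiff_const_smul g).mdifferentiable (by simp)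
    have h := tmap_comp (hg g x) (hg g⁻¹ (g • x)) (inv_smul_smul g x)
    simp only [smul_inv_smul] at h
    rw [tmap_id] at h
    exact ⟨_, congrArg (fun L : E →L[ℝ] E => L u') h⟩
  have h1 : sys.covectorAt (g • x) (g • orb Γ x) rfl =
      sys.covectorAt (g • x) (orb Γ (g • x)) rfl := rfl
  have h2 := sys.covectorAt_apply (g • x) (g • orb Γ x) rfl (tmap E E (fun y : S => g • y) x u)
  have h3 := sys.covectorAt_apply x (orb Γ x) rfl u
  rw [sys.liouville_symmetry] at h2
  have h4 : tmap E₂ E₂ (fun d : Orb Γ S => g⁻¹ • d) (g • orb Γ x)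
      (tmap E E₂ (orb Γ) (g • x) (tmap E E (fun y : S => g • y) x u)) =
      tmap E E₂ (orb Γ) x u := by
    rw [sys.tmap_orb_symmetry, sys.tmap_inv_smul]
  show t * (sys.covectorAt x (orb Γ x) rfl).1 (tmap E₂ E₂ (fun d : Orb Γ S => g⁻¹ • d)
    (g • orb Γ x) (tmap E E₂ (orb Γ) (g • x) (tmap E E (fun y : S => g • y) x u))) =
    t * (sys.covectorAt (g • x) (g • orb Γ x) rfl).1
      (tmap E E₂ (orb Γ) (g • x) (tmap E E (fun y : S => g • y) x u))
  rw [h4, h2, h3]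

/-- The projection `𝒟°/G → C/G`. -/
noncomputable def annProj : Orb G (TotalSpace ℝ sys.AnnFiber) → Orb G (Orb Γ S) :=
  Quotient.lift (fun p => orb G p.1) (by
    rintro _ p ⟨g, rfl⟩
    exact orb_eq_orb.mpr ⟨g, rfl⟩)

/-- The fibre of `𝒟°/G → C/G` over `b`. -/
def AnnQuot (b : Orb G (Orb Γ S)) : Type _ :=
  {q : Orb G (TotalSpace ℝ sys.AnnFiber) // sys.annProj q = b}

namespace AnnQuot

/-- The class of `α ∈ 𝒟°` in the fibre over `b`. -/
noncomputable def mkAt (c : Orb Γ S) (b : Orb G (Orb Γ S)) (hc : orb G c = b) (α : sys.AnnFiber c) :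
    sys.AnnQuot b := ⟨orb G ⟨c, α⟩, hc⟩

theorem mkAt_smul (c d : Orb Γ S) (b : Orb G (Orb Γ S)) (hc : orb G c = b) (hd : orb G d = b)
    (g : G) (α : sys.AnnFiber c) (β : sys.AnnFiber d) (h : (⟨d, β⟩ : TotalSpace ℝ sys.AnnFiber) = g • ⟨c, α⟩) :
    mkAt sys d b hd β = mkAt sys c b hc α :=
  Subtype.ext (orb_eq_orb.mpr ⟨g, h.symm⟩)

theorem mkAt_bijective (c : Orb Γ S) (b : Orb G (Orb Γ S)) (hc : orb G c = b) :
    Function.Bijective (mkAt sys c b hc) := by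
  constructor
  · intro α β e
    obtain ⟨g, hg⟩ := orb_eq_orb.mp (congrArg Subtype.val e)
    have h1 : g = 1 := sys.principal_symmetry_quotient.free g c (congrArg TotalSpace.proj hg)
    rw [h1, one_smul] at hg
    exact (TotalSpace.mk_inj.mp hg).symm
  · rintro ⟨q, hq⟩
    induction q using Quotient.inductionOn with
    | h p =>
      obtain ⟨d, α⟩ := p
      obtain ⟨g, rfl⟩ := orb_eq_orb.mp (hc.trans hq.symm)
      exact ⟨sys.cotangentLift g d α, Subtype.ext (orb_eq_orb.mpr ⟨g, rfl⟩)⟩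

/-- The identification of the fibre of `𝒟°/G` over `b = [c]` with the fibre of `𝒟°` over `c`, for
one choice of `c`. -/
noncomputable def outEquiv (b : Orb G (Orb Γ S)) : sys.AnnQuot b ≃ sys.AnnFiber b.out :=
  (Equiv.ofBijective _ (mkAt_bijective sys b.out b (Quotient.out_eq b))).symm

/-- The vector space structure with `a [α] + b [β] = [a α + b β]` for `α` and `β` over the same point. -/
noncomputable instance (b : Orb G (Orb Γ S)) : AddCommGroup (sys.AnnQuot b) :=
  (outEquiv sys b).addCommGroup

noncomputable instance (b : Orb G (Orb Γ S)) : Module ℝ (sys.AnnQuot b) :=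
  (outEquiv sys b).module ℝ

noncomputable instance (b : Orb G (Orb Γ S)) : TopologicalSpace (sys.AnnQuot b) :=
  TopologicalSpace.induced (outEquiv sys b) inferInstance

/-- The identification as an isomorphism of topological vector spaces. -/
noncomputable def outLin (b : Orb G (Orb Γ S)) : sys.AnnQuot b ≃L[ℝ] sys.AnnFiber b.out :=
  { (outEquiv sys b).linearEquiv ℝ with
    continuous_toFun := continuous_induced_dom
    continuous_invFun := by
      refine continuous_induced_rng.mpr ?_
      have : (outEquiv sys b) ∘ (outEquiv sys b).symm = id := by ext; simp
      exact this ▸ continuous_id }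

/-- The coordinate on a fibre of `𝒟°/G` with respect to the class of the covector of `x`. -/
noncomputable def coordAt (x : S) (b : Orb G (Orb Γ S)) (hx : orb G (orb Γ x) = b) :
    sys.AnnQuot b ≃L[ℝ] ℝ :=
  (outLin sys b).trans (sys.coordAt ((exists_smul_orb_eq_out x b hx).choose • x) b.out
    (exists_smul_orb_eq_out x b hx).choose_spec)

theorem coordAt_symm (x : S) (b : Orb G (Orb Γ S)) (hx : orb G (orb Γ x) = b) (t : ℝ) :
    (coordAt sys x b hx).symm t =
      mkAt sys (orb Γ x) b hx (t • sys.covector x) := by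
  have key : ∀ (c : Orb Γ S) (hc : orb G c = b) (g : G) (hg : orb Γ (g • x) = c),
      mkAt sys c b hc (t • (sys.covectorAt (g • x) c hg : sys.AnnFiber c)) =
      mkAt sys (orb Γ x) b hx (t • sys.covector x) := by
    rintro _ hc g rfl
    refine mkAt_smul sys _ _ b hx hc g _ _ ?_
    exact (congrArg (TotalSpace.mk (F := ℝ) (g • orb Γ x)) (sys.cotangentLift_covector g x t)).symm
  exact key b.out (Quotient.out_eq b) _ (exists_smul_orb_eq_out x b hx).choose_spec

theorem coordAt_coordAt_symm (x y : S) (b : Orb G (Orb Γ S)) (hx : orb G (orb Γ x) = b)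
    (hy : orb G (orb Γ y) = b) (g : G) (s : Γ) (hs : y = s • g • x) (t : ℝ) :
    coordAt sys x b hx ((coordAt sys y b hy).symm t) = scalingCoord s * t := by
  subst hs
  rw [← ContinuousLinearEquiv.eq_symm_apply, coordAt_symm, coordAt_symm]
  refine mkAt_smul sys _ _ b hx hy g _ _ ?_
  refine Eq.trans ?_
    (congrArg (TotalSpace.mk (F := ℝ) (g • orb Γ x)) (sys.cotangentLift_covector g x _)).symm
  have h1 : orb Γ (s • g • x) = g • orb Γ x := orb_eq_orb.mpr ⟨s, rfl⟩
  refine sys.annFiber_mk_eq h1 fun v => ?_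
  have h2 := sys.covectorAt_smul (g • x) (s • g • x) (g • orb Γ x) rfl h1 s rfl
  have h3 : ∀ (d : Orb Γ S) (hd : orb Γ (s • g • x) = d) (v : E₂),
      (sys.covectorAt (s • g • x) _ rfl).1 v = (sys.covectorAt (s • g • x) d hd).1 v := by
    rintro _ rfl _; rfl
  show t * (sys.covectorAt (s • g • x) _ rfl).1 v =
    (scalingCoord s * t) * (sys.covectorAt (g • x) (g • orb Γ x) rfl).1 v
  rw [h3 _ h1 v, h2]
  show t * (scalingCoord s * (sys.covectorAt (g • x) (g • orb Γ x) rfl).1 v) = _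
  ring

end AnnQuot

variable [LieGroup 𝓘(ℝ, EG) ∞ G]

/-- The smooth frames `b ↦ [α_{ξ b}]` of `𝒟°/G`, for smooth local maps `ξ : C/G → S` lifting the
points of `C/G`. -/
noncomputable def annQuotFrames : LineFrames E₄ sys.AnnQuot where
  dom i := (sys.exists_local_lift i).choose
  isOpen_dom i := (sys.exists_local_lift i).choose_spec.1
  mem_dom i := (sys.exists_local_lift i).choose_spec.2.1
  coord i k := AnnQuot.coordAt sys ((sys.exists_local_lift i).choose_spec.2.2.choose k) k
    ((sys.exists_local_lift i).choose_spec.2.2.choose_spec.1 k)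
  contMDiffOn_coord i j := by
    set a := (sys.exists_local_lift i).choose_spec.2.2.choose with ha
    set b := (sys.exists_local_lift j).choose_spec.2.2.choose with hb
    have hai := (sys.exists_local_lift i).choose_spec.2.2.choose_spec
    have hbi := (sys.exists_local_lift j).choose_spec.2.2.choose_spec
    rw [← ha] at hai
    rw [← hb] at hbi
    set U := (sys.exists_local_lift i).choose ∩ (sys.exists_local_lift j).choose with hUdef
    have hU : IsOpen U :=
      (sys.exists_local_lift i).choose_spec.1.inter (sys.exists_local_lift j).choose_spec.1
    have haU := hai.2.mono (Set.inter_subset_left : U ⊆ _)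
    have hbU := hbi.2.mono (Set.inter_subset_right : U ⊆ _)
    have hp := sys.principal_scaling.contMDiff_orb
    obtain ⟨g, hg, hgab⟩ := sys.principal_symmetry_quotient.exists_div hU
      (hp.comp_contMDiffOn hbU) (hp.comp_contMDiffOn haU)
      (fun n _ => (hbi.1 n).trans (hai.1 n).symm)
    obtain ⟨s, hs, hsab⟩ := sys.principal_scaling.exists_div hU
      (sys.principal_symmetry.contMDiff_smul.comp_contMDiffOn (hg.prodMk hbU)) haU
      (fun n hn => (hgab n hn).symm)
    refine ((contMDiff_scalingCoord Γ).comp_contMDiffOn hs).congr ?_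
    intro k hk
    rw [AnnQuot.coordAt_coordAt_symm sys (b k) (a k) k (hbi.1 k) (hai.1 k) (g k) (s k) (hsab k hk),
      mul_one]
    rfl

noncomputable instance : TopologicalSpace (TotalSpace ℝ sys.AnnQuot) :=
  sys.annQuotFrames.prebundle.totalSpaceTopology

noncomputable instance : FiberBundle ℝ sys.AnnQuot := sys.annQuotFrames.prebundle.toFiberBundle

instance : VectorBundle ℝ ℝ sys.AnnQuot := sys.annQuotFrames.prebundle.toVectorBundle

instance [IsManifold 𝓘(ℝ, E₄) ∞ (Orb G (Orb Γ S))] :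
    ContMDiffVectorBundle ∞ ℝ sys.AnnQuot 𝓘(ℝ, E₄) :=
  letI := sys.annQuotFrames.prebundle_isContMDiff
  sys.annQuotFrames.prebundle.contMDiffVectorBundle 𝓘(ℝ, E₄)

end action

end CompatibleSystem
namespace CompatibleSystem
variable {E E₁ E₂ E₃ E₄ EG S G : Type*} {Γ : Subgroup ℝˣ} [Fact (Γ = ⊤ ∨ Γ = Units.posSubgroup ℝ)]
  [NormedAddCommGroup E] [NormedSpace ℝ E] [NormedAddCommGroup E₁] [NormedSpace ℝ E₁]
  [NormedAddCommGroup E₂] [NormedSpace ℝ E₂] [NormedAddCommGroup E₃] [NormedSpace ℝ E₃]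
  [NormedAddCommGroup E₄] [NormedSpace ℝ E₄] [NormedAddCommGroup EG] [NormedSpace ℝ EG]
  [TopologicalSpace S] [ChartedSpace E S] [IsManifold 𝓘(ℝ, E) ∞ S]
  [Group G] [TopologicalSpace G] [ChartedSpace EG G]
  [MulAction G S] [MulAction Γ S] [SMulCommClass G Γ S] [SMulCommClass Γ G S]
  [ChartedSpace E₁ (Orb G S)] [ChartedSpace E₂ (Orb Γ S)]
  [ChartedSpace E₃ (Orb Γ (Orb G S))] [ChartedSpace E₄ (Orb G (Orb Γ S))]
  (sys : CompatibleSystem E E₁ E₂ E₃ E₄ EG S G Γ)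


/-- The symplectic form read in the model space. -/
noncomputable def formL (x : S) : E →L[ℝ] E →L[ℝ] ℝ := sys.sympl.form x

/-- The Hamiltonian vector field read in the model space. -/
noncomputable def hamVec (f : S → ℝ) (x : S) : E := sys.sympl.hamiltonianField f x

theorem formL_hamVec [FiniteDimensional ℝ E] (f : S → ℝ) (x : S) :
    sys.formL x (sys.hamVec f x) = tmap E ℝ f x := by
  have hinj : Function.Injective (fun v : E => sys.formL x v) := by
    intro v w h
    have : v - w = 0 := sys.sympl.nondegenerate x (v - w) fun u => by
      have h2 : sys.formL x (v - w) = 0 := by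
        rw [map_sub, show sys.formL x v = sys.formL x w from h, sub_self]
      exact congrArg (fun L : E →L[ℝ] ℝ => L u) h2
    exact sub_eq_zero.mp this
  have hsurj : Function.Surjective (fun v : E => sys.formL x v) := by
    have hd : Module.finrank ℝ E = Module.finrank ℝ (E →L[ℝ] ℝ) := by
      rw [← (LinearMap.toContinuousLinearMap (𝕜 := ℝ) (E := E) (F' := ℝ)).finrank_eq]
      exact (Subspace.dual_finrank_eq).symm
    exact (LinearMap.injective_iff_surjective_of_finrank_eq_finrank hd
      (f := (sys.formL x).toLinearMap)).mp hinj
  exact Function.invFun_eq (hsurj (tmap E ℝ f x))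

theorem tmap_invariant (sys : CompatibleSystem E E₁ E₂ E₃ E₄ EG S G Γ) {f : S → ℝ} (hf : ∀ (g : G) x, f (g • x) = f x)
    (g : G) (x : S) (u : E) :
    tmap E ℝ f (g • x) (tmap E E (fun y : S => g • y) x u) = tmap E ℝ f x u := by
  have hs : ∀ (g : G) (x : S), MDifferentiableAt 𝓘(ℝ, E) 𝓘(ℝ, E) (fun y : S => g • y) x :=
    fun g => (sys.principal_symmetry.contMDiff_const_smul g).mdifferentiable (by simp)
  by_cases hd : MDifferentiableAt 𝓘(ℝ, E) 𝓘(ℝ, ℝ) f (g • x)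
  · have h := tmap_comp hd (hs g x) rfl
    simp only [hf] at h
    exact (congrArg (fun L : E →L[ℝ] ℝ => L u) h).symm
  · have hd2 : ¬ MDifferentiableAt 𝓘(ℝ, E) 𝓘(ℝ, ℝ) f x := by
      intro h
      apply hd
      have h2 : MDifferentiableAt 𝓘(ℝ, E) 𝓘(ℝ, ℝ) f (g⁻¹ • g • x) := by rwa [inv_smul_smul]
      have h3 := h2.comp (g • x) (hs g⁻¹ (g • x))
      have h4 : f ∘ (fun y : S => g⁻¹ • y) = f := funext fun y => hf _ _
      rwa [h4] at h3
    have e1 : tmap E ℝ f (g • x) = 0 := mfderiv_zero_of_not_mdifferentiableAt hd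
    have e2 : tmap E ℝ f x = 0 := mfderiv_zero_of_not_mdifferentiableAt hd2
    rw [e1, e2]
    rfl

theorem poisson_symmetry [FiniteDimensional ℝ E] (sys : CompatibleSystem E E₁ E₂ E₃ E₄ EG S G Γ) {f k : S → ℝ}
    (hf : ∀ (g : G) x, f (g • x) = f x) (hk : ∀ (g : G) x, k (g • x) = k x) (g : G) (x : S) :
    sys.sympl.poisson f k (g • x) = sys.sympl.poisson f k x := by
  have hs : ∀ (g : G) (x : S), MDifferentiableAt 𝓘(ℝ, E) 𝓘(ℝ, E) (fun y : S => g • y) x :=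
    fun g => (sys.principal_symmetry.contMDiff_const_smul g).mdifferentiable (by simp)
  have key : ∀ {f : S → ℝ}, (∀ (g : G) x, f (g • x) = f x) →
      sys.hamVec f (g • x) = tmap E E (fun y : S => g • y) x (sys.hamVec f x) := by
    intro f hf
    rw [← sub_eq_zero]
    refine sys.sympl.nondegenerate (g • x) _ fun w' => ?_
    have h := tmap_comp (hs g x) (hs g⁻¹ (g • x)) (inv_smul_smul g x)
    simp only [smul_inv_smul] at h
    rw [tmap_id] at h
    obtain ⟨w, rfl⟩ : ∃ w, w' = tmap E E (fun y : S => g • y) x w :=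
      ⟨_, congrArg (fun L : E →L[ℝ] E => L w') h⟩
    have h1 := congrArg (fun L : E →L[ℝ] ℝ => L (tmap E E (fun y : S => g • y) x w))
      (sys.formL_hamVec f (g • x))
    have h2 := congrArg (fun L : E →L[ℝ] ℝ => L w) (sys.formL_hamVec f x)
    have h3 : sys.formL (g • x) (tmap E E (fun y : S => g • y) x (sys.hamVec f x))
      (tmap E E (fun y : S => g • y) x w) = sys.formL x (sys.hamVec f x) w :=
      sys.form_symmetry g x (sys.hamVec f x) w
    have h4 := sys.tmap_invariant hf g x w
    show sys.formL (g • x) (sys.hamVec f (g • x) -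
      tmap E E (fun y : S => g • y) x (sys.hamVec f x)) (tmap E E (fun y : S => g • y) x w) = 0
    rw [map_sub, sub_apply, h3]
    exact sub_eq_zero.mpr (h1.trans (h4.trans h2.symm))
  show sys.formL (g • x) (sys.hamVec f (g • x)) (sys.hamVec k (g • x)) = _
  rw [key hf, key hk]
  exact sys.form_symmetry g x (sys.hamVec f x) (sys.hamVec k x)

/-- The reduced Poisson bracket on `S/G`: `{f, k}([x]) = {f ∘ ℘, k ∘ ℘}(x)`, `℘ : S → S/G`. -/
noncomputable def reducedPoisson [FiniteDimensional ℝ E] (f k : Orb G S → ℝ) : Orb G S → ℝ :=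
  Quotient.lift (fun x => sys.sympl.poisson (fun y => f (orb G y)) (fun y => k (orb G y)) x) (by
    rintro _ x ⟨g, rfl⟩
    have h : ∀ (g : G) (y : S), orb G (g • y) = orb G y := fun g y => orb_eq_orb.mpr ⟨g, rfl⟩
    exact sys.poisson_symmetry (fun g y => by rw [h]) (fun g y => by rw [h]) g x)

/-- The reduced Hamiltonian `H^G` on `S/G`: `H^G([x]) = H x`. -/
def reducedHam : Orb G S → ℝ :=
  Quotient.lift sys.ham (by
    rintro _ x ⟨g, rfl⟩
    exact sys.ham_symmetry g x)

end CompatibleSystem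

section kirillov

variable {EB B : Type*} [NormedAddCommGroup EB] [NormedSpace ℝ EB] [TopologicalSpace B]
  [ChartedSpace EB B]

variable (EB) in
/-- The smooth sections of the dual `V^*` of a line bundle `V → B`: families of linear forms on
the fibres which are smooth as functions on the total space. -/
def dualSections (V : B → Type*) [∀ b, AddCommGroup (V b)] [∀ b, Module ℝ (V b)]
    [∀ b, TopologicalSpace (V b)] [TopologicalSpace (TotalSpace ℝ V)] [FiberBundle ℝ V] :
    Submodule ℝ (∀ b, V b →ₗ[ℝ] ℝ) where
  carrier := {h | ContMDiff (𝓘(ℝ, EB).prod 𝓘(ℝ, ℝ)) 𝓘(ℝ, ℝ) ∞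
    (fun v : TotalSpace ℝ V => h v.1 v.2)}
  add_mem' := fun ha hb => ContMDiff.add ha hb
  zero_mem' := contMDiff_const
  smul_mem' r _ ha := ContMDiff.mul (contMDiff_const (c := r)) ha

variable (EB) in
/-- A Kirillov structure on the line bundle `V → B`: a Lie bracket on the sections of `V^*` which
is a first order differential operator, `[f h₁, h₂] = f [h₁, h₂] + X_{h₂}(f) h₁`. The smooth vector
field `X_h = symbol h` is the Hamiltonian vector field of `h`. In `bracket_mul`, `k = f h₁`. -/
structure KirillovStructure [IsManifold 𝓘(ℝ, EB) ∞ B] (V : B → Type*) [∀ b, AddCommGroup (V b)]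
    [∀ b, Module ℝ (V b)]
    [∀ b, TopologicalSpace (V b)] [TopologicalSpace (TotalSpace ℝ V)] [FiberBundle ℝ V] where
  bracket : dualSections EB V →ₗ[ℝ] dualSections EB V →ₗ[ℝ] dualSections EB V
  bracket_self : ∀ h, bracket h h = 0
  jacobi : ∀ h₁ h₂ h₃, bracket h₁ (bracket h₂ h₃) + bracket h₂ (bracket h₃ h₁) +
    bracket h₃ (bracket h₁ h₂) = 0
  symbol : dualSections EB V → ∀ b : B, TangentSpace 𝓘(ℝ, EB) b
  isSmoothField_symbol : ∀ h, IsSmoothField (symbol h)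
  bracket_mul : ∀ f : B → ℝ, ContMDiff 𝓘(ℝ, EB) 𝓘(ℝ, ℝ) ∞ f → ∀ h₁ k h₂ : dualSections EB V,
    (∀ b v, k.1 b v = f b * h₁.1 b v) → ∀ b v,
      (bracket k h₂).1 b v = f b * (bracket h₁ h₂).1 b v +
        differential f b (symbol h₂ b) * h₁.1 b v

variable {EB' B' : Type*} [NormedAddCommGroup EB'] [NormedSpace ℝ EB'] [TopologicalSpace B']
  [ChartedSpace EB' B']

variable (EB EB') in
/-- An isomorphism of line bundles: a diffeomorphism of the total spaces which is linear on the
fibres and covers a diffeomorphism of the bases. -/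
structure LineBundleIso (V : B → Type*) [∀ b, AddCommGroup (V b)] [∀ b, Module ℝ (V b)]
    [∀ b, TopologicalSpace (V b)] [TopologicalSpace (TotalSpace ℝ V)] [FiberBundle ℝ V]
    (W : B' → Type*) [∀ b, AddCommGroup (W b)] [∀ b, Module ℝ (W b)]
    [∀ b, TopologicalSpace (W b)] [TopologicalSpace (TotalSpace ℝ W)] [FiberBundle ℝ W] where
  base : Diffeomorph 𝓘(ℝ, EB) 𝓘(ℝ, EB') B B' ∞
  total : Diffeomorph (𝓘(ℝ, EB).prod 𝓘(ℝ, ℝ)) (𝓘(ℝ, EB').prod 𝓘(ℝ, ℝ))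
    (TotalSpace ℝ V) (TotalSpace ℝ W) ∞
  fiber : ∀ b : B, V b ≃ₗ[ℝ] W (base b)
  total_mk : ∀ (b : B) (v : V b), total ⟨b, v⟩ = ⟨base b, fiber b v⟩

/-- The section `b ↦ Ψ_b^* (h (ψ b))` of `V^*`. -/
noncomputable def LineBundleIso.pullback {V : B → Type*} [∀ b, AddCommGroup (V b)] [∀ b, Module ℝ (V b)]
    [∀ b, TopologicalSpace (V b)] [TopologicalSpace (TotalSpace ℝ V)] [FiberBundle ℝ V]
    {W : B' → Type*} [∀ b, AddCommGroup (W b)] [∀ b, Module ℝ (W b)]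
    [∀ b, TopologicalSpace (W b)] [TopologicalSpace (TotalSpace ℝ W)] [FiberBundle ℝ W]
    (Ψ : LineBundleIso EB EB' V W) (h : dualSections EB' W) : dualSections EB V :=
  ⟨fun b => h.1 (Ψ.base b) ∘ₗ (Ψ.fiber b).toLinearMap, by
    have e : (fun v : TotalSpace ℝ V => (h.1 (Ψ.base v.1) ∘ₗ (Ψ.fiber v.1).toLinearMap) v.2) =
        (fun w : TotalSpace ℝ W => h.1 w.1 w.2) ∘ Ψ.total := by
      funext ⟨b, v⟩
      exact congrArg (fun w : TotalSpace ℝ W => h.1 w.1 w.2) (Ψ.total_mk b v).symm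
    have hc := ContMDiff.comp h.2 Ψ.total.contMDiff
    rw [← e] at hc
    exact hc⟩

end kirillov

namespace CompatibleSystem
variable {E E₁ E₂ E₃ E₄ EG S G : Type*} {Γ : Subgroup ℝˣ} [Fact (Γ = ⊤ ∨ Γ = Units.posSubgroup ℝ)]
  [NormedAddCommGroup E] [NormedSpace ℝ E] [NormedAddCommGroup E₁] [NormedSpace ℝ E₁]
  [NormedAddCommGroup E₂] [NormedSpace ℝ E₂] [NormedAddCommGroup E₃] [NormedSpace ℝ E₃]
  [NormedAddCommGroup E₄] [NormedSpace ℝ E₄] [NormedAddCommGroup EG] [NormedSpace ℝ EG]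
  [TopologicalSpace S] [ChartedSpace E S] [IsManifold 𝓘(ℝ, E) ∞ S]
  [Group G] [TopologicalSpace G] [ChartedSpace EG G]
  [MulAction G S] [MulAction Γ S] [SMulCommClass G Γ S] [SMulCommClass Γ G S]
  [ChartedSpace E₁ (Orb G S)] [ChartedSpace E₂ (Orb Γ S)]
  [ChartedSpace E₃ (Orb Γ (Orb G S))] [ChartedSpace E₄ (Orb G (Orb Γ S))]
  (sys : CompatibleSystem E E₁ E₂ E₃ E₄ EG S G Γ)


/-- The line bundle `L = (S/G × ℝ)/Γ` over `(S/G)/Γ`. -/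
abbrev LineL : Orb Γ (Orb G S) → Type _ := AssocFiber sys.principal_scaling_quotient

/-- The homogeneous function `y ↦ h([(y, 1)])` on `S/G` of a section `h` of `L^*`. -/
noncomputable def hamL [IsManifold 𝓘(ℝ, E₃) ∞ (Orb Γ (Orb G S))] (h : dualSections E₃ sys.LineL)
    (y : Orb G S) : ℝ :=
  h.1 (orb Γ y) (AssocFiber.mk sys.principal_scaling_quotient y 1)

/-- The homogeneous function `x ↦ h(α_x)` on `S` of a section `h` of `(𝒟°)^*`. -/
noncomputable def hamC (h : dualSections E₂ sys.AnnFiber) (x : S) : ℝ :=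
  h.1 (orb Γ x) (sys.covector x)

variable [IsManifold 𝓘(ℝ, E₂) ∞ (Orb Γ S)]

/-- The projection `𝒟° → 𝒟°/G`. -/
noncomputable def annMk (c : Orb Γ S) (α : sys.AnnFiber c) : sys.AnnQuot (orb G c) :=
  AnnQuot.mkAt sys c (orb G c) rfl α

variable [LieGroup 𝓘(ℝ, EG) ∞ G]

/-- The section `k` of `(𝒟°/G)^*` is induced by the (then `G`-invariant) section `h` of `(𝒟°)^*`. -/
def Induces (h : dualSections E₂ sys.AnnFiber) (k : dualSections E₄ sys.AnnQuot) : Prop :=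
  ∀ (c : Orb Γ S) (α : sys.AnnFiber c), k.1 (orb G c) (sys.annMk c α) = h.1 c α

end CompatibleSystem

/-!
Each of the three line bundles carries a frame indexed by `S`: the nonvanishing vectors
`[([x], 1)]` of `L`, `α_x` of `𝒟°` and `[α_x]` of `𝒟°/G`, attached smoothly to the points `x` of
`S`. Moving `x` by `s ∈ ℝ^×` multiplies the vector by `s`, moving it by `G` changes nothing in `L`
and `𝒟°/G`, and two points lie over the same base point only if such a motion joins them. Evaluating
a section of the dual bundle on the frame therefore identifies the sections with the functions on
`S` that are homogeneous of degree one (and `G`-invariant, for `L` and `𝒟°/G`).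

Because the action is conformally symplectic, such functions are closed under the Poisson bracket
of `S`, and their Hamiltonian vector fields descend to the base. Transporting `-{·, ·}` through the
identification gives the Kirillov brackets; the symbol of the section corresponding to `F` is the
descent of the Hamiltonian vector field of `-F`.

The frames of `L` and `𝒟°/G` have the same indexing manifold, the same group `G × ℝ^×` and the same
weight, so matching them vector by vector is an isomorphism of line bundles. A section and its
pullback give the same function on `S`, hence sections, brackets and symbols all correspond.
-/

section Differential

variable {E : Type*} [NormedAddCommGroup E] [NormedSpace ℝ E] {M : Type*} [TopologicalSpace M]
  [ChartedSpace E M] {f g : M → ℝ} {x : M}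

theorem differential_mul (hf : MDifferentiableAt 𝓘(ℝ, E) 𝓘(ℝ, ℝ) f x)
    (hg : MDifferentiableAt 𝓘(ℝ, E) 𝓘(ℝ, ℝ) g x) (v : TangentSpace 𝓘(ℝ, E) x) :
    differential (f * g) x v = f x * differential g x v + g x * differential f x v :=
  congrArg (fun L : E →L[ℝ] ℝ => L v) (hf.hasMFDerivAt.mul hg.hasMFDerivAt).mfderiv

theorem differential_neg (f : M → ℝ) (x : M) :
    (differential (-f) x : TangentSpace 𝓘(ℝ, E) x →L[ℝ] ℝ) = -differential f x :=
  mfderiv_neg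

theorem differential_add (hf : MDifferentiableAt 𝓘(ℝ, E) 𝓘(ℝ, ℝ) f x)
    (hg : MDifferentiableAt 𝓘(ℝ, E) 𝓘(ℝ, ℝ) g x) :
    (differential (f + g) x : TangentSpace 𝓘(ℝ, E) x →L[ℝ] ℝ) =
      differential f x + differential g x :=
  mfderiv_add hf hg

theorem differential_const_smul (hf : MDifferentiableAt 𝓘(ℝ, E) 𝓘(ℝ, ℝ) f x) (r : ℝ) :
    (differential (r • f) x : TangentSpace 𝓘(ℝ, E) x →L[ℝ] ℝ) = r • differential f x :=
  const_smul_mfderiv hf r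

variable [IsManifold 𝓘(ℝ, E) ∞ M]

theorem contMDiff_differential (hf : ContMDiff 𝓘(ℝ, E) 𝓘(ℝ, ℝ) ∞ f) :
    ContMDiff 𝓘(ℝ, E) (𝓘(ℝ, E).prod 𝓘(ℝ, E →L[ℝ] ℝ)) ∞
      (fun x => TotalSpace.mk' (E →L[ℝ] ℝ)
        (E := fun x : M => TangentSpace 𝓘(ℝ, E) x →L[ℝ] ℝ) x (differential f x)) := by
  intro x₀
  refine (contMDiffAt_hom_bundle _).mpr ⟨contMDiffAt_id, ?_⟩
  refine ((hf x₀).mfderiv_const (m := ∞) le_rfl).congr_of_eventuallyEq (.of_forall fun x => ?_)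
  ext v
  simp only [inTangentCoordinates, ContinuousLinearMap.inCoordinates,
    Trivial.fiberBundle_trivializationAt', Trivial.continuousLinearMapAt_trivialization,
    ContinuousLinearMap.id_comp, TangentBundle.continuousLinearMapAt_model_space, id_eq]
  rfl

theorem contMDiff_differential_apply (hf : ContMDiff 𝓘(ℝ, E) 𝓘(ℝ, ℝ) ∞ f)
    {X : ∀ x : M, TangentSpace 𝓘(ℝ, E) x} (hX : IsSmoothField X) :
    ContMDiff 𝓘(ℝ, E) 𝓘(ℝ, ℝ) ∞ (fun x => differential f x (X x)) := fun x =>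
  (contMDiffAt_totalSpace.mp (ContMDiff.clm_bundle_apply (F₁ := E)
    (E₁ := fun x : M => TangentSpace 𝓘(ℝ, E) x) (F₂ := ℝ) (E₂ := Bundle.Trivial M ℝ) (b := id)
    (contMDiff_differential hf) hX x)).2

end Differential

section ClmInverse

variable {F F₁ F₂ M : Type*} [NormedAddCommGroup F] [NormedSpace ℝ F]
  [NormedAddCommGroup F₁] [NormedSpace ℝ F₁] [NormedAddCommGroup F₂] [NormedSpace ℝ F₂]
  [TopologicalSpace M] [ChartedSpace F M]
  {V₁ : M → Type*} [TopologicalSpace (TotalSpace F₁ V₁)] [∀ x, AddCommGroup (V₁ x)]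
  [∀ x, Module ℝ (V₁ x)] [∀ x, TopologicalSpace (V₁ x)] [FiberBundle F₁ V₁] [VectorBundle ℝ F₁ V₁]
  {V₂ : M → Type*} [TopologicalSpace (TotalSpace F₂ V₂)] [∀ x, AddCommGroup (V₂ x)]
  [∀ x, Module ℝ (V₂ x)] [∀ x, TopologicalSpace (V₂ x)] [∀ x, IsTopologicalAddGroup (V₂ x)]
  [∀ x, ContinuousSMul ℝ (V₂ x)] [FiberBundle F₂ V₂] [VectorBundle ℝ F₂ V₂]

theorem contMDiffAt_clm_inverse_apply [CompleteSpace F₁] {n : ℕ∞ω} {A : ∀ x, V₁ x →L[ℝ] V₂ x}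
    {v : ∀ x, V₂ x} {x₀ : M}
    (hA : ContMDiffAt 𝓘(ℝ, F) (𝓘(ℝ, F).prod 𝓘(ℝ, F₁ →L[ℝ] F₂)) n
      (fun x => TotalSpace.mk' (F₁ →L[ℝ] F₂) (E := fun x => V₁ x →L[ℝ] V₂ x) x (A x)) x₀)
    (hv : ContMDiffAt 𝓘(ℝ, F) (𝓘(ℝ, F).prod 𝓘(ℝ, F₂)) n (fun x => TotalSpace.mk' F₂ x (v x)) x₀)
    (hinv : (A x₀).IsInvertible) :
    ContMDiffAt 𝓘(ℝ, F) (𝓘(ℝ, F).prod 𝓘(ℝ, F₁)) n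
      (fun x => TotalSpace.mk' F₁ x ((A x).inverse (v x))) x₀ := by
  refine ContMDiffAt.clm_apply_of_inCoordinates (b₁ := id) (b₂ := id)
    (ϕ := fun x => (A x).inverse) ?_ hv contMDiffAt_id
  have inverse_coordinates : ContMDiffAt 𝓘(ℝ, F) 𝓘(ℝ, F₂ →L[ℝ] F₁) n
      (ContinuousLinearMap.inverse ∘ fun x =>
        ContinuousLinearMap.inCoordinates F₁ V₁ F₂ V₂ x₀ x x₀ x (A x)) x₀ := by
    refine ContMDiffAt.comp x₀ (ContDiffAt.contMDiffAt ?_) ((contMDiffAt_hom_bundle _).mp hA).2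
    apply ContinuousLinearMap.IsInvertible.contDiffAt_map_inverse
    rw [ContinuousLinearMap.inCoordinates_eq (FiberBundle.mem_baseSet_trivializationAt' x₀)
      (FiberBundle.mem_baseSet_trivializationAt' x₀)]
    exact ContinuousLinearMap.isInvertible_equiv.comp
      (hinv.comp ContinuousLinearMap.isInvertible_equiv)
  refine inverse_coordinates.congr_of_eventuallyEq ?_
  filter_upwards [(trivializationAt F₁ V₁ x₀).open_baseSet.mem_nhds
      (FiberBundle.mem_baseSet_trivializationAt' x₀),
    (trivializationAt F₂ V₂ x₀).open_baseSet.mem_nhds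
      (FiberBundle.mem_baseSet_trivializationAt' x₀)] with x hx hx'
  simp only [Function.comp_apply, id]
  rw [ContinuousLinearMap.inCoordinates_eq hx hx', ContinuousLinearMap.inCoordinates_eq hx' hx]
  simp only [ContinuousLinearMap.inverse_equiv_comp, ContinuousLinearMap.inverse_comp_equiv,
    ContinuousLinearEquiv.symm_symm]
  rfl

end ClmInverse

section ChartField

variable {E : Type*} [NormedAddCommGroup E] [NormedSpace ℝ E] {M : Type*} [TopologicalSpace M]
  [ChartedSpace E M]

/-- The representative of the vector field `Z` in the preferred chart at `x`. -/
noncomputable def chartField (x : M) (Z : ∀ y : M, TangentSpace 𝓘(ℝ, E) y) : E → E :=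
  VectorField.mpullbackWithin 𝓘(ℝ, E) 𝓘(ℝ, E) (extChartAt 𝓘(ℝ, E) x).symm Z (Set.range 𝓘(ℝ, E))

variable {x : M} {Z : ∀ y : M, TangentSpace 𝓘(ℝ, E) y}

theorem mfderivWithin_extChartAt_symm_eq_tmap (x : M) (y : E) :
    (mfderivWithin 𝓘(ℝ, E) 𝓘(ℝ, E) (extChartAt 𝓘(ℝ, E) x).symm (Set.range 𝓘(ℝ, E)) y : E →L[ℝ] E) =
      tmap E E (extChartAt 𝓘(ℝ, E) x).symm y := by
  rw [modelWithCornersSelf_coe, Set.range_id, mfderivWithin_univ]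
  rfl

theorem mlieBracket_eq_lieBracket_chartField [IsManifold 𝓘(ℝ, E) 1 M]
    (X Y : ∀ y : M, TangentSpace 𝓘(ℝ, E) y) (x : M) :
    VectorField.mlieBracket 𝓘(ℝ, E) X Y x =
      VectorField.lieBracket ℝ (chartField x X) (chartField x Y) (extChartAt 𝓘(ℝ, E) x x) := by
  have mfderiv_chart : (mfderiv 𝓘(ℝ, E) 𝓘(ℝ, E) (extChartAt 𝓘(ℝ, E) x) x : E →L[ℝ] E) =
      ContinuousLinearMap.id ℝ E := mfderiv_extChartAt_self
  rw [VectorField.mlieBracket, VectorField.mlieBracketWithin_apply]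
  refine (congrArg (fun L : E →L[ℝ] E => L.inverse _) mfderiv_chart).trans ?_
  rw [ContinuousLinearMap.inverse_id, ContinuousLinearMap.id_apply, Set.preimage_univ,
    Set.univ_inter, ← VectorField.lieBracketWithin_univ]
  simp only [chartField, modelWithCornersSelf_coe, Set.range_id]

variable [IsManifold 𝓘(ℝ, E) ∞ M]

theorem contMDiffAt_extChartAt_symm {y : E} (hy : y ∈ (extChartAt 𝓘(ℝ, E) x).target) :
    ContMDiffAt 𝓘(ℝ, E) 𝓘(ℝ, E) ∞ (extChartAt 𝓘(ℝ, E) x).symm y :=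
  (contMDiffOn_extChartAt_symm x).contMDiffAt ((isOpen_extChartAt_target x).mem_nhds hy)

theorem tmap_extChartAt_symm_chartField {y : E} (hy : y ∈ (extChartAt 𝓘(ℝ, E) x).target)
    (Z : ∀ y : M, TangentSpace 𝓘(ℝ, E) y) :
    tmap E E (extChartAt 𝓘(ℝ, E) x).symm y (chartField x Z y) =
      Z ((extChartAt 𝓘(ℝ, E) x).symm y) := by
  have : IsManifold 𝓘(ℝ, E) 1 M := .of_le (n := ∞) (by simp)
  rw [← mfderivWithin_extChartAt_symm_eq_tmap]
  exact (isInvertible_mfderivWithin_extChartAt_symm (I := 𝓘(ℝ, E)) hy).self_apply_inverse _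

theorem chartField_self (x : M) (Z : ∀ y : M, TangentSpace 𝓘(ℝ, E) y) :
    chartField x Z (extChartAt 𝓘(ℝ, E) x x) = Z x := by
  have : IsManifold 𝓘(ℝ, E) 1 M := .of_le (n := ∞) (by simp)
  have tmap_symm : tmap E E (extChartAt 𝓘(ℝ, E) x).symm (extChartAt 𝓘(ℝ, E) x x) =
      ContinuousLinearMap.id ℝ E := by
    rw [← mfderivWithin_extChartAt_symm_eq_tmap]
    exact mfderivWithin_range_extChartAt_symm
  have h := tmap_extChartAt_symm_chartField (mem_extChartAt_target x) Z
  rw [tmap_symm, ContinuousLinearMap.id_apply] at h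
  rw [h, extChartAt_to_inv]

theorem differentiableAt_chartField [CompleteSpace E] (hZ : IsSmoothField Z) (x : M) :
    DifferentiableAt ℝ (chartField x Z) (extChartAt 𝓘(ℝ, E) x x) := by
  have : IsManifold 𝓘(ℝ, E) 2 M := .of_le (n := ∞) ENat.LEInfty.out
  have mdifferentiable_field : MDifferentiableWithinAt 𝓘(ℝ, E) 𝓘(ℝ, E).tangent
      (fun x => (⟨x, Z x⟩ : TangentBundle 𝓘(ℝ, E) M)) Set.univ x :=
    ((hZ x).mdifferentiableAt (by simp)).mdifferentiableWithinAt
  have h : DifferentiableWithinAt ℝ (chartField x Z) _ (extChartAt 𝓘(ℝ, E) x x) :=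
    mdifferentiable_field.differentiableWithinAt_mpullbackWithin_vectorField
  rwa [modelWithCornersSelf_coe, Set.range_id, Set.preimage_univ, Set.univ_inter,
    differentiableWithinAt_univ] at h

theorem fderiv_comp_extChartAt_symm_chartField {g : M → ℝ}
    (hg : MDifferentiable 𝓘(ℝ, E) 𝓘(ℝ, ℝ) g) {y : E} (hy : y ∈ (extChartAt 𝓘(ℝ, E) x).target)
    (Z : ∀ y : M, TangentSpace 𝓘(ℝ, E) y) :
    fderiv ℝ (fun y => g ((extChartAt 𝓘(ℝ, E) x).symm y)) y (chartField x Z y) =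
      differential g ((extChartAt 𝓘(ℝ, E) x).symm y) (Z ((extChartAt 𝓘(ℝ, E) x).symm y)) := by
  have h := tmap_comp (hg _) ((contMDiffAt_extChartAt_symm hy).mdifferentiableAt (by simp)) rfl
  rw [tmap, mfderiv_eq_fderiv] at h
  rw [h, ContinuousLinearMap.comp_apply, tmap_extChartAt_symm_chartField hy]
  rfl

theorem fderiv_comp_extChartAt_symm_chartField_self {g : M → ℝ}
    (hg : MDifferentiable 𝓘(ℝ, E) 𝓘(ℝ, ℝ) g) (x : M) (Z : ∀ y : M, TangentSpace 𝓘(ℝ, E) y) :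
    fderiv ℝ (fun y => g ((extChartAt 𝓘(ℝ, E) x).symm y)) (extChartAt 𝓘(ℝ, E) x x)
      (chartField x Z (extChartAt 𝓘(ℝ, E) x x)) = differential g x (Z x) := by
  rw [fderiv_comp_extChartAt_symm_chartField hg (mem_extChartAt_target x) Z, extChartAt_to_inv]

theorem differential_mlieBracket [CompleteSpace E] {f : M → ℝ}
    (hf : ContMDiff 𝓘(ℝ, E) 𝓘(ℝ, ℝ) ∞ f) {X Y : ∀ x : M, TangentSpace 𝓘(ℝ, E) x}
    (hX : IsSmoothField X) (hY : IsSmoothField Y) (x : M) :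
    differential f x (VectorField.mlieBracket 𝓘(ℝ, E) X Y x) =
      differential (fun y => differential f y (Y y)) x (X x) -
        differential (fun y => differential f y (X y)) x (Y x) := by
  have : IsManifold 𝓘(ℝ, E) 1 M := .of_le (n := ∞) (by simp)
  have hf' : MDifferentiable 𝓘(ℝ, E) 𝓘(ℝ, ℝ) f := hf.mdifferentiable (by simp)
  have f_chart : ContDiffAt ℝ 2 (fun y => f ((extChartAt 𝓘(ℝ, E) x).symm y))
      (extChartAt 𝓘(ℝ, E) x x) :=
    (contMDiffAt_iff_contDiffAt.mp ((hf _).comp _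
      (contMDiffAt_extChartAt_symm (mem_extChartAt_target x)))).of_le ENat.LEInfty.out
  have derivative_chart : ∀ {Z : ∀ x : M, TangentSpace 𝓘(ℝ, E) x}, IsSmoothField Z →
      ∀ W : ∀ x : M, TangentSpace 𝓘(ℝ, E) x,
      fderiv ℝ (fun y => fderiv ℝ (fun y => f ((extChartAt 𝓘(ℝ, E) x).symm y)) y
        (chartField x Z y)) (extChartAt 𝓘(ℝ, E) x x) (chartField x W (extChartAt 𝓘(ℝ, E) x x)) =
      differential (fun y => differential f y (Z y)) x (W x) := fun {Z} hZ W => by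
    rw [← fderiv_comp_extChartAt_symm_chartField_self
      ((contMDiff_differential_apply hf hZ).mdifferentiable (by simp)) x W]
    refine congrArg (fun L : E →L[ℝ] ℝ => L _) (Filter.EventuallyEq.fderiv_eq ?_)
    filter_upwards [extChartAt_target_mem_nhds x] with y hy
      using fderiv_comp_extChartAt_symm_chartField hf' hy Z
  have h := VectorField.fderiv_apply_lieBracket f_chart (by simp)
    (differentiableAt_chartField hY x) (differentiableAt_chartField hX x)
  rw [derivative_chart hX, derivative_chart hY, ← mlieBracket_eq_lieBracket_chartField,
    ← chartField_self x (VectorField.mlieBracket 𝓘(ℝ, E) X Y)] at h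
  rw [← h, fderiv_comp_extChartAt_symm_chartField_self hf']

end ChartField

namespace SymplecticForm

variable {E : Type*} [NormedAddCommGroup E] [NormedSpace ℝ E] {M : Type*} [TopologicalSpace M]
  [ChartedSpace E M] [IsManifold 𝓘(ℝ, E) ∞ M] (Ω : SymplecticForm E M)

theorem injective_form (x : M) : Function.Injective (fun v => Ω.form x v) := by
  refine (injective_iff_map_eq_zero (Ω.form x)).mpr fun v hv => Ω.nondegenerate x v fun u => ?_
  rw [hv]
  rfl

theorem poisson_swap (f g : M → ℝ) : Ω.poisson f g = -Ω.poisson g f :=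
  funext fun x => Ω.skew x _ _

variable [FiniteDimensional ℝ E]

theorem isInvertible_form (x : M) : (Ω.form x).IsInvertible := by
  let A : E →L[ℝ] E →L[ℝ] ℝ := Ω.form x
  have hd : Module.finrank ℝ E = Module.finrank ℝ (E →L[ℝ] ℝ) :=
    Subspace.dual_finrank_eq.symm.trans
      (LinearMap.toContinuousLinearMap (𝕜 := ℝ) (E := E) (F' := ℝ)).finrank_eq
  exact ⟨(LinearEquiv.ofInjectiveOfFinrankEq A.toLinearMap (Ω.injective_form x)
    hd).toContinuousLinearEquiv, rfl⟩

theorem form_hamiltonianField (f : M → ℝ) (x : M) :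
    Ω.form x (Ω.hamiltonianField f x) = differential f x := by
  obtain ⟨e, he⟩ := Ω.isInvertible_form x
  refine Function.invFun_eq (f := fun v => Ω.form x v) ⟨e.symm (differential f x), ?_⟩
  rw [← he]
  exact e.apply_symm_apply _

theorem hamiltonianField_eq_of_form {f : M → ℝ} {x : M} {v : TangentSpace 𝓘(ℝ, E) x}
    (h : Ω.form x v = differential f x) : Ω.hamiltonianField f x = v :=
  Ω.injective_form x ((Ω.form_hamiltonianField f x).trans h.symm)

theorem hamiltonianField_eq_inverse (f : M → ℝ) (x : M) :
    Ω.hamiltonianField f x = (Ω.form x).inverse (differential f x) := by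
  obtain ⟨e, he⟩ := Ω.isInvertible_form x
  refine Ω.hamiltonianField_eq_of_form ?_
  rw [← he, ContinuousLinearMap.inverse_equiv]
  exact e.apply_symm_apply _

theorem isSmoothField_hamiltonianField {f : M → ℝ} (hf : ContMDiff 𝓘(ℝ, E) 𝓘(ℝ, ℝ) ∞ f) :
    IsSmoothField (Ω.hamiltonianField f) := by
  have := FiniteDimensional.complete ℝ E
  intro x₀
  simp only [hamiltonianField_eq_inverse]
  exact contMDiffAt_clm_inverse_apply (Ω.contMDiff_form x₀) (contMDiff_differential hf x₀)
    (Ω.isInvertible_form x₀)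

theorem poisson_eq (f g : M → ℝ) (x : M) :
    Ω.poisson f g x = differential f x (Ω.hamiltonianField g x) := by
  rw [poisson, form_hamiltonianField]

theorem poisson_neg_left (f g : M → ℝ) : Ω.poisson (-f) g = -Ω.poisson f g := by
  funext x
  rw [Pi.neg_apply, poisson_eq, poisson_eq, differential_neg]
  rfl

theorem poisson_neg_right (f g : M → ℝ) : Ω.poisson f (-g) = -Ω.poisson f g := by
  rw [poisson_swap, poisson_neg_left, Ω.poisson_swap f]

theorem poisson_add_left {f₁ f₂ : M → ℝ} (h₁ : ContMDiff 𝓘(ℝ, E) 𝓘(ℝ, ℝ) ∞ f₁)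
    (h₂ : ContMDiff 𝓘(ℝ, E) 𝓘(ℝ, ℝ) ∞ f₂) (g : M → ℝ) :
    Ω.poisson (f₁ + f₂) g = Ω.poisson f₁ g + Ω.poisson f₂ g := by
  funext x
  rw [Pi.add_apply, poisson_eq, poisson_eq, poisson_eq,
    differential_add (h₁.mdifferentiable (by simp) x) (h₂.mdifferentiable (by simp) x)]
  rfl

theorem poisson_add_right (f : M → ℝ) {g₁ g₂ : M → ℝ} (h₁ : ContMDiff 𝓘(ℝ, E) 𝓘(ℝ, ℝ) ∞ g₁)
    (h₂ : ContMDiff 𝓘(ℝ, E) 𝓘(ℝ, ℝ) ∞ g₂) :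
    Ω.poisson f (g₁ + g₂) = Ω.poisson f g₁ + Ω.poisson f g₂ := by
  rw [poisson_swap, Ω.poisson_add_left h₁ h₂, Ω.poisson_swap f, Ω.poisson_swap f, neg_add]

theorem poisson_smul_left {f : M → ℝ} (hf : ContMDiff 𝓘(ℝ, E) 𝓘(ℝ, ℝ) ∞ f) (r : ℝ) (g : M → ℝ) :
    Ω.poisson (r • f) g = r • Ω.poisson f g := by
  funext x
  rw [Pi.smul_apply, poisson_eq, poisson_eq,
    differential_const_smul (hf.mdifferentiable (by simp) x)]
  rfl

theorem poisson_smul_right (f : M → ℝ) {g : M → ℝ} (hg : ContMDiff 𝓘(ℝ, E) 𝓘(ℝ, ℝ) ∞ g) (r : ℝ) :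
    Ω.poisson f (r • g) = r • Ω.poisson f g := by
  rw [poisson_swap, Ω.poisson_smul_left hg, Ω.poisson_swap f, smul_neg]

theorem poisson_mul_left {f₁ f₂ : M → ℝ} (h₁ : ContMDiff 𝓘(ℝ, E) 𝓘(ℝ, ℝ) ∞ f₁)
    (h₂ : ContMDiff 𝓘(ℝ, E) 𝓘(ℝ, ℝ) ∞ f₂) (g : M → ℝ) :
    Ω.poisson (f₁ * f₂) g = f₁ * Ω.poisson f₂ g + f₂ * Ω.poisson f₁ g := by
  funext x
  rw [poisson_eq, differential_mul (h₁.mdifferentiable (by simp) x)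
    (h₂.mdifferentiable (by simp) x), ← poisson_eq, ← poisson_eq]
  rfl

theorem contMDiff_poisson {f g : M → ℝ} (hf : ContMDiff 𝓘(ℝ, E) 𝓘(ℝ, ℝ) ∞ f)
    (hg : ContMDiff 𝓘(ℝ, E) 𝓘(ℝ, ℝ) ∞ g) : ContMDiff 𝓘(ℝ, E) 𝓘(ℝ, ℝ) ∞ (Ω.poisson f g) := by
  simpa only [← poisson_eq] using
    contMDiff_differential_apply hf (Ω.isSmoothField_hamiltonianField hg)

theorem form_mlieBracket_hamiltonianField {f g k : M → ℝ} (hf : ContMDiff 𝓘(ℝ, E) 𝓘(ℝ, ℝ) ∞ f)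
    (hg : ContMDiff 𝓘(ℝ, E) 𝓘(ℝ, ℝ) ∞ g) (hk : ContMDiff 𝓘(ℝ, E) 𝓘(ℝ, ℝ) ∞ k) (x : M) :
    Ω.form x (VectorField.mlieBracket 𝓘(ℝ, E) (Ω.hamiltonianField f) (Ω.hamiltonianField g) x)
      (Ω.hamiltonianField k x) =
    Ω.poisson (Ω.poisson k f) g x - Ω.poisson (Ω.poisson k g) f x := by
  have := FiniteDimensional.complete ℝ E
  rw [Ω.skew, form_hamiltonianField, differential_mlieBracket hk
    (Ω.isSmoothField_hamiltonianField hf) (Ω.isSmoothField_hamiltonianField hg)]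
  simp only [← poisson_eq, neg_sub]

theorem poisson_jacobi {f g k : M → ℝ} (hf : ContMDiff 𝓘(ℝ, E) 𝓘(ℝ, ℝ) ∞ f)
    (hg : ContMDiff 𝓘(ℝ, E) 𝓘(ℝ, ℝ) ∞ g) (hk : ContMDiff 𝓘(ℝ, E) 𝓘(ℝ, ℝ) ∞ k) (x : M) :
    Ω.poisson f (Ω.poisson g k) x + Ω.poisson g (Ω.poisson k f) x +
      Ω.poisson k (Ω.poisson f g) x = 0 := by
  have closed := Ω.closed _ _ _ (Ω.isSmoothField_hamiltonianField hf)
    (Ω.isSmoothField_hamiltonianField hg) (Ω.isSmoothField_hamiltonianField hk) x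
  rw [Ω.form_mlieBracket_hamiltonianField hf hg hk, Ω.form_mlieBracket_hamiltonianField hf hk hg,
    Ω.form_mlieBracket_hamiltonianField hg hk hf, ← poisson_eq, ← poisson_eq,
    ← poisson_eq] at closed
  change Ω.poisson (Ω.poisson g k) f x - Ω.poisson (Ω.poisson f k) g x +
    Ω.poisson (Ω.poisson f g) k x - _ + _ - _ = 0 at closed
  rw [Ω.poisson_swap f k, Ω.poisson_swap k g, Ω.poisson_swap g f] at closed
  simp only [poisson_neg_left, Pi.neg_apply] at closed
  rw [Ω.poisson_swap f (Ω.poisson g k), Ω.poisson_swap g (Ω.poisson k f),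
    Ω.poisson_swap k (Ω.poisson f g)]
  simp only [Pi.neg_apply]
  linarith

end SymplecticForm

section LineBundle

variable {B : Type*} {V : B → Type*} [∀ b, AddCommGroup (V b)] [∀ b, Module ℝ (V b)]

/-- Scalar multiplication in the fibres, as a map of the total space: this allows one to
state equivariance of maps into the total space although the fibres over equal points are different
types. -/
def fiberSMul (t : ℝ) (v : TotalSpace ℝ V) : TotalSpace ℝ V := ⟨v.1, t • v.2⟩

theorem fiberSMul_fiberSMul (s t : ℝ) (v : TotalSpace ℝ V) :
    fiberSMul s (fiberSMul t v) = fiberSMul (s * t) v :=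
  congrArg (TotalSpace.mk v.1) (smul_smul s t v.2)

theorem one_fiberSMul (v : TotalSpace ℝ V) : fiberSMul 1 v = v :=
  congrArg (TotalSpace.mk v.1) (one_smul ℝ v.2)

theorem apply_fiberSMul (h : ∀ b, V b →ₗ[ℝ] ℝ) (t : ℝ) (v : TotalSpace ℝ V) :
    h (fiberSMul t v).1 (fiberSMul t v).2 = t * h v.1 v.2 :=
  map_smul (h v.1) t v.2

variable [TopologicalSpace B] [∀ b, TopologicalSpace (V b)] [TopologicalSpace (TotalSpace ℝ V)]
  [FiberBundle ℝ V]

theorem trivialization_fiberSMul (e : Bundle.Trivialization ℝ (π ℝ V)) [e.IsLinear ℝ] (t : ℝ)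
    {v : TotalSpace ℝ V} (hv : v.1 ∈ e.baseSet) : (e (fiberSMul t v)).2 = t * (e v).2 :=
  (e.continuousLinearEquivAt ℝ v.1 hv).map_smul t v.2

theorem trivialization_snd_eq_zero_iff (e : Bundle.Trivialization ℝ (π ℝ V)) [e.IsLinear ℝ]
    {v : TotalSpace ℝ V} (hv : v.1 ∈ e.baseSet) : (e v).2 = 0 ↔ v.2 = 0 :=
  map_eq_zero_iff (e.continuousLinearEquivAt ℝ v.1 hv) (ContinuousLinearEquiv.injective _)

variable [VectorBundle ℝ ℝ V]

variable (V) in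
theorem finrank_fiber_eq_one (b : B) : Module.finrank ℝ (V b) = 1 :=
  ((trivializationAt ℝ V b).continuousLinearEquivAt ℝ b
    (FiberBundle.mem_baseSet_trivializationAt' b)).toLinearEquiv.finrank_eq.trans
    (Module.finrank_self ℝ)

theorem contMDiffAt_fiberSMul {EB : Type*} [NormedAddCommGroup EB] [NormedSpace ℝ EB]
    [ChartedSpace EB B] {EN HN N : Type*} [NormedAddCommGroup EN]
    [NormedSpace ℝ EN] [TopologicalSpace HN] {I : ModelWithCorners ℝ EN HN} [TopologicalSpace N]
    [ChartedSpace HN N] {n : ℕ∞ω} {c : N → ℝ} {f : N → TotalSpace ℝ V} {x : N}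
    (hc : ContMDiffAt I 𝓘(ℝ, ℝ) n c x) (hf : ContMDiffAt I (𝓘(ℝ, EB).prod 𝓘(ℝ, ℝ)) n f x) :
    ContMDiffAt I (𝓘(ℝ, EB).prod 𝓘(ℝ, ℝ)) n (fun y => fiberSMul (c y) (f y)) x := by
  obtain ⟨hproj, hcoord⟩ := contMDiffAt_totalSpace.mp hf
  refine contMDiffAt_totalSpace.mpr ⟨hproj, (hc.mul hcoord).congr_of_eventuallyEq ?_⟩
  filter_upwards [hproj.continuousAt.preimage_mem_nhds
    ((trivializationAt ℝ V (f x).1).open_baseSet.mem_nhds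
      (FiberBundle.mem_baseSet_trivializationAt' _))] with y hy
  exact trivialization_fiberSMul _ _ hy

end LineBundle

section EquivariantFrame

variable {EB E B M : Type*} [NormedAddCommGroup EB] [NormedSpace ℝ EB] [TopologicalSpace B]
  [ChartedSpace EB B] [NormedAddCommGroup E] [NormedSpace ℝ E] [TopologicalSpace M]
  [ChartedSpace E M] {K : Type*} [SMul K M]

/-- The smooth functions on `M` which are homogeneous of weight `χ` for the action of `K`. -/
def homogeneousFunctions (E : Type*) {M : Type*} [NormedAddCommGroup E] [NormedSpace ℝ E]
    [TopologicalSpace M] [ChartedSpace E M] {K : Type*} [SMul K M] (χ : K → ℝ) :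
    Submodule ℝ (M → ℝ) where
  carrier := {F | ContMDiff 𝓘(ℝ, E) 𝓘(ℝ, ℝ) ∞ F ∧ ∀ (k : K) (x : M), F (k • x) = χ k * F x}
  add_mem' ha hb := ⟨ha.1.add hb.1, fun k x => by
    simp only [Pi.add_apply, ha.2, hb.2, mul_add]⟩
  zero_mem' := ⟨contMDiff_const, fun _ _ => (mul_zero _).symm⟩
  smul_mem' r F ha := ⟨contMDiff_const.mul ha.1, fun k x => by
    simp only [Pi.smul_apply, ha.2, smul_eq_mul, mul_left_comm]⟩

/-- A smooth map `x ↦ (proj x, vec x)` from a space `M` on which `K` acts to the nonzero vectors of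
a line bundle `V → B`, such that `proj` has smooth local sections and its fibres are the orbits
of `K`, and `k` acts on the vectors as multiplication by the weight `χ k`. It identifies the
sections of `V^*` with the functions on `M` which are homogeneous of weight `χ`. -/
structure EquivariantFrame (E EB : Type*) {B M K : Type*} [NormedAddCommGroup EB] [NormedSpace ℝ EB]
    [TopologicalSpace B] [ChartedSpace EB B] [NormedAddCommGroup E] [NormedSpace ℝ E]
    [TopologicalSpace M] [ChartedSpace E M] [SMul K M] (V : B → Type*) [∀ b, AddCommGroup (V b)]
    [∀ b, Module ℝ (V b)] [∀ b, TopologicalSpace (V b)] [TopologicalSpace (TotalSpace ℝ V)]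
    [FiberBundle ℝ V] (χ : K → ℝ) where
  proj : M → B
  vec : ∀ x : M, V (proj x)
  contMDiff_mk : ContMDiff 𝓘(ℝ, E) (𝓘(ℝ, EB).prod 𝓘(ℝ, ℝ)) ∞
    (fun x => (⟨proj x, vec x⟩ : TotalSpace ℝ V))
  vec_ne_zero : ∀ x, vec x ≠ 0
  exists_section : ∀ b, ∃ U : Set B, IsOpen U ∧ b ∈ U ∧ ∃ σ : B → M, (∀ c, proj (σ c) = c) ∧
    ContMDiffOn 𝓘(ℝ, EB) 𝓘(ℝ, E) ∞ σ U
  mk_smul : ∀ (k : K) (x : M),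
    (⟨proj (k • x), vec (k • x)⟩ : TotalSpace ℝ V) = fiberSMul (χ k) ⟨proj x, vec x⟩
  exists_smul_eq : ∀ x y, proj x = proj y → ∃ k : K, k • y = x

namespace EquivariantFrame

variable {V : B → Type*} [∀ b, AddCommGroup (V b)] [∀ b, Module ℝ (V b)]
  [∀ b, TopologicalSpace (V b)] [TopologicalSpace (TotalSpace ℝ V)] [FiberBundle ℝ V]
  {χ : K → ℝ} (ε : EquivariantFrame E EB (M := M) V χ)

/-- The frame as a map to the total space. -/
def toTotalSpace (x : M) : TotalSpace ℝ V := ⟨ε.proj x, ε.vec x⟩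

theorem contMDiff_toTotalSpace :
    ContMDiff 𝓘(ℝ, E) (𝓘(ℝ, EB).prod 𝓘(ℝ, ℝ)) ∞ ε.toTotalSpace :=
  ε.contMDiff_mk

theorem contMDiff_proj : ContMDiff 𝓘(ℝ, E) 𝓘(ℝ, EB) ∞ ε.proj :=
  (Bundle.contMDiff_proj V).comp ε.contMDiff_mk

theorem toTotalSpace_smul (k : K) (x : M) :
    ε.toTotalSpace (k • x) = fiberSMul (χ k) (ε.toTotalSpace x) :=
  ε.mk_smul k x

theorem proj_smul (k : K) (x : M) : ε.proj (k • x) = ε.proj x :=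
  congrArg TotalSpace.proj (ε.mk_smul k x)

theorem proj_surjective : Function.Surjective ε.proj := fun b =>
  let ⟨_, _, _, σ, hσ, _⟩ := ε.exists_section b
  ⟨σ b, hσ b⟩

section Descent

variable {EN HN N : Type*} [NormedAddCommGroup EN] [NormedSpace ℝ EN] [TopologicalSpace HN]
  {I : ModelWithCorners ℝ EN HN} [TopologicalSpace N] [ChartedSpace HN N]

theorem contMDiff_of_comp_proj {f : B → N} (hf : ContMDiff 𝓘(ℝ, E) I ∞ (f ∘ ε.proj)) :
    ContMDiff 𝓘(ℝ, EB) I ∞ f := by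
  intro b
  obtain ⟨U, hU, hbU, σ, hσ, hσU⟩ := ε.exists_section b
  refine (hf.contMDiffAt.comp b (hσU.contMDiffAt (hU.mem_nhds hbU))).congr_of_eventuallyEq
    (.of_forall fun c => ?_)
  simp only [Function.comp_apply, hσ]

variable [VectorBundle ℝ ℝ V]

/-- The linear isomorphism `t ↦ t • vec x` from `ℝ` to the fibre over `b = proj x`. -/
noncomputable def fiberEquiv {x : M} {b : B} (hx : ε.proj x = b) : ℝ ≃ₗ[ℝ] V b :=
  (LinearEquiv.ofBijective (LinearMap.toSpanSingleton ℝ _ (ε.vec x))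
    ⟨smul_left_injective ℝ (ε.vec_ne_zero x), exists_smul_eq_of_finrank_eq_one
      (finrank_fiber_eq_one V _) (ε.vec_ne_zero x)⟩).trans (LinearEquiv.cast hx)

theorem mk_fiberEquiv {x : M} {b : B} (hx : ε.proj x = b) (t : ℝ) :
    ⟨b, ε.fiberEquiv hx t⟩ = fiberSMul t (ε.toTotalSpace x) := by
  subst hx
  rfl

theorem exists_fiberSMul_eq (v : TotalSpace ℝ V) :
    ∃ t x, fiberSMul t (ε.toTotalSpace x) = v := by
  obtain ⟨x, hx⟩ := ε.proj_surjective v.1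
  refine ⟨(ε.fiberEquiv hx).symm v.2, x, ?_⟩
  rw [← ε.mk_fiberEquiv hx, LinearEquiv.apply_symm_apply]

variable [ContMDiffVectorBundle ∞ ℝ V 𝓘(ℝ, EB)]

theorem exists_local_fiberSMul_eq (v₀ : TotalSpace ℝ V) :
    ∃ (c : TotalSpace ℝ V → ℝ) (τ : TotalSpace ℝ V → M),
      ContMDiffAt (𝓘(ℝ, EB).prod 𝓘(ℝ, ℝ)) 𝓘(ℝ, ℝ) ∞ c v₀ ∧
      ContMDiffAt (𝓘(ℝ, EB).prod 𝓘(ℝ, ℝ)) 𝓘(ℝ, E) ∞ τ v₀ ∧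
      ∀ᶠ v in nhds v₀, fiberSMul (c v) (ε.toTotalSpace (τ v)) = v := by
  obtain ⟨U, hU, hbU, σ, hσ, hσU⟩ := ε.exists_section v₀.1
  set e := trivializationAt ℝ V v₀.1
  have mem_base : v₀.1 ∈ e.baseSet := FiberBundle.mem_baseSet_trivializationAt' v₀.1
  have contMDiffAt_coord : ∀ {w : TotalSpace ℝ V}, w.1 = v₀.1 →
      ContMDiffAt (𝓘(ℝ, EB).prod 𝓘(ℝ, ℝ)) 𝓘(ℝ, ℝ) ∞ (fun v => (e v).2) w := fun {w} hw =>
    contMDiffAt_snd.comp w (e.contMDiffOn.contMDiffAt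
      (e.open_source.mem_nhds (e.mem_source.mpr (hw ▸ mem_base))))
  have hτ : ContMDiffAt (𝓘(ℝ, EB).prod 𝓘(ℝ, ℝ)) 𝓘(ℝ, E) ∞ (fun v => σ v.1) v₀ :=
    (hσU.contMDiffAt (hU.mem_nhds hbU)).comp v₀ (Bundle.contMDiff_proj V v₀)
  have mem_base_section : ∀ d ∈ e.baseSet, ε.proj (σ d) ∈ e.baseSet := fun d hd => by rwa [hσ]
  have frame_coord_ne_zero : ∀ d ∈ e.baseSet, (e (ε.toTotalSpace (σ d))).2 ≠ 0 := fun d hd h0 =>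
    ε.vec_ne_zero (σ d) ((trivialization_snd_eq_zero_iff e (mem_base_section d hd)).mp h0)
  refine ⟨fun v => (e v).2 / (e (ε.toTotalSpace (σ v.1))).2, fun v => σ v.1,
    (contMDiffAt_coord rfl).div₀ ((contMDiffAt_coord (hσ v₀.1)).comp v₀
      (ε.contMDiff_toTotalSpace.contMDiffAt.comp v₀ hτ)) (frame_coord_ne_zero _ mem_base), hτ, ?_⟩
  filter_upwards [(e.open_baseSet.preimage (FiberBundle.continuous_proj ℝ V)).mem_nhds mem_base]
    with v hv
  have mem_source : ∀ t : ℝ, fiberSMul t (ε.toTotalSpace (σ v.1)) ∈ e.source := fun _ =>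
    e.mem_source.mpr (mem_base_section v.1 hv)
  refine e.injOn (mem_source _) (e.mem_source.mpr hv) (Prod.ext ?_ ?_)
  · exact (e.coe_fst (mem_source _)).trans ((hσ v.1).trans (e.coe_fst (e.mem_source.mpr hv)).symm)
  · refine (trivialization_fiberSMul e _ (v := ε.toTotalSpace _) (mem_base_section v.1 hv)).trans ?_
    exact div_mul_cancel₀ _ (frame_coord_ne_zero _ hv)

theorem contMDiff_of_comp_fiberSMul {Q : TotalSpace ℝ V → N}
    (hQ : ContMDiff (𝓘(ℝ, ℝ).prod 𝓘(ℝ, E)) I ∞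
      (fun p : ℝ × M => Q (fiberSMul p.1 (ε.toTotalSpace p.2)))) :
    ContMDiff (𝓘(ℝ, EB).prod 𝓘(ℝ, ℝ)) I ∞ Q := by
  intro v₀
  obtain ⟨c, τ, hc, hτ, hv⟩ := ε.exists_local_fiberSMul_eq v₀
  refine (hQ.contMDiffAt.comp v₀ (hc.prodMk hτ)).congr_of_eventuallyEq ?_
  filter_upwards [hv] with v hv
  exact (congrArg Q hv).symm

end Descent

section Sections

/-- The homogeneous function `x ↦ h (vec x)` of a section `h` of the dual bundle. -/
def ham : dualSections EB V →ₗ[ℝ] homogeneousFunctions (M := M) E χ where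
  toFun h := ⟨fun x => h.1 (ε.proj x) (ε.vec x), h.2.comp ε.contMDiff_mk, fun k x =>
    (congrArg (fun w : TotalSpace ℝ V => h.1 w.1 w.2) (ε.mk_smul k x)).trans
      (apply_fiberSMul h.1 _ _)⟩
  map_add' _ _ := rfl
  map_smul' _ _ := rfl

variable [VectorBundle ℝ ℝ V]

theorem exists_apply_eq (b : B) (v : V b) :
    ∃ t x, ε.proj x = b ∧ ∀ h : dualSections EB V, h.1 b v = t * (ε.ham h).1 x := by
  obtain ⟨t, x, hv⟩ := ε.exists_fiberSMul_eq ⟨b, v⟩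
  exact ⟨t, x, congrArg TotalSpace.proj hv, fun h =>
    (congrArg (fun w : TotalSpace ℝ V => h.1 w.1 w.2) hv.symm).trans (apply_fiberSMul h.1 t _)⟩

theorem ham_injective : Function.Injective ε.ham := by
  intro h k e
  refine Subtype.ext (funext fun b => LinearMap.ext fun v => ?_)
  obtain ⟨t, x, -, apply_eq⟩ := ε.exists_apply_eq b v
  rw [apply_eq, apply_eq, e]

theorem exists_linearMap_vec (F : homogeneousFunctions (M := M) E χ) :
    ∃ h : ∀ b, V b →ₗ[ℝ] ℝ, ∀ x, h (ε.proj x) (ε.vec x) = F.1 x := by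
  have exists_form : ∀ b, ∃ l : V b →ₗ[ℝ] ℝ, ∀ x w, ε.toTotalSpace x = ⟨b, w⟩ → l w = F.1 x := by
    intro b
    obtain ⟨x, rfl⟩ := ε.proj_surjective b
    refine ⟨F.1 x • (ε.fiberEquiv (x := x) (b := ε.proj x) rfl).symm.toLinearMap, fun y w hy => ?_⟩
    obtain ⟨k, rfl⟩ := ε.exists_smul_eq y x (congrArg TotalSpace.proj hy)
    rw [toTotalSpace_smul, ← ε.mk_fiberEquiv rfl] at hy
    obtain rfl := TotalSpace.mk_inj.mp hy
    rw [F.2.2, LinearMap.smul_apply, LinearEquiv.coe_coe, LinearEquiv.symm_apply_apply,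
      smul_eq_mul, mul_comm]
  choose h hh using exists_form
  exact ⟨h, fun x => hh _ x _ rfl⟩

variable [ContMDiffVectorBundle ∞ ℝ V 𝓘(ℝ, EB)]

theorem ham_surjective : Function.Surjective ε.ham := by
  intro F
  obtain ⟨h, hF⟩ := ε.exists_linearMap_vec F
  refine ⟨⟨h, ε.contMDiff_of_comp_fiberSMul ?_⟩, Subtype.ext (funext hF)⟩
  refine (contMDiff_fst.mul (F.2.1.comp contMDiff_snd)).congr fun p => ?_
  rw [apply_fiberSMul]
  exact congrArg (p.1 * ·) (hF p.2)

/-- Sections of the dual bundle are the homogeneous functions. -/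
noncomputable def hamEquiv : dualSections EB V ≃ₗ[ℝ] homogeneousFunctions (M := M) E χ :=
  LinearEquiv.ofBijective ε.ham ⟨ε.ham_injective, ε.ham_surjective⟩

end Sections

/-- A point over `b`. -/
noncomputable def point (b : B) : M := (ε.proj_surjective b).choose

theorem proj_point (b : B) : ε.proj (ε.point b) = b := (ε.proj_surjective b).choose_spec

section Iso

variable {EB' B' : Type*} [NormedAddCommGroup EB'] [NormedSpace ℝ EB'] [TopologicalSpace B']
  [ChartedSpace EB' B'] {V' : B' → Type*} [∀ b, AddCommGroup (V' b)] [∀ b, Module ℝ (V' b)]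
  [∀ b, TopologicalSpace (V' b)] [TopologicalSpace (TotalSpace ℝ V')] [FiberBundle ℝ V']
  (ε' : EquivariantFrame E EB' (M := M) V' χ)

theorem exists_smul_point (x : M) : ∃ k : K, k • ε.point (ε.proj x) = x :=
  ε.exists_smul_eq _ _ (ε.proj_point _).symm

/-- The map `proj x ↦ proj' x` between the bases of two frames. -/
noncomputable def baseMap (b : B) : B' := ε'.proj (ε.point b)

theorem baseMap_proj (x : M) : ε.baseMap ε' (ε.proj x) = ε'.proj x := by
  obtain ⟨k, hk⟩ := ε.exists_smul_point x
  rw [baseMap, ← ε'.proj_smul k, hk]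

theorem contMDiff_baseMap : ContMDiff 𝓘(ℝ, EB) 𝓘(ℝ, EB') ∞ (ε.baseMap ε') :=
  ε.contMDiff_of_comp_proj (ε'.contMDiff_proj.congr (ε.baseMap_proj ε'))

theorem baseMap_baseMap (b : B) : ε'.baseMap ε (ε.baseMap ε' b) = b := by
  obtain ⟨x, rfl⟩ := ε.proj_surjective b
  rw [baseMap_proj, baseMap_proj]

variable [VectorBundle ℝ ℝ V'] [VectorBundle ℝ ℝ V]

/-- The linear isomorphism `vec x ↦ vec' x` of the fibres of two frames. -/
noncomputable def fiberMap (b : B) : V b ≃ₗ[ℝ] V' (ε.baseMap ε' b) :=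
  (ε.fiberEquiv (ε.proj_point b)).symm.trans (ε'.fiberEquiv rfl)

/-- The map `(proj x, t • vec x) ↦ (proj' x, t • vec' x)` between the total spaces of two frames. -/
noncomputable def totalMap (v : TotalSpace ℝ V) : TotalSpace ℝ V' :=
  ⟨ε.baseMap ε' v.1, ε.fiberMap ε' v.1 v.2⟩

theorem totalMap_fiberSMul_point (t : ℝ) (b : B) :
    ε.totalMap ε' (fiberSMul t (ε.toTotalSpace (ε.point b))) =
      fiberSMul t (ε'.toTotalSpace (ε.point b)) := by
  rw [← ε.mk_fiberEquiv (ε.proj_point b), totalMap, fiberMap, LinearEquiv.trans_apply,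
    LinearEquiv.symm_apply_apply]
  exact ε'.mk_fiberEquiv rfl t

theorem totalMap_fiberSMul (t : ℝ) (x : M) :
    ε.totalMap ε' (fiberSMul t (ε.toTotalSpace x)) = fiberSMul t (ε'.toTotalSpace x) := by
  obtain ⟨k, hk⟩ := ε.exists_smul_point x
  rw [← hk, toTotalSpace_smul, toTotalSpace_smul, fiberSMul_fiberSMul, fiberSMul_fiberSMul,
    totalMap_fiberSMul_point]

theorem totalMap_totalMap (v : TotalSpace ℝ V) : ε'.totalMap ε (ε.totalMap ε' v) = v := by
  obtain ⟨t, x, rfl⟩ := ε.exists_fiberSMul_eq v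
  rw [totalMap_fiberSMul, totalMap_fiberSMul]

variable [ContMDiffVectorBundle ∞ ℝ V 𝓘(ℝ, EB)]

theorem contMDiff_totalMap :
    ContMDiff (𝓘(ℝ, EB).prod 𝓘(ℝ, ℝ)) (𝓘(ℝ, EB').prod 𝓘(ℝ, ℝ)) ∞ (ε.totalMap ε') := by
  refine ε.contMDiff_of_comp_fiberSMul fun p => ?_
  simp only [totalMap_fiberSMul]
  exact contMDiffAt_fiberSMul contMDiffAt_fst
    (ε'.contMDiff_toTotalSpace.contMDiffAt.comp p contMDiffAt_snd)

variable [ContMDiffVectorBundle ∞ ℝ V' 𝓘(ℝ, EB')]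

/-- The isomorphism `vec x ↦ vec' x` between two line bundles with frames on the same space. -/
noncomputable def lineBundleIso : LineBundleIso EB EB' V V' where
  base :=
    { toFun := ε.baseMap ε'
      invFun := ε'.baseMap ε
      left_inv := ε.baseMap_baseMap ε'
      right_inv := ε'.baseMap_baseMap ε
      contMDiff_toFun := ε.contMDiff_baseMap ε'
      contMDiff_invFun := ε'.contMDiff_baseMap ε }
  total :=
    { toFun := ε.totalMap ε'
      invFun := ε'.totalMap ε
      left_inv := ε.totalMap_totalMap ε'
      right_inv := ε'.totalMap_totalMap ε
      contMDiff_toFun := ε.contMDiff_totalMap ε'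
      contMDiff_invFun := ε'.contMDiff_totalMap ε }
  fiber := ε.fiberMap ε'
  total_mk _ _ := rfl

theorem lineBundleIso_total_fiberSMul (t : ℝ) (x : M) :
    (ε.lineBundleIso ε').total (fiberSMul t (ε.toTotalSpace x)) =
      fiberSMul t (ε'.toTotalSpace x) :=
  ε.totalMap_fiberSMul ε' t x

theorem ham_pullback (h : dualSections EB' V') :
    ε.ham ((ε.lineBundleIso ε').pullback h) = ε'.ham h := by
  refine Subtype.ext (funext fun x => ?_)
  have total_toTotalSpace := ε.totalMap_fiberSMul ε' 1 x
  rw [one_fiberSMul, one_fiberSMul] at total_toTotalSpace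
  exact congrArg (fun w : TotalSpace ℝ V' => h.1 w.1 w.2) total_toTotalSpace

end Iso

end EquivariantFrame

end EquivariantFrame

section Conformal

variable {E M : Type*} [NormedAddCommGroup E] [NormedSpace ℝ E] [TopologicalSpace M]
  [ChartedSpace E M] [IsManifold 𝓘(ℝ, E) ∞ M] {K : Type*} [SMul K M] {χ : K → ℝ}

/-- The action of `K` is smooth, and `k` multiplies the symplectic form by `χ k ≠ 0`. -/
structure SymplecticForm.IsConformal (Ω : SymplecticForm E M) (χ : K → ℝ) : Prop where
  contMDiff_smul : ∀ k : K, ContMDiff 𝓘(ℝ, E) 𝓘(ℝ, E) ∞ (fun x : M => k • x)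
  ne_zero : ∀ k, χ k ≠ 0
  form_smul : ∀ (k : K) (x : M) (v w : E),
    Ω.form (k • x) (tmap E E (fun y : M => k • y) x v) (tmap E E (fun y : M => k • y) x w) =
      χ k * Ω.form x v w

namespace SymplecticForm.IsConformal

variable {Ω : SymplecticForm E M} [FiniteDimensional ℝ E] (hΩ : Ω.IsConformal χ)
include hΩ

theorem tmap_smul_surjective (k : K) (x : M) :
    Function.Surjective (tmap E E (fun y : M => k • y) x) := by
  refine LinearMap.surjective_of_injective (f := (tmap E E (fun y : M => k • y) x).toLinearMap) ?_
  refine (injective_iff_map_eq_zero _).mpr fun v hv => Ω.nondegenerate x v fun w => ?_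
  have form_smul := hΩ.form_smul k x v w
  rw [show tmap E E (fun y : M => k • y) x v = 0 from hv] at form_smul
  refine (mul_eq_zero.mp (form_smul.symm.trans ?_)).resolve_left (hΩ.ne_zero k)
  exact congrArg (fun L : E →L[ℝ] ℝ => L _) (map_zero (Ω.form (k • x)))

theorem hamiltonianField_smul {F : M → ℝ} (hF : F ∈ homogeneousFunctions E χ) (k : K) (x : M) :
    (Ω.hamiltonianField F (k • x) : E) =
      tmap E E (fun y : M => k • y) x (Ω.hamiltonianField F x) := by
  refine Ω.hamiltonianField_eq_of_form (ContinuousLinearMap.ext fun w' => ?_)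
  obtain ⟨w, rfl⟩ := hΩ.tmap_smul_surjective k x w'
  have differential_smul : χ k • tmap E ℝ F x =
      (tmap E ℝ F (k • x)).comp (tmap E E (fun y : M => k • y) x) := by
    rw [← tmap_comp (hF.1.mdifferentiable (by simp) _)
      ((hΩ.contMDiff_smul k).mdifferentiable (by simp) x) rfl, funext (hF.2 k)]
    exact (const_smul_mfderiv (hF.1.mdifferentiable (by simp) x) (χ k)).symm
  calc Ω.form (k • x) _ _ = χ k * Ω.form x (Ω.hamiltonianField F x) w := hΩ.form_smul k x _ w
    _ = χ k * differential F x w := by rw [form_hamiltonianField]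
    _ = differential F (k • x) (tmap E E (fun y : M => k • y) x w) :=
      congrArg (fun L : E →L[ℝ] ℝ => L w) differential_smul

theorem poisson_mem {F₁ F₂ : M → ℝ} (h₁ : F₁ ∈ homogeneousFunctions E χ)
    (h₂ : F₂ ∈ homogeneousFunctions E χ) : Ω.poisson F₁ F₂ ∈ homogeneousFunctions E χ := by
  refine ⟨Ω.contMDiff_poisson h₁.1 h₂.1, fun k x => ?_⟩
  have form_smul := hΩ.form_smul k x (Ω.hamiltonianField F₁ x) (Ω.hamiltonianField F₂ x)
  rwa [← hΩ.hamiltonianField_smul h₁, ← hΩ.hamiltonianField_smul h₂] at form_smul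

/-- The bracket `-{F₁, F₂} = {F₂, F₁}` of homogeneous functions. -/
noncomputable def bracket : homogeneousFunctions (M := M) E χ →ₗ[ℝ]
    homogeneousFunctions (M := M) E χ →ₗ[ℝ] homogeneousFunctions (M := M) E χ :=
  LinearMap.mk₂ ℝ (fun F₁ F₂ => ⟨Ω.poisson F₂.1 F₁.1, hΩ.poisson_mem F₂.2 F₁.2⟩)
    (fun F₁ F₁' F₂ => Subtype.ext (Ω.poisson_add_right F₂.1 F₁.2.1 F₁'.2.1))
    (fun r F₁ F₂ => Subtype.ext (Ω.poisson_smul_right F₂.1 F₁.2.1 r))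
    (fun F₁ F₂ F₂' => Subtype.ext (Ω.poisson_add_left F₂.2.1 F₂'.2.1 F₁.1))
    (fun r F₁ F₂ => Subtype.ext (Ω.poisson_smul_left F₂.2.1 r F₁.1))

theorem bracket_coe (F₁ F₂ : homogeneousFunctions (M := M) E χ) :
    (hΩ.bracket F₁ F₂).1 = -Ω.poisson F₁.1 F₂.1 :=
  Ω.poisson_swap F₂.1 F₁.1

theorem bracket_self (F : homogeneousFunctions (M := M) E χ) : hΩ.bracket F F = 0 :=
  Subtype.ext (self_eq_neg.mp (Ω.poisson_swap F.1 F.1))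

theorem bracket_jacobi (F₁ F₂ F₃ : homogeneousFunctions (M := M) E χ) :
    hΩ.bracket F₁ (hΩ.bracket F₂ F₃) + hΩ.bracket F₂ (hΩ.bracket F₃ F₁) +
      hΩ.bracket F₃ (hΩ.bracket F₁ F₂) = 0 := by
  refine Subtype.ext ?_
  simp only [Submodule.coe_add, bracket_coe, poisson_neg_right, neg_neg]
  exact funext (Ω.poisson_jacobi F₁.2.1 F₂.2.1 F₃.2.1)

end SymplecticForm.IsConformal

namespace EquivariantFrame

variable {EB B : Type*} [NormedAddCommGroup EB] [NormedSpace ℝ EB] [TopologicalSpace B]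
  [ChartedSpace EB B] {V : B → Type*} [∀ b, AddCommGroup (V b)] [∀ b, Module ℝ (V b)]
  [∀ b, TopologicalSpace (V b)] [TopologicalSpace (TotalSpace ℝ V)] [FiberBundle ℝ V]
  {Ω : SymplecticForm E M} (ε : EquivariantFrame E EB (M := M) V χ)

/-- The symbol of a section `h`: the projection of the Hamiltonian vector field of `-H_h`, where
the sign comes from the bracket `-{H₁, H₂}` of homogeneous functions. -/
noncomputable def symbol (Ω : SymplecticForm E M) (h : dualSections EB V) (b : B) :
    TangentSpace 𝓘(ℝ, EB) b :=
  tmap E EB ε.proj (ε.point b) (Ω.hamiltonianField (-(ε.ham h).1) (ε.point b))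

variable [FiniteDimensional ℝ E] (hΩ : Ω.IsConformal χ)
include hΩ

theorem symbol_proj (h : dualSections EB V) (x : M) : (ε.symbol Ω h (ε.proj x) : EB) =
    tmap E EB ε.proj x (Ω.hamiltonianField (-(ε.ham h).1) x) := by
  obtain ⟨k, hk⟩ := ε.exists_smul_eq _ _ (ε.proj_point (ε.proj x))
  have tmap_proj := tmap_comp (ε.contMDiff_proj.mdifferentiable (by simp) (k • x))
    ((hΩ.contMDiff_smul k).mdifferentiable (by simp) x) rfl
  simp only [proj_smul] at tmap_proj
  rw [symbol, ← hk, hΩ.hamiltonianField_smul (neg_mem (ε.ham h).2)]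
  exact (congrArg (fun L : E →L[ℝ] EB => L _) tmap_proj).symm

theorem differential_symbol {f : B → ℝ} (hf : ContMDiff 𝓘(ℝ, EB) 𝓘(ℝ, ℝ) ∞ f)
    (h : dualSections EB V) (x : M) :
    differential f (ε.proj x) (ε.symbol Ω h (ε.proj x)) =
      -Ω.poisson (f ∘ ε.proj) (ε.ham h).1 x := by
  have differential_comp := tmap_comp (hf.mdifferentiable (by simp) (ε.proj x))
    (ε.contMDiff_proj.mdifferentiable (by simp) x) rfl
  calc differential f (ε.proj x) (ε.symbol Ω h (ε.proj x))
      = differential f (ε.proj x) (tmap E EB ε.proj x (Ω.hamiltonianField (-(ε.ham h).1) x)) :=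
        congrArg (tmap EB ℝ f (ε.proj x)) (ε.symbol_proj hΩ h x)
    _ = differential (f ∘ ε.proj) x (Ω.hamiltonianField (-(ε.ham h).1) x) :=
        (congrArg (fun L : E →L[ℝ] ℝ => L _) differential_comp).symm
    _ = -Ω.poisson (f ∘ ε.proj) (ε.ham h).1 x := by
        rw [← Ω.poisson_eq, Ω.poisson_neg_right, Pi.neg_apply]

theorem isSmoothField_symbol [IsManifold 𝓘(ℝ, EB) ∞ B] (h : dualSections EB V) :
    IsSmoothField (ε.symbol Ω h) := by
  refine ε.contMDiff_of_comp_proj ?_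
  refine ((ε.contMDiff_proj.contMDiff_tangentMap (m := ∞) le_rfl).comp
    (Ω.isSmoothField_hamiltonianField (neg_mem (ε.ham h).2).1)).congr fun x => ?_
  exact congrArg (TotalSpace.mk (F := EB) (E := TangentSpace 𝓘(ℝ, EB)) (ε.proj x))
    (ε.symbol_proj hΩ h x)

variable [VectorBundle ℝ ℝ V] [ContMDiffVectorBundle ∞ ℝ V 𝓘(ℝ, EB)]

/-- The bracket of the sections of `V^*` with homogeneous function `-{H₁, H₂}`. -/
noncomputable def bracket : dualSections EB V →ₗ[ℝ] dualSections EB V →ₗ[ℝ] dualSections EB V :=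
  (hΩ.bracket.compl₁₂ ε.ham ε.ham).compr₂ ε.hamEquiv.symm.toLinearMap

theorem ham_bracket (h₁ h₂ : dualSections EB V) :
    ε.ham (ε.bracket hΩ h₁ h₂) = hΩ.bracket (ε.ham h₁) (ε.ham h₂) :=
  ε.hamEquiv.apply_symm_apply _

theorem bracket_mul {f : B → ℝ} (hf : ContMDiff 𝓘(ℝ, EB) 𝓘(ℝ, ℝ) ∞ f)
    {h₁ k : dualSections EB V} (h₂ : dualSections EB V) (hk : ∀ b v, k.1 b v = f b * h₁.1 b v)
    (b : B) (v : V b) : (ε.bracket hΩ k h₂).1 b v =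
      f b * (ε.bracket hΩ h₁ h₂).1 b v + differential f b (ε.symbol Ω h₂ b) * h₁.1 b v := by
  obtain ⟨t, x, rfl, apply_eq⟩ := ε.exists_apply_eq b v
  have ham_k : (ε.ham k).1 = (f ∘ ε.proj) * (ε.ham h₁).1 := funext fun y => hk _ _
  rw [apply_eq, apply_eq, apply_eq, ε.differential_symbol hΩ hf, ham_bracket, ham_bracket,
    hΩ.bracket_coe, hΩ.bracket_coe, ham_k,
    Ω.poisson_mul_left (hf.comp ε.contMDiff_proj) (ε.ham h₁).2.1]
  simp only [Pi.neg_apply, Pi.add_apply, Pi.mul_apply, Function.comp_apply]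
  ring

/-- The Kirillov structure given by the Poisson bracket of homogeneous functions. -/
noncomputable def kirillovStructure [IsManifold 𝓘(ℝ, EB) ∞ B] : KirillovStructure EB V where
  bracket := ε.bracket hΩ
  bracket_self h := ε.ham_injective (by rw [ham_bracket, hΩ.bracket_self, map_zero])
  jacobi h₁ h₂ h₃ := ε.ham_injective (by
    simp only [map_add, ham_bracket, hΩ.bracket_jacobi, map_zero])
  symbol := ε.symbol Ω
  isSmoothField_symbol := ε.isSmoothField_symbol hΩ
  bracket_mul _ hf _ _ h₂ hk := ε.bracket_mul hΩ hf h₂ hk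

section Iso

variable {EB' B' : Type*} [NormedAddCommGroup EB'] [NormedSpace ℝ EB'] [TopologicalSpace B']
  [ChartedSpace EB' B'] {V' : B' → Type*} [∀ b, AddCommGroup (V' b)] [∀ b, Module ℝ (V' b)]
  [∀ b, TopologicalSpace (V' b)] [TopologicalSpace (TotalSpace ℝ V')] [FiberBundle ℝ V']
  [VectorBundle ℝ ℝ V'] [ContMDiffVectorBundle ∞ ℝ V' 𝓘(ℝ, EB')]
  (ε' : EquivariantFrame E EB' (M := M) V' χ)

theorem bracket_pullback (h k : dualSections EB' V') :
    ε.bracket hΩ ((ε.lineBundleIso ε').pullback h) ((ε.lineBundleIso ε').pullback k) =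
      (ε.lineBundleIso ε').pullback (ε'.bracket hΩ h k) :=
  ε.ham_injective (by simp only [ham_bracket, ham_pullback])

theorem mfderiv_symbol {h : dualSections EB V} {h' : dualSections EB' V'}
    (hh : ε.ham h = ε'.ham h') (b : B) :
    mfderiv 𝓘(ℝ, EB) 𝓘(ℝ, EB') (ε.lineBundleIso ε').base b (ε.symbol Ω h b) =
      ε'.symbol Ω h' ((ε.lineBundleIso ε').base b) := by
  obtain ⟨x, rfl⟩ := ε.proj_surjective b
  have tmap_base := tmap_comp ((ε.contMDiff_baseMap ε').mdifferentiable (by simp) (ε.proj x))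
    (ε.contMDiff_proj.mdifferentiable (by simp) x) rfl
  simp only [baseMap_proj] at tmap_base
  have symbol_base : (ε'.symbol Ω h' (ε.baseMap ε' (ε.proj x)) : EB') =
      tmap E EB' ε'.proj x (Ω.hamiltonianField (-(ε.ham h).1) x) := by
    rw [baseMap_proj, hh, ε'.symbol_proj hΩ]
  refine (congrArg (tmap EB EB' (ε.baseMap ε') (ε.proj x)) (ε.symbol_proj hΩ h x)).trans ?_
  exact (congrArg (fun L : E →L[ℝ] EB' => L _) tmap_base).symm.trans symbol_base.symm

end Iso

end EquivariantFrame

end Conformal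

section Frames

theorem orb_smul {G M : Type*} [Group G] [MulAction G M] (g : G) (x : M) :
    orb G (g • x) = orb G x :=
  orb_eq_orb.mpr ⟨g, rfl⟩

theorem exists_smul_smul_eq_of_orb_orb_eq {G H M : Type*} [Group G] [Group H] [MulAction G M]
    [MulAction H M] [SMulCommClass G H M] {x y : M} (h : orb H (orb G x) = orb H (orb G y)) :
    ∃ (k : H) (g : G), g • k • y = x := by
  obtain ⟨k, hk⟩ := orb_eq_orb.mp h
  obtain ⟨g, hg⟩ := orb_eq_orb.mp hk.symm
  exact ⟨k, g, hg⟩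

theorem IsPrincipalAction.exists_div_section {EG E EB G M : Type*} [NormedAddCommGroup EG]
    [NormedSpace ℝ EG] [NormedAddCommGroup E] [NormedSpace ℝ E] [NormedAddCommGroup EB]
    [NormedSpace ℝ EB] [Group G] [TopologicalSpace G] [ChartedSpace EG G] [LieGroup 𝓘(ℝ, EG) ∞ G]
    [TopologicalSpace M] [ChartedSpace E M] [MulAction G M] [ChartedSpace EB (Orb G M)]
    (h : IsPrincipalAction EG E EB G M) {U : Set (Orb G M)} (hU : IsOpen U) {σ : Orb G M → M}
    (hσ : ∀ c, orb G (σ c) = c) (hσU : ContMDiffOn 𝓘(ℝ, EB) 𝓘(ℝ, E) ∞ σ U) :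
    ∃ g : M → G, ContMDiffOn 𝓘(ℝ, E) 𝓘(ℝ, EG) ∞ g (orb G ⁻¹' U) ∧
      ∀ x ∈ orb G ⁻¹' U, x = g x • σ (orb G x) :=
  h.exists_div (hU.preimage h.contMDiff_orb.continuous)
    (hσU.comp h.contMDiff_orb.contMDiffOn fun _ hx => hx) contMDiff_id.contMDiffOn
    fun _ _ => hσ _

theorem LineFrames.contMDiff_mk {EB B : Type*} [NormedAddCommGroup EB] [NormedSpace ℝ EB]
    [TopologicalSpace B] [ChartedSpace EB B] {V : B → Type*} [∀ b, AddCommGroup (V b)]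
    [∀ b, Module ℝ (V b)] [∀ b, TopologicalSpace (V b)] (Φ : LineFrames EB V) {EN HN N : Type*}
    [NormedAddCommGroup EN] [NormedSpace ℝ EN] [TopologicalSpace HN]
    {I : ModelWithCorners ℝ EN HN} [TopologicalSpace N] [ChartedSpace HN N] {f : N → B}
    {v : ∀ x, V (f x)} (hf : ContMDiff I 𝓘(ℝ, EB) ∞ f)
    (hv : ∀ x, ContMDiffAt I 𝓘(ℝ, ℝ) ∞ (fun y => Φ.coord (f x) (f y) (v y)) x) :
    letI := Φ.prebundle.totalSpaceTopology
    letI := Φ.prebundle.toFiberBundle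
    ContMDiff I (𝓘(ℝ, EB).prod 𝓘(ℝ, ℝ)) ∞ (fun x => (⟨f x, v x⟩ : TotalSpace ℝ V)) :=
  letI := Φ.prebundle.totalSpaceTopology
  letI := Φ.prebundle.toFiberBundle
  fun x => contMDiffAt_totalSpace.mpr ⟨hf x, hv x⟩

namespace AssocFiber

variable {Γ : Subgroup ℝˣ} [Fact (Γ = ⊤ ∨ Γ = Units.posSubgroup ℝ)]
  {E EB M : Type*} [NormedAddCommGroup E] [NormedSpace ℝ E] [NormedAddCommGroup EB]
  [NormedSpace ℝ EB] [TopologicalSpace M] [ChartedSpace E M] [MulAction Γ M]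
  [ChartedSpace EB (Orb Γ M)] (h : IsPrincipalAction ℝ E EB Γ M)

theorem totalSpaceMk_eq_mkAt {x : M} {k : Orb Γ M} (hx : orb Γ x = k) (t : ℝ) :
    (⟨orb Γ x, mk h x t⟩ : TotalSpace ℝ (AssocFiber h)) = ⟨k, mkAt h x k hx t⟩ := by
  subst hx
  rfl

theorem fiberSMul_mk_one (x : M) (t : ℝ) :
    fiberSMul t (⟨orb Γ x, mk h x 1⟩ : TotalSpace ℝ (AssocFiber h)) = ⟨orb Γ x, mk h x t⟩ := by
  refine congrArg (TotalSpace.mk _) ?_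
  change t • mkAt h x _ rfl 1 = mkAt h x _ rfl t
  rw [← coord_symm, ← coord_symm, ← map_smul, smul_eq_mul, mul_one]

theorem mk_one_ne_zero (x : M) : mk h x 1 ≠ 0 := by
  change mkAt h x _ rfl 1 ≠ 0
  rw [← coord_symm]
  exact (map_ne_zero_iff _ (coord h x _ rfl).symm.injective).mpr one_ne_zero

theorem mk_smul_one (s : Γ) (x : M) :
    (⟨orb Γ (s • x), mk h (s • x) 1⟩ : TotalSpace ℝ (AssocFiber h)) =
      fiberSMul (scalingCoord s) ⟨orb Γ x, mk h x 1⟩ := by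
  rw [fiberSMul_mk_one, totalSpaceMk_eq_mkAt h (orb_smul s x),
    mkAt_eq h x (s • x) _ rfl _ s rfl, one_mul]
  rfl

variable [IsManifold 𝓘(ℝ, EB) ∞ (Orb Γ M)]

theorem contMDiff_mk_one : ContMDiff 𝓘(ℝ, E) (𝓘(ℝ, EB).prod 𝓘(ℝ, ℝ)) ∞
    (fun x => (⟨orb Γ x, mk h x 1⟩ : TotalSpace ℝ (AssocFiber h))) := by
  refine (frames h).contMDiff_mk h.contMDiff_orb fun x => ?_
  obtain ⟨hU, hxU, hσ⟩ := (h.locally_trivial (orb Γ x)).choose_spec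
  obtain ⟨orb_σ, hσU, -⟩ := hσ.choose_spec
  obtain ⟨s, hs, eq_smul⟩ := h.exists_div_section hU orb_σ hσU
  have hU' := (hU.preimage h.contMDiff_orb.continuous).mem_nhds hxU
  refine ((contMDiff_scalingCoord Γ).contMDiffAt.comp x (hs.contMDiffAt hU')).congr_of_eventuallyEq
    ?_
  filter_upwards [hU'] with y hy
  change coord h _ (orb Γ y) (orb_σ _) (mkAt h y _ rfl 1) = scalingCoord (s y)
  rw [mkAt_eq h _ y _ (orb_σ _) rfl (s y) (eq_smul y hy), coord_mkAt, one_mul]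

end AssocFiber

end Frames

section Pair

/-- The weight on `G × Γ` for which functions are homogeneous when they are invariant under `G` and
homogeneous under `Γ`. -/
def pairWeight {G : Type*} {Γ : Subgroup ℝˣ} (p : G × Γ) : ℝ := scalingCoord p.2

attribute [local instance] MulAction.prodOfSMulCommClass

theorem homogeneous_scaling_of_homogeneous_pair {E S G : Type*} {Γ : Subgroup ℝˣ}
    [NormedAddCommGroup E] [NormedSpace ℝ E] [TopologicalSpace S] [ChartedSpace E S] [Group G]
    [MulAction G S] [MulAction Γ S] [SMulCommClass G Γ S] {F : S → ℝ}
    (hF : F ∈ homogeneousFunctions E (pairWeight : G × Γ → ℝ)) :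
    F ∈ homogeneousFunctions E (scalingCoord : Γ → ℝ) :=
  ⟨hF.1, fun s x => (one_smul G (s • x)) ▸ hF.2 (1, s) x⟩

end Pair

namespace CompatibleSystem

variable {E E₁ E₂ E₃ E₄ EG S G : Type*} {Γ : Subgroup ℝˣ} [Fact (Γ = ⊤ ∨ Γ = Units.posSubgroup ℝ)]
  [NormedAddCommGroup E] [NormedSpace ℝ E] [NormedAddCommGroup E₁] [NormedSpace ℝ E₁]
  [NormedAddCommGroup E₂] [NormedSpace ℝ E₂] [NormedAddCommGroup E₃] [NormedSpace ℝ E₃]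
  [NormedAddCommGroup E₄] [NormedSpace ℝ E₄] [NormedAddCommGroup EG] [NormedSpace ℝ EG]
  [TopologicalSpace S] [ChartedSpace E S] [IsManifold 𝓘(ℝ, E) ∞ S]
  [Group G] [TopologicalSpace G] [ChartedSpace EG G]
  [MulAction G S] [MulAction Γ S] [SMulCommClass G Γ S] [SMulCommClass Γ G S]
  [ChartedSpace E₁ (Orb G S)] [ChartedSpace E₂ (Orb Γ S)]
  [ChartedSpace E₃ (Orb Γ (Orb G S))] [ChartedSpace E₄ (Orb G (Orb Γ S))]
  (sys : CompatibleSystem E E₁ E₂ E₃ E₄ EG S G Γ)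

section Scaling

theorem isConformal_scaling : sys.sympl.IsConformal (scalingCoord : Γ → ℝ) where
  contMDiff_smul := sys.principal_scaling.contMDiff_const_smul
  ne_zero := scalingCoord_ne_zero
  form_smul := sys.form_scaling

theorem totalSpaceMk_covector_eq {x : S} {c : Orb Γ S} (hx : orb Γ x = c) :
    (⟨orb Γ x, sys.covector x⟩ : TotalSpace ℝ sys.AnnFiber) = ⟨c, sys.covectorAt x c hx⟩ := by
  subst hx
  rfl

theorem mk_covector_smul (s : Γ) (x : S) :
    (⟨orb Γ (s • x), sys.covector (s • x)⟩ : TotalSpace ℝ sys.AnnFiber) =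
      fiberSMul (scalingCoord s) ⟨orb Γ x, sys.covector x⟩ := by
  rw [sys.totalSpaceMk_covector_eq (orb_smul s x), sys.covectorAt_smul x (s • x) _ rfl _ s rfl]
  rfl

theorem contMDiff_mk_covector : ContMDiff 𝓘(ℝ, E) (𝓘(ℝ, E₂).prod 𝓘(ℝ, ℝ)) ∞
    (fun x => (⟨orb Γ x, sys.covector x⟩ : TotalSpace ℝ sys.AnnFiber)) := by
  have h := sys.principal_scaling
  refine sys.annFrames.contMDiff_mk h.contMDiff_orb fun x => ?_
  obtain ⟨hU, hxU, hσ⟩ := (h.locally_trivial (orb Γ x)).choose_spec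
  obtain ⟨orb_σ, hσU, -⟩ := hσ.choose_spec
  obtain ⟨s, hs, eq_smul⟩ := h.exists_div_section hU orb_σ hσU
  have hU' := (hU.preimage h.contMDiff_orb.continuous).mem_nhds hxU
  refine ((contMDiff_scalingCoord Γ).contMDiffAt.comp x (hs.contMDiffAt hU')).congr_of_eventuallyEq
    ?_
  filter_upwards [hU'] with y hy
  have coord_eq := sys.coordAt_coordAt_symm _ y (orb Γ y) (orb_σ _) rfl (s y) (eq_smul y hy) 1
  rwa [coordAt_symm, one_smul, mul_one] at coord_eq

/-- The frame `x ↦ α_x` of `𝒟°`. -/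
noncomputable def frameC :
    EquivariantFrame E E₂ (M := S) sys.AnnFiber (scalingCoord : Γ → ℝ) where
  proj := orb Γ
  vec := sys.covector
  contMDiff_mk := sys.contMDiff_mk_covector
  vec_ne_zero x := sys.covectorAt_ne_zero x _ rfl
  exists_section b :=
    let ⟨U, hU, hbU, σ, hσ, hσU, _⟩ := sys.principal_scaling.locally_trivial b
    ⟨U, hU, hbU, σ, hσ, hσU⟩
  mk_smul := sys.mk_covector_smul
  exists_smul_eq _ _ h := orb_eq_orb.mp h

end Scaling

section Pair

attribute [local instance] MulAction.prodOfSMulCommClass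

theorem isConformal_pair : sys.sympl.IsConformal (pairWeight : G × Γ → ℝ) where
  contMDiff_smul p := (sys.principal_symmetry.contMDiff_const_smul p.1).comp
    (sys.principal_scaling.contMDiff_const_smul p.2)
  ne_zero p := scalingCoord_ne_zero p.2
  form_smul p x v w := by
    have tmap_smul : tmap E E (fun y : S => p.1 • p.2 • y) x = _ := tmap_comp
      ((sys.principal_symmetry.contMDiff_const_smul p.1).mdifferentiable (by simp) (p.2 • x))
      ((sys.principal_scaling.contMDiff_const_smul p.2).mdifferentiable (by simp) x) rfl
    change sys.sympl.form (p.1 • p.2 • x) (tmap E E (fun y : S => p.1 • p.2 • y) x v)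
      (tmap E E (fun y : S => p.1 • p.2 • y) x w) = _
    rw [tmap_smul]
    exact (sys.form_symmetry p.1 (p.2 • x) _ _).trans (sys.form_scaling p.2 x v w)

include sys in
theorem exists_local_lift_lineL (b : Orb Γ (Orb G S)) :
    ∃ U : Set (Orb Γ (Orb G S)), IsOpen U ∧ b ∈ U ∧ ∃ ξ : Orb Γ (Orb G S) → S,
      (∀ c, orb Γ (orb G (ξ c)) = c) ∧ ContMDiffOn 𝓘(ℝ, E₃) 𝓘(ℝ, E) ∞ ξ U := by
  obtain ⟨V, hV, hbV, τ, orb_τ, hτ, -⟩ := sys.principal_scaling_quotient.locally_trivial b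
  obtain ⟨U, hU, hbU, σ, orb_σ, hσ, -⟩ := sys.principal_symmetry.locally_trivial (τ b)
  refine ⟨V ∩ τ ⁻¹' U, hτ.continuousOn.isOpen_inter_preimage hV hU, ⟨hbV, hbU⟩, σ ∘ τ,
    fun c => by rw [Function.comp_apply, orb_σ, orb_τ], ?_⟩
  exact hσ.comp (hτ.mono Set.inter_subset_left) fun c hc => hc.2

/-- The frame `x ↦ [([x], 1)]` of `L`. -/
noncomputable def frameL [IsManifold 𝓘(ℝ, E₃) ∞ (Orb Γ (Orb G S))] :
    EquivariantFrame E E₃ (M := S) sys.LineL (pairWeight : G × Γ → ℝ) where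
  proj x := orb Γ (orb G x)
  vec x := AssocFiber.mk sys.principal_scaling_quotient (orb G x) 1
  contMDiff_mk := (AssocFiber.contMDiff_mk_one _).comp sys.principal_symmetry.contMDiff_orb
  vec_ne_zero _ := AssocFiber.mk_one_ne_zero _ _
  exists_section := sys.exists_local_lift_lineL
  mk_smul p x := by
    have orb_pair_smul : orb G (p • x) = p.2 • orb G x := orb_smul p.1 (p.2 • x)
    rw [orb_pair_smul]
    exact AssocFiber.mk_smul_one _ p.2 (orb G x)
  exists_smul_eq _ _ h :=
    let ⟨s, g, hx⟩ := exists_smul_smul_eq_of_orb_orb_eq h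
    ⟨(g, s), hx⟩

include sys in
theorem exists_div_lift [LieGroup 𝓘(ℝ, EG) ∞ G] {U : Set (Orb G (Orb Γ S))} (hU : IsOpen U)
    {ξ : Orb G (Orb Γ S) → S} (hξ : ∀ c, orb G (orb Γ (ξ c)) = c)
    (hξU : ContMDiffOn 𝓘(ℝ, E₄) 𝓘(ℝ, E) ∞ ξ U) :
    ∃ (g : S → G) (s : S → Γ),
      ContMDiffOn 𝓘(ℝ, E) 𝓘(ℝ, ℝ) ∞ s ((fun x => orb G (orb Γ x)) ⁻¹' U) ∧
      ∀ x, orb G (orb Γ x) ∈ U → x = s x • g x • ξ (orb G (orb Γ x)) := by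
  have h := sys.principal_scaling
  have contMDiff_orb_orb : ContMDiff 𝓘(ℝ, E) 𝓘(ℝ, E₄) ∞ (fun x : S => orb G (orb Γ x)) :=
    sys.principal_symmetry_quotient.contMDiff_orb.comp h.contMDiff_orb
  have hU' := hU.preimage contMDiff_orb_orb.continuous
  have hξ' := hξU.comp contMDiff_orb_orb.contMDiffOn fun _ hx => hx
  obtain ⟨g, hg, orb_eq⟩ := sys.principal_symmetry_quotient.exists_div hU'
    (h.contMDiff_orb.comp_contMDiffOn hξ') h.contMDiff_orb.contMDiffOn fun _ _ => hξ _
  obtain ⟨s, hs, eq_smul⟩ := h.exists_div hU'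
    (sys.principal_symmetry.contMDiff_smul.comp_contMDiffOn (hg.prodMk hξ'))
    contMDiff_id.contMDiffOn fun x hx => (orb_eq x hx).symm
  exact ⟨g, s, hs, eq_smul⟩

section Quotient

variable [IsManifold 𝓘(ℝ, E₂) ∞ (Orb Γ S)]

theorem annMk_covector {x : S} {b : Orb G (Orb Γ S)} (hx : orb G (orb Γ x) = b) (t : ℝ) :
    (⟨orb G (orb Γ x), sys.annMk (orb Γ x) (t • sys.covector x)⟩ : TotalSpace ℝ sys.AnnQuot) =
      ⟨b, (AnnQuot.coordAt sys x b hx).symm t⟩ := by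
  subst hx
  rw [AnnQuot.coordAt_symm]
  rfl

theorem annMk_smul_covector (x : S) (t : ℝ) : sys.annMk (orb Γ x) (t • sys.covector x) =
    t • sys.annMk (orb Γ x) (sys.covector x) := by
  have annMk_eq : ∀ t, sys.annMk (orb Γ x) (t • sys.covector x) =
      (AnnQuot.coordAt sys x _ rfl).symm t := fun t => (AnnQuot.coordAt_symm sys x _ rfl t).symm
  have annMk_one := annMk_eq 1
  rw [one_smul] at annMk_one
  rw [annMk_eq, annMk_one, ← map_smul, smul_eq_mul, mul_one]

theorem annMk_covector_ne_zero (x : S) : sys.annMk (orb Γ x) (sys.covector x) ≠ 0 := by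
  have coord_symm := AnnQuot.coordAt_symm sys x _ rfl 1
  rw [one_smul] at coord_symm
  change AnnQuot.mkAt sys (orb Γ x) _ rfl (sys.covector x) ≠ 0
  exact coord_symm ▸ (map_ne_zero_iff _ (AnnQuot.coordAt sys x _ rfl).symm.injective).mpr
    one_ne_zero

theorem mk_annMk_covector_smul (p : G × Γ) (x : S) :
    (⟨orb G (orb Γ (p • x)), sys.annMk (orb Γ (p • x)) (sys.covector (p • x))⟩ :
      TotalSpace ℝ sys.AnnQuot) =
    fiberSMul (pairWeight p) ⟨orb G (orb Γ x), sys.annMk (orb Γ x) (sys.covector x)⟩ := by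
  have hp : p • x = p.2 • p.1 • x := smul_comm p.1 p.2 x
  have orb_orb_smul : orb G (orb Γ (p • x)) = orb G (orb Γ x) :=
    (congrArg (orb G) (hp ▸ orb_smul p.2 (p.1 • x))).trans (orb_smul p.1 (orb Γ x))
  have annMk_eq := sys.annMk_covector orb_orb_smul 1
  rw [one_smul] at annMk_eq
  rw [annMk_eq, fiberSMul, ← annMk_smul_covector, sys.annMk_covector rfl]
  refine congrArg _ ?_
  rw [ContinuousLinearEquiv.eq_symm_apply,
    AnnQuot.coordAt_coordAt_symm sys x (p • x) _ rfl orb_orb_smul p.1 p.2 hp, mul_one]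
  rfl

variable [LieGroup 𝓘(ℝ, EG) ∞ G]

theorem contMDiff_mk_annMk_covector : ContMDiff 𝓘(ℝ, E) (𝓘(ℝ, E₄).prod 𝓘(ℝ, ℝ)) ∞
    (fun x => (⟨orb G (orb Γ x), sys.annMk (orb Γ x) (sys.covector x)⟩ :
      TotalSpace ℝ sys.AnnQuot)) := by
  have contMDiff_orb_orb : ContMDiff 𝓘(ℝ, E) 𝓘(ℝ, E₄) ∞ (fun x : S => orb G (orb Γ x)) :=
    sys.principal_symmetry_quotient.contMDiff_orb.comp sys.principal_scaling.contMDiff_orb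
  refine sys.annQuotFrames.contMDiff_mk contMDiff_orb_orb fun x => ?_
  obtain ⟨hU, hxU, hξ⟩ := (sys.exists_local_lift (orb G (orb Γ x))).choose_spec
  obtain ⟨orb_ξ, hξU⟩ := hξ.choose_spec
  obtain ⟨g, s, hs, eq_smul⟩ := sys.exists_div_lift hU orb_ξ hξU
  have hU' := (hU.preimage contMDiff_orb_orb.continuous).mem_nhds hxU
  refine ((contMDiff_scalingCoord Γ).contMDiffAt.comp x (hs.contMDiffAt hU')).congr_of_eventuallyEq
    ?_
  filter_upwards [hU'] with y hy
  have coord_eq := AnnQuot.coordAt_coordAt_symm sys _ y _ (orb_ξ _) rfl (g y) (s y)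
    (eq_smul y hy) 1
  rwa [AnnQuot.coordAt_symm, one_smul, mul_one] at coord_eq

/-- The frame `x ↦ [α_x]` of `𝒟°/G`. -/
noncomputable def frameCG :
    EquivariantFrame E E₄ (M := S) sys.AnnQuot (pairWeight : G × Γ → ℝ) where
  proj x := orb G (orb Γ x)
  vec x := sys.annMk (orb Γ x) (sys.covector x)
  contMDiff_mk := sys.contMDiff_mk_annMk_covector
  vec_ne_zero := sys.annMk_covector_ne_zero
  exists_section := sys.exists_local_lift
  mk_smul := sys.mk_annMk_covector_smul
  exists_smul_eq _ y h :=
    let ⟨g, s, hx⟩ := exists_smul_smul_eq_of_orb_orb_eq h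
    ⟨(g, s), (smul_comm g s y).trans hx⟩

theorem induces_iff (h : dualSections E₂ sys.AnnFiber) (k : dualSections E₄ sys.AnnQuot) :
    sys.Induces h k ↔ (sys.frameCG.ham k).1 = (sys.frameC.ham h).1 := by
  refine ⟨fun hI => funext fun x => hI (orb Γ x) (sys.covector x), fun ham_eq c α => ?_⟩
  obtain ⟨x, rfl⟩ := Quotient.exists_rep c
  obtain ⟨t, rfl⟩ := sys.exists_eq_smul_covectorAt x _ rfl α
  calc k.1 _ (sys.annMk (orb Γ x) (t • sys.covector x))
      = t * (sys.frameCG.ham k).1 x :=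
        (congrArg (k.1 _) (sys.annMk_smul_covector x t)).trans (map_smul (k.1 _) t _)
    _ = t * (sys.frameC.ham h).1 x := by rw [ham_eq]
    _ = h.1 (orb Γ x) (t • sys.covector x) := (map_smul (h.1 _) t (sys.covector x)).symm

end Quotient

/-- The Hamiltonian as a homogeneous function. -/
def homogeneousHam : homogeneousFunctions (M := S) E (scalingCoord : Γ → ℝ) :=
  ⟨sys.ham, sys.contMDiff_ham, sys.ham_scaling⟩

/-- The Hamiltonian as a homogeneous and `G`-invariant function. -/
def invariantHam : homogeneousFunctions (M := S) E (pairWeight : G × Γ → ℝ) :=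
  ⟨sys.ham, sys.contMDiff_ham, fun p x =>
    (sys.ham_symmetry p.1 (p.2 • x)).trans (sys.ham_scaling p.2 x)⟩

section L

variable [IsManifold 𝓘(ℝ, E₃) ∞ (Orb Γ (Orb G S))]

/-- The section `h_{H^G}` of `L^*`. -/
noncomputable def hamSectionL : dualSections E₃ sys.LineL :=
  sys.frameL.hamEquiv.symm sys.invariantHam

theorem ham_hamSectionL : sys.frameL.ham sys.hamSectionL = sys.invariantHam :=
  sys.frameL.hamEquiv.apply_symm_apply _

theorem hamL_hamSectionL : sys.hamL sys.hamSectionL = sys.reducedHam := by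
  funext y
  obtain ⟨x, rfl⟩ := Quotient.exists_rep y
  exact congrFun (congrArg Subtype.val sys.ham_hamSectionL) x

variable [FiniteDimensional ℝ E]

/-- The Kirillov structure on `L`. -/
noncomputable def kirillovL : KirillovStructure E₃ sys.LineL :=
  sys.frameL.kirillovStructure sys.isConformal_pair

theorem hamL_bracket (h k : dualSections E₃ sys.LineL) : sys.hamL (sys.kirillovL.bracket h k) =
    -sys.reducedPoisson (sys.hamL h) (sys.hamL k) := by
  funext y
  obtain ⟨x, rfl⟩ := Quotient.exists_rep y
  have ham_bracket := congrArg Subtype.val (sys.frameL.ham_bracket sys.isConformal_pair h k)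
  rw [SymplecticForm.IsConformal.bracket_coe] at ham_bracket
  exact congrFun ham_bracket x

end L

section C

variable [IsManifold 𝓘(ℝ, E₂) ∞ (Orb Γ S)]

/-- The section `h_H` of `(𝒟°)^*`. -/
noncomputable def hamSectionC : dualSections E₂ sys.AnnFiber :=
  sys.frameC.hamEquiv.symm sys.homogeneousHam

theorem ham_hamSectionC : sys.frameC.ham sys.hamSectionC = sys.homogeneousHam :=
  sys.frameC.hamEquiv.apply_symm_apply _

theorem hamC_hamSectionC : sys.hamC sys.hamSectionC = sys.ham :=
  congrArg Subtype.val sys.ham_hamSectionC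

variable [FiniteDimensional ℝ E]

/-- The Kirillov structure on `𝒟°`. -/
noncomputable def kirillovC : KirillovStructure E₂ sys.AnnFiber :=
  sys.frameC.kirillovStructure sys.isConformal_scaling

theorem hamC_bracket (h k : dualSections E₂ sys.AnnFiber) : sys.hamC (sys.kirillovC.bracket h k) =
    -sys.sympl.poisson (sys.hamC h) (sys.hamC k) :=
  (congrArg Subtype.val (sys.frameC.ham_bracket sys.isConformal_scaling h k)).trans
    (sys.isConformal_scaling.bracket_coe _ _)

end C

section CG

variable [LieGroup 𝓘(ℝ, EG) ∞ G] [IsManifold 𝓘(ℝ, E₂) ∞ (Orb Γ S)]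

theorem exists_induces (k : dualSections E₄ sys.AnnQuot) : ∃ h, sys.Induces h k := by
  obtain ⟨h, hh⟩ := sys.frameC.ham_surjective
    ⟨_, homogeneous_scaling_of_homogeneous_pair (sys.frameCG.ham k).2⟩
  exact ⟨h, (sys.induces_iff h k).mpr (congrArg Subtype.val hh).symm⟩

variable [IsManifold 𝓘(ℝ, E₄) ∞ (Orb G (Orb Γ S))]

/-- The section `h_H^G` of `(𝒟°/G)^*`. -/
noncomputable def hamSectionCG : dualSections E₄ sys.AnnQuot :=
  sys.frameCG.hamEquiv.symm sys.invariantHam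

theorem ham_hamSectionCG : sys.frameCG.ham sys.hamSectionCG = sys.invariantHam :=
  sys.frameCG.hamEquiv.apply_symm_apply _

theorem induces_hamSection : sys.Induces sys.hamSectionC sys.hamSectionCG := by
  rw [induces_iff, ham_hamSectionC, ham_hamSectionCG]
  rfl

section Bracket

variable [FiniteDimensional ℝ E]

/-- The Kirillov structure on `𝒟°/G`. -/
noncomputable def kirillovCG : KirillovStructure E₄ sys.AnnQuot :=
  sys.frameCG.kirillovStructure sys.isConformal_pair

theorem induces_bracket {h₁ h₂ : dualSections E₂ sys.AnnFiber}
    {k₁ k₂ : dualSections E₄ sys.AnnQuot} (hk₁ : sys.Induces h₁ k₁) (hk₂ : sys.Induces h₂ k₂) :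
    sys.Induces (sys.kirillovC.bracket h₁ h₂) (sys.kirillovCG.bracket k₁ k₂) := by
  rw [induces_iff] at hk₁ hk₂ ⊢
  have ham_bracketCG := congrArg Subtype.val (sys.frameCG.ham_bracket sys.isConformal_pair k₁ k₂)
  have ham_bracketC := congrArg Subtype.val (sys.frameC.ham_bracket sys.isConformal_scaling h₁ h₂)
  rw [SymplecticForm.IsConformal.bracket_coe] at ham_bracketCG ham_bracketC
  rw [hk₁, hk₂] at ham_bracketCG
  exact ham_bracketCG.trans ham_bracketC.symm

end Bracket

variable [IsManifold 𝓘(ℝ, E₃) ∞ (Orb Γ (Orb G S))]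

/-- The isomorphism `(Ψ, ψ)` from `L` to `𝒟°/G`. -/
noncomputable def reductionIso : LineBundleIso E₃ E₄ sys.LineL sys.AnnQuot :=
  sys.frameL.lineBundleIso sys.frameCG

theorem reductionIso_total_mk (x : S) (t : ℝ) :
    sys.reductionIso.total ⟨orb Γ (orb G x), AssocFiber.mk _ (orb G x) t⟩ =
      ⟨orb G (orb Γ x), sys.annMk (orb Γ x) (t • sys.covector x)⟩ := by
  rw [← AssocFiber.fiberSMul_mk_one, annMk_smul_covector]
  exact sys.frameL.lineBundleIso_total_fiberSMul sys.frameCG t x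

theorem hamSectionL_eq_pullback : sys.hamSectionL = sys.reductionIso.pullback sys.hamSectionCG := by
  refine sys.frameL.ham_injective ?_
  rw [reductionIso, EquivariantFrame.ham_pullback, ham_hamSectionL, ham_hamSectionCG]

variable [FiniteDimensional ℝ E]

theorem kirillovL_bracket_pullback (k₁ k₂ : dualSections E₄ sys.AnnQuot) :
    sys.kirillovL.bracket (sys.reductionIso.pullback k₁) (sys.reductionIso.pullback k₂) =
      sys.reductionIso.pullback (sys.kirillovCG.bracket k₁ k₂) :=
  sys.frameL.bracket_pullback sys.isConformal_pair sys.frameCG k₁ k₂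

theorem mfderiv_symbol_hamSectionL (b : Orb Γ (Orb G S)) :
    mfderiv 𝓘(ℝ, E₃) 𝓘(ℝ, E₄) sys.reductionIso.base b (sys.kirillovL.symbol sys.hamSectionL b) =
      sys.kirillovCG.symbol sys.hamSectionCG (sys.reductionIso.base b) :=
  sys.frameL.mfderiv_symbol sys.isConformal_pair sys.frameCG
    (sys.ham_hamSectionL.trans sys.ham_hamSectionCG.symm) b

end CG

end Pair

end CompatibleSystem

theorem mainTheorem5_general {E E₁ E₂ E₃ E₄ EG S G : Type*}
    [NormedAddCommGroup E] [NormedSpace ℝ E] [FiniteDimensional ℝ E]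
    [NormedAddCommGroup E₁] [NormedSpace ℝ E₁] [NormedAddCommGroup E₂] [NormedSpace ℝ E₂]
    [NormedAddCommGroup E₃] [NormedSpace ℝ E₃] [NormedAddCommGroup E₄] [NormedSpace ℝ E₄]
    [NormedAddCommGroup EG] [NormedSpace ℝ EG]
    [TopologicalSpace S] [ChartedSpace E S] [IsManifold 𝓘(ℝ, E) ∞ S]
    [Group G] [TopologicalSpace G] [ChartedSpace EG G] [LieGroup 𝓘(ℝ, EG) ∞ G]
    (Γ : Subgroup ℝˣ) [Fact (Γ = ⊤ ∨ Γ = Units.posSubgroup ℝ)]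
    [MulAction G S] [MulAction Γ S] [SMulCommClass G Γ S] [SMulCommClass Γ G S]
    [ChartedSpace E₁ (Orb G S)]
    [ChartedSpace E₂ (Orb Γ S)] [IsManifold 𝓘(ℝ, E₂) ∞ (Orb Γ S)]
    [ChartedSpace E₃ (Orb Γ (Orb G S))] [IsManifold 𝓘(ℝ, E₃) ∞ (Orb Γ (Orb G S))]
    [ChartedSpace E₄ (Orb G (Orb Γ S))] [IsManifold 𝓘(ℝ, E₄) ∞ (Orb G (Orb Γ S))]
    (sys : CompatibleSystem E E₁ E₂ E₃ E₄ EG S G Γ) :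
    ∃ (κL : KirillovStructure E₃ sys.LineL) (κC : KirillovStructure E₂ sys.AnnFiber)
      (κCG : KirillovStructure E₄ sys.AnnQuot)
      (hL : dualSections E₃ sys.LineL) (hC : dualSections E₂ sys.AnnFiber)
      (hCG : dualSections E₄ sys.AnnQuot)
      (Ψ : LineBundleIso E₃ E₄ sys.LineL sys.AnnQuot),
      (∀ h k, sys.hamL (κL.bracket h k) = -sys.reducedPoisson (sys.hamL h) (sys.hamL k)) ∧
      sys.hamL hL = sys.reducedHam ∧
      (∀ h k, sys.hamC (κC.bracket h k) = -sys.sympl.poisson (sys.hamC h) (sys.hamC k)) ∧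
      sys.hamC hC = sys.ham ∧
      (∀ k, ∃ h, sys.Induces h k) ∧
      (∀ h k h₂ k₂, sys.Induces h h₂ → sys.Induces k k₂ →
        sys.Induces (κC.bracket h k) (κCG.bracket h₂ k₂)) ∧
      sys.Induces hC hCG ∧
      (∀ (x : S) (t : ℝ), Ψ.total ⟨orb Γ (orb G x), AssocFiber.mk _ (orb G x) t⟩ =
        ⟨orb G (orb Γ x), sys.annMk (orb Γ x) (t • sys.covector x)⟩) ∧
      hL = Ψ.pullback hCG ∧
      (∀ h k, κL.bracket (Ψ.pullback h) (Ψ.pullback k) = Ψ.pullback (κCG.bracket h k)) ∧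
      (∀ b, mfderiv 𝓘(ℝ, E₃) 𝓘(ℝ, E₄) Ψ.base b (κL.symbol hL b) =
        κCG.symbol hCG (Ψ.base b)) :=
  ⟨sys.kirillovL, sys.kirillovC, sys.kirillovCG,
    sys.hamSectionL, sys.hamSectionC, sys.hamSectionCG, sys.reductionIso,
    sys.hamL_bracket, sys.hamL_hamSectionL,
    sys.hamC_bracket, sys.hamC_hamSectionC,
    sys.exists_induces, fun _ _ _ _ => sys.induces_bracket, sys.induces_hamSection,
    sys.reductionIso_total_mk, sys.hamSectionL_eq_pullback,
    sys.kirillovL_bracket_pullback, sys.mfderiv_symbol_hamSectionL⟩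

theorem mainTheorem5 {E E₁ E₂ E₃ E₄ EG S G : Type*}
    [NormedAddCommGroup E] [NormedSpace ℝ E] [FiniteDimensional ℝ E]
    [NormedAddCommGroup E₁] [NormedSpace ℝ E₁] [FiniteDimensional ℝ E₁]
    [NormedAddCommGroup E₂] [NormedSpace ℝ E₂] [FiniteDimensional ℝ E₂]
    [NormedAddCommGroup E₃] [NormedSpace ℝ E₃] [FiniteDimensional ℝ E₃]
    [NormedAddCommGroup E₄] [NormedSpace ℝ E₄] [FiniteDimensional ℝ E₄]
    [NormedAddCommGroup EG] [NormedSpace ℝ EG] [FiniteDimensional ℝ EG]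
    -- the symplectic manifold, the Lie group and the multiplicative group
    [TopologicalSpace S] [ChartedSpace E S] [IsManifold 𝓘(ℝ, E) ∞ S] [T2Space S]
    [SecondCountableTopology S]
    [Group G] [TopologicalSpace G] [ChartedSpace EG G] [LieGroup 𝓘(ℝ, EG) ∞ G]
    (Γ : Subgroup ℝˣ) [Fact (Γ = ⊤ ∨ Γ = Units.posSubgroup ℝ)]
    [MulAction G S] [MulAction Γ S] [SMulCommClass G Γ S] [SMulCommClass Γ G S]
    -- the manifolds `S/G`, `S/Γ`, `(S/G)/Γ`, `(S/Γ)/G`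
    [ChartedSpace E₁ (Orb G S)] [IsManifold 𝓘(ℝ, E₁) ∞ (Orb G S)] [T2Space (Orb G S)]
    [ChartedSpace E₂ (Orb Γ S)] [IsManifold 𝓘(ℝ, E₂) ∞ (Orb Γ S)] [T2Space (Orb Γ S)]
    [ChartedSpace E₃ (Orb Γ (Orb G S))] [IsManifold 𝓘(ℝ, E₃) ∞ (Orb Γ (Orb G S))]
    [T2Space (Orb Γ (Orb G S))]
    [ChartedSpace E₄ (Orb G (Orb Γ S))] [IsManifold 𝓘(ℝ, E₄) ∞ (Orb G (Orb Γ S))]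
    [T2Space (Orb G (Orb Γ S))]
    (sys : CompatibleSystem E E₁ E₂ E₃ E₄ EG S G Γ) :
    -- the Kirillov structures on `L`, `𝒟°`, `𝒟°/G`, the Hamiltonian sections, the isomorphism
    ∃ (κL : KirillovStructure E₃ sys.LineL) (κC : KirillovStructure E₂ sys.AnnFiber)
      (κCG : KirillovStructure E₄ sys.AnnQuot)
      (hL : dualSections E₃ sys.LineL) (hC : dualSections E₂ sys.AnnFiber)
      (hCG : dualSections E₄ sys.AnnQuot)
      (Ψ : LineBundleIso E₃ E₄ sys.LineL sys.AnnQuot),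
      -- the bracket and the section on `L` correspond to the Poisson bracket and to `H` on `S/G`
      (∀ h k, sys.hamL (κL.bracket h k) = -sys.reducedPoisson (sys.hamL h) (sys.hamL k)) ∧
      sys.hamL hL = sys.reducedHam ∧
      -- the bracket and the section on `𝒟°` correspond to the Poisson bracket and to `H` on `S`
      (∀ h k, sys.hamC (κC.bracket h k) = -sys.sympl.poisson (sys.hamC h) (sys.hamC k)) ∧
      sys.hamC hC = sys.ham ∧
      -- the bracket and the section on `𝒟°/G` are induced by those on `𝒟°`; every section of
      -- `(𝒟°/G)^*` is induced by a section of `(𝒟°)^*`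
      (∀ k, ∃ h, sys.Induces h k) ∧
      (∀ h k h₂ k₂, sys.Induces h h₂ → sys.Induces k k₂ →
        sys.Induces (κC.bracket h k) (κCG.bracket h₂ k₂)) ∧
      sys.Induces hC hCG ∧
      -- the isomorphism is `[[x], t] ↦ [t α_x]` over `[[x]] ↦ [[x]]`
      (∀ (x : S) (t : ℝ), Ψ.total ⟨orb Γ (orb G x), AssocFiber.mk _ (orb G x) t⟩ =
        ⟨orb G (orb Γ x), sys.annMk (orb Γ x) (t • sys.covector x)⟩) ∧
      -- it relates the Hamiltonian sections, the brackets and the Hamiltonian vector fields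
      hL = Ψ.pullback hCG ∧
      (∀ h k, κL.bracket (Ψ.pullback h) (Ψ.pullback k) = Ψ.pullback (κCG.bracket h k)) ∧
      (∀ b, mfderiv 𝓘(ℝ, E₃) 𝓘(ℝ, E₄) Ψ.base b (κL.symbol hL b) =
        κCG.symbol hCG (Ψ.base b)) :=
  mainTheorem5_general Γ sys
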